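/- Let $\eta,\tau\in\mathbb C$ with $\operatorname{Im}\eta>0$, $\operatorname{Im}\tau>0$, and put $p=e^{2\pi i\tau}$, $q=e^{4\pi i\eta}$, $Z=e^{2\pi i z}$, $(t;p)_\infty=\prod_{k\ge0}(1-tp^k)$, $\theta(t;p)=(t;p)_\infty(pt^{-1};p)_\infty$, $\theta(tZ^{\pm1};p)=\theta(tZ;p)\theta(tZ^{-1};p)$, $R(\tau)=e^{-\pi i\tau/4}/(i\,(p;p)_\infty)$. The Jacobi theta functions are $\theta_1(z|\tau)=-\sum_{n\in\mathbb Z}e^{\pi i(n+1/2)^2\tau}e^{2\pi i(n+1/2)(z+1/2)}$, $\theta_2(z|\tau)=\theta_1(z+\tfrac12|\tau)$, $\theta_3(z|\tau)=e^{\pi i\tau/4+\pi iz}\theta_2(z+\tfrac\tau2|\tau)$, $\theta_4(z|\tau)=\theta_3(z+\tfrac12|\tau)$, and the elliptic gamma function is $\Gamma(z)=\prod_{a,b\ge0}\frac{1-e^{-2\pi iz}p^{a+1}q^{b+1}}{1-e^{2\pi iz}p^aq^b}$. The intertwining operator is $$[\mathrm M(g)\Phi](z)=\frac{(q;q)_\infty(p;p)_\infty}{2}\int_0^1\frac{\Gamma(z+x-g)\Gamma(z-x-g)\Gamma(-z+x-g)\Gamma(-z-x-g)}{\Gamma(-2g)\Gamma(2x)\Gamma(-2x)}\Phi(x)\,dx,\qquad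 \operatorname{Im}(-g\pm z)>0,$$ and it is extended to other $g$ by meromorphic continuation in $g$ for fixed $z$; here $\Phi$ is an admissible test function, i.e. a meromorphic $1$-periodic function without poles on $\mathbb R$. For $s\in\{0,\tfrac12\}$, integers $n,m\ge0$ and $k\in\{3,4\}$, at $g=s+n\eta+m\tau/2$ it takes the form of the finite-difference operator $$\mathrm M^{(k)}(s+n\eta+m\tfrac\tau2)=\mathrm A_k(s+m\tfrac\tau2+(n-1)\eta)\cdots\mathrm A_k(s+m\tfrac\tau2)\,\mathrm B_k(s+(m-1)\tfrac\tau2)\cdots\mathrm B_k(s)\,\theta_k(z+s|\eta)^{-m}\theta_k(z+s|\tfrac\tau2)^{-n}e^{s\partial_z},$$ which acts on arbitrary functions of $z$, where $e^{a\partial_z}f(z)=f(z+a)$, $$\mathrm A_k(g)=\frac{e^{\pi i\eta}}{R(\tau)}\frac{e^{\pi iz^2/\eta}}{\theta_1(2z|\tau)}\bigl[\theta_k(z+g+\eta|\tfrac\tau2)e^{\eta\partial_z}-\theta_k(z-g-\eta|\tfrac\tau2)e^{-\eta\partial_z}\bigr]e^{-\pi iz^2/\eta},$$ and $\mathrm B_k(g)$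 is obtained from $\mathrm A_k(g)$ by exchanging $2\eta$ and $\tau$. A function $f$ is called a zero mode of $\mathrm M(g)$, $g=s+n\eta+m\tau/2$, if (i) $\mathrm M^{(k)}(g)f(z)=0$ for $k=3,4$ and every $z$ at which none of the denominators in $\mathrm M^{(k)}(g)f(z)$ vanishes; and (ii) if $1,2\eta,\tau$ are linearly independent over $\mathbb Z$ and $f$ is an admissible test function, then for every $z\notin\frac12\mathbb Z+\eta\mathbb Z+\frac\tau2\mathbb Z$ such that $f$ is analytic at all points of $\pm z+g+\eta\mathbb Z+\frac\tau2\mathbb Z$, the function $g'\mapsto[\mathrm M(g')f](z)$ continues meromorphically from the half-plane $\operatorname{Im}(-g'\pm z)>0$ to a half-plane $\{\operatorname{Im}g'<c\}$ containing $g$, and the continuation is regular at $g$ with value $0$. 1. Let $n,m>0$, $0\le j\le n-1$, $0\le\ell\le m-1$, and $$\varphi^{(n,m)}_{j,\ell}(z)=\theta_3(z|\tfrac\tau2)^j\,\theta_4(z|\tfrac\tau2)^{n-1-j}\,\theta_3(z|\eta)^\ell\,\theta_4(z|\eta)^{m-1-\ell}.$$ These functions are entire and $1$-periodic. For every function $\psi$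 with $\psi(z+2\eta)=\psi(z)$ or $\psi(z+\tau)=\psi(z)$ (in particular $\psi=1$), $\varphi^{(n,m)}_{j,\ell}\psi$ is a zero mode of $\mathrm M(n\eta+m\tau/2)$, and $\varphi^{(n,m)}_{n-1-j,m-1-\ell}\psi$ is a zero mode of $\mathrm M(\tfrac12+n\eta+m\tau/2)$. 2. Let $n>0$ and $0\le j\le n-1$. Then $\varphi_j^{(n)}(z)=\theta_3(z|\tfrac\tau2)^j\theta_4(z|\tfrac\tau2)^{n-1-j}/\theta(q^{-1/4}Z^{\pm1};q)$, with $q^{-1/4}=e^{-\pi i\eta}$, is an admissible test function, and $\varphi_j^{(n)}\psi$ is a zero mode of $\mathrm M(n\eta)$ for every $\psi$ with $\psi(z+2\eta)=\psi(z)$. 3. Let $m>0$ and $0\le\ell\le m-1$. Then $\theta_3(z|\eta)^\ell\theta_4(z|\eta)^{m-1-\ell}/\theta(p^{-1/4}Z^{\pm1};p)$, with $p^{-1/4}=e^{-\pi i\tau/2}$, is an admissible test function, and its product with $\psi$ is a zero mode of $\mathrm M(m\tau/2)$ for every $\psi$ with $\psi(z+\tau)=\psi(z)$. -/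

import Mathlib

open Complex Filter Topology

noncomputable section

namespace EllipticDouble

/-! ### Jacobi theta functions, infinite products, elliptic gamma function -/

/-- `θ₁(z|τ)`. -/
def theta1 (z τ : ℂ) : ℂ :=
  -∑' n : ℤ, exp (Real.pi * I * ((n : ℂ) + 1 / 2) ^ 2 * τ) *
    exp (2 * Real.pi * I * ((n : ℂ) + 1 / 2) * (z + 1 / 2))

/-- `θ₂(z|τ)`. -/
def theta2 (z τ : ℂ) : ℂ := theta1 (z + 1 / 2) τ

/-- `θ₃(z|τ)`. -/
def theta3 (z τ : ℂ) : ℂ :=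
  exp (Real.pi * I * τ / 4 + Real.pi * I * z) * theta2 (z + τ / 2) τ

/-- `θ₄(z|τ)`. -/
def theta4 (z τ : ℂ) : ℂ := theta3 (z + 1 / 2) τ

/-- `(t; p)_∞ = ∏_{k ≥ 0} (1 - t p^k)`. -/
def qPoch (t p : ℂ) : ℂ := ∏' k : ℕ, (1 - t * p ^ k)

/-- `θ(t; p) = (t; p)_∞ (p t⁻¹; p)_∞`. -/
def mTheta (t p : ℂ) : ℂ := qPoch t p * qPoch (p * t⁻¹) p

/-- `exp (2πiω)`: this is `p` for `ω = τ` and `q` for `ω = 2η`. -/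
def nome (ω : ℂ) : ℂ := exp (2 * Real.pi * I * ω)

/-- `R(τ) = p^{-1/8} / (i (p; p)_∞)`. -/
def Rconst (τ : ℂ) : ℂ := exp (-(Real.pi * I * τ / 4)) / (I * qPoch (nome τ) (nome τ))

/-- The elliptic gamma function `Γ(z | τ, 2η)`. -/
def eGamma (η τ z : ℂ) : ℂ :=
  ∏' k : ℕ × ℕ,
    (1 - exp (-(2 * Real.pi * I * z)) * nome τ ^ (k.1 + 1) * nome (2 * η) ^ (k.2 + 1)) /
      (1 - exp (2 * Real.pi * I * z) * nome τ ^ k.1 * nome (2 * η) ^ k.2)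

/-! ### The integral operator and its continuation in the spin -/

/-- The integral operator `[M(g)Φ](z)`, in the range `Im(-g ± z) > 0`. -/
def intM (η τ g : ℂ) (Φ : ℂ → ℂ) (z : ℂ) : ℂ :=
  qPoch (nome (2 * η)) (nome (2 * η)) * qPoch (nome τ) (nome τ) / 2 *
    ∫ x in (0 : ℝ)..1,
      eGamma η τ (z + x - g) * eGamma η τ (z - x - g) *
          eGamma η τ (-z + x - g) * eGamma η τ (-z - x - g) /
        (eGamma η τ (-(2 * g)) * eGamma η τ (2 * x) * eGamma η τ (-(2 * x))) * Φ x

/-- `[M(g₀)Φ](z) = w` in the sense of analytic continuation in the spin: `g ↦ [M(g)Φ](z)`, given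
by the integral for `Im(-g ± z) > 0`, continues meromorphically to a half-plane containing `g₀`,
and the continuation is regular at `g₀` with value `w`. (By the identity theorem `w` is unique.) -/
def HasMValue (η τ g₀ : ℂ) (Φ : ℂ → ℂ) (z w : ℂ) : Prop :=
  ∃ (c : ℝ) (F : ℂ → ℂ), g₀.im < c ∧ MeromorphicOn F {g : ℂ | g.im < c} ∧
    (∀ g : ℂ, 0 < (-g + z).im → 0 < (-g - z).im → F g = intM η τ g Φ z) ∧
    Tendsto F (𝓝[≠] g₀) (𝓝 w)

/-- Admissible functions for the integral operator: meromorphic in `X = exp (2πix)` (that is,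
meromorphic in `x` and 1-periodic), without singularities on the contour of integration. -/
def IsTestFunction (Φ : ℂ → ℂ) : Prop :=
  Meromorphic Φ ∧ Function.Periodic Φ 1 ∧ ∀ x : ℝ, AnalyticAt ℂ Φ (x : ℂ)

/-- `1, 2η, τ` are linearly independent over the integers. -/
def Incommensurate (η τ : ℂ) : Prop :=
  ∀ a b c : ℤ, (a : ℂ) + b * (2 * η) + c * τ = 0 → a = 0 ∧ b = 0 ∧ c = 0

/-- `Φ` is annihilated by the (continued) integral operator `M(g₀)`: the function `M(g₀)Φ`
vanishes at all `z` outside a countable set, namely outside the lattice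
`(1/2)ℤ + ηℤ + (τ/2)ℤ` and the translates of the singularities of `Φ`. -/
def IntKills (η τ g₀ : ℂ) (Φ : ℂ → ℂ) : Prop :=
  ∀ z : ℂ, (∀ a b c : ℤ, z ≠ (c : ℂ) / 2 + a * η + b * (τ / 2)) →
    (∀ a b : ℤ, AnalyticAt ℂ Φ (z + g₀ + a * η + b * (τ / 2)) ∧
      AnalyticAt ℂ Φ (-z + g₀ + a * η + b * (τ / 2))) →
    HasMValue η τ g₀ Φ z 0

/-! ### The finite-difference form on the spin lattices

Below `ϑ` stands for `θ_k`, `k = 3, 4`. -/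

/-- The difference operator `A_k(g)`. -/
def opA (η τ : ℂ) (ϑ : ℂ → ℂ → ℂ) (g : ℂ) (f : ℂ → ℂ) (z : ℂ) : ℂ :=
  exp (Real.pi * I * z ^ 2 / η) * (exp (Real.pi * I * η) / Rconst τ / theta1 (2 * z) τ) *
    (ϑ (z + g + η) (τ / 2) * (exp (-(Real.pi * I * (z + η) ^ 2 / η)) * f (z + η)) -
      ϑ (z - g - η) (τ / 2) * (exp (-(Real.pi * I * (z - η) ^ 2 / η)) * f (z - η)))

/-- The difference operator `B_k(g)`. -/
def opB (η τ : ℂ) (ϑ : ℂ → ℂ → ℂ) (g : ℂ) (f : ℂ → ℂ) (z : ℂ) : ℂ :=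
  exp (2 * Real.pi * I * z ^ 2 / τ) *
      (exp (Real.pi * I * (τ / 2)) / Rconst (2 * η) / theta1 (2 * z) (2 * η)) *
    (ϑ (z + g + τ / 2) η * (exp (-(2 * Real.pi * I * (z + τ / 2) ^ 2 / τ)) * f (z + τ / 2)) -
      ϑ (z - g - τ / 2) η * (exp (-(2 * Real.pi * I * (z - τ / 2) ^ 2 / τ)) * f (z - τ / 2)))

/-- `A_k(g + (n-1)η) ⋯ A_k(g + η) A_k(g)`. -/
def iterA (η τ : ℂ) (ϑ : ℂ → ℂ → ℂ) (g : ℂ) : ℕ → (ℂ → ℂ) → ℂ → ℂ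
  | 0, f => f
  | n + 1, f => opA η τ ϑ (g + n * η) (iterA η τ ϑ g n f)

/-- `B_k(g + (m-1)τ/2) ⋯ B_k(g + τ/2) B_k(g)`. -/
def iterB (η τ : ℂ) (ϑ : ℂ → ℂ → ℂ) (g : ℂ) : ℕ → (ℂ → ℂ) → ℂ → ℂ
  | 0, f => f
  | m + 1, f => opB η τ ϑ (g + m * (τ / 2)) (iterB η τ ϑ g m f)

/-- The operator `M^{(k)}(s + nη + mτ/2)` for `s = 0` or `s = 1/2`:
`A_k ⋯ A_k B_k ⋯ B_k θ_k(z+s|η)^{-m} θ_k(z+s|τ/2)^{-n} e^{s∂_z}`. -/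
def opM (η τ : ℂ) (ϑ : ℂ → ℂ → ℂ) (s : ℂ) (n m : ℕ) (f : ℂ → ℂ) : ℂ → ℂ :=
  iterA η τ ϑ (s + m * (τ / 2)) n
    (iterB η τ ϑ s m
      (fun z => (ϑ (z + s) η ^ m)⁻¹ * (ϑ (z + s) (τ / 2) ^ n)⁻¹ * f (z + s)))

/-- No denominator in the evaluation at `z` of `M^{(k)}(s + nη + mτ/2)` vanishes. The points `z`
excluded by this form a discrete set. -/
def Regular (η τ : ℂ) (ϑ : ℂ → ℂ → ℂ) (s : ℂ) (n m : ℕ) (z : ℂ) : Prop :=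
  (∀ a : ℤ, |a| < n → theta1 (2 * (z + a * η)) τ ≠ 0) ∧
  (∀ a b : ℤ, |a| ≤ n → |b| < m → theta1 (2 * (z + a * η + b * (τ / 2))) (2 * η) ≠ 0) ∧
  (∀ a b : ℤ, |a| ≤ n → |b| ≤ m →
    ϑ (z + s + a * η + b * (τ / 2)) η ^ m * ϑ (z + s + a * η + b * (τ / 2)) (τ / 2) ^ n ≠ 0)

/-- `f` is annihilated by both forms (`k = 3, 4`) of the difference operator
`M(s + nη + mτ/2)`. -/
def DiffKills (η τ s : ℂ) (n m : ℕ) (f : ℂ → ℂ) : Prop :=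
  ∀ ϑ : ℂ → ℂ → ℂ, (ϑ = theta3 ∨ ϑ = theta4) →
    ∀ z : ℂ, Regular η τ ϑ s n m z → opM η τ ϑ s n m f z = 0

/-- `f` is a zero mode of `M(s + nη + mτ/2)`: it is annihilated by the difference operator, which
acts on arbitrary functions of `z`; and if `f` is an admissible function for the integral operator
(and `1, 2η, τ` are incommensurate), it is annihilated by the integral operator, continued
analytically in the spin. -/
def IsZeroMode (η τ s : ℂ) (n m : ℕ) (f : ℂ → ℂ) : Prop :=
  DiffKills η τ s n m f ∧
    (Incommensurate η τ → IsTestFunction f → IntKills η τ (s + n * η + m * (τ / 2)) f)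

/-! ### The products of theta functions -/

/-- `φ_{j,ℓ}^{(n,m)}`. -/
def phi (η τ : ℂ) (n m j l : ℕ) (z : ℂ) : ℂ :=
  theta3 z (τ / 2) ^ j * theta4 z (τ / 2) ^ (n - 1 - j) *
    (theta3 z η ^ l * theta4 z η ^ (m - 1 - l))

/-- `θ(r^{-1/4} Z^{±1}; r)` with `r = exp (2πiω)` and `Z = exp (2πiz)`. -/
def thetaDen (ω z : ℂ) : ℂ :=
  mTheta (exp (-(Real.pi * I * ω / 2)) * exp (2 * Real.pi * I * z)) (nome ω) *
    mTheta (exp (-(Real.pi * I * ω / 2)) * (exp (2 * Real.pi * I * z))⁻¹) (nome ω)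

/-- The functions for `m = 0`, with denominator `θ(q^{-1/4} Z^{±1}; q)`. -/
def phiEta (η τ : ℂ) (n j : ℕ) (z : ℂ) : ℂ :=
  theta3 z (τ / 2) ^ j * theta4 z (τ / 2) ^ (n - 1 - j) / thetaDen (2 * η) z

/-- The functions for `n = 0`, with denominator `θ(p^{-1/4} Z^{±1}; p)`. -/
def phiTau (η τ : ℂ) (m l : ℕ) (z : ℂ) : ℂ :=
  theta3 z η ^ l * theta4 z η ^ (m - 1 - l) / thetaDen τ z

end EllipticDouble

end

open Complex Filter Topology

noncomputable section

namespace EllipticDouble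

/-! Difference operators. By the addition formula `two_mul_theta1_mul_theta1`, if ϑ is one of θ₃, θ₄
and ϑ' is the other, then the quotient Y = ϑ'/ϑ (nome ratio τ/2) satisfies ϑ(x)ϑ(y)(Y(x) - Y(y)) = κ
θ₁(x+y|τ)θ₁(x-y|τ). Taken at x = z+(r+1)η and y = z-(r+1)η, the right side contains the denominator
θ₁(2z|τ) of A_k. A block of n operators A_k therefore computes a divided difference of order n in
the variable Y, up to explicit factors (`iterA_eq_monomialDiff`). After the multiplication by
θ_k^{-n}, the product θ₃^j θ₄^{n-1-j} becomes ϑ⁻¹ times a monomial in Y of degree less than n, so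
its divided difference of order n is zero. The remaining factor of the function only has to satisfy
G(z+η) = e^{4πiz} G(z-η). This holds for the theta quotient in the other nome, which has total
degree -1, and for 1/θ(q^{-1/4}Z^{±1};q), in both cases times a 2η-periodic ψ. For a τ-periodic ψ
the B block plays this role. The A and B blocks can be interchanged (`iterA_iterB_comm`), and
exchanging 2η with τ turns one into the other (`opB_eq`).

Integral operator. Multiplying the three-term theta relation by gamma functions gives a contiguity
relation of the kernel (`kernelM_contiguity`). Where the integral converges, M(u+s+nη+mτ/2)f is thus
A⋯AB⋯B applied to M(u+s)Φ, with Φ = θ_k^{-m}θ_k^{-n}f (`intM_eq_iterA_iterB`). The coefficients of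
the difference operators are entire in u, so only the continuation of M(u+s)Φ to u = 0 is missing.
The case s = 1/2 reduces to s = 0 by a shift of the integration variable.

At u = 0 the operator is the identity on even functions (`exists_continuation_zero`). Finitely many
poles ±(u+βᵢ) of the kernel are split off, partial fractions reduce the integral to Cauchy
transforms, and these are continued with the residue theorem. As u → 0 the prefactor 1/Γ(-2u)
vanishes, so only the terms of the pair β = ±z, whose poles pinch the contour, survive. The
reflection formula of the Cauchy transform and the value of the infinite products at 1 identify
their sum with Φ(z).

Consequently the continued integral operator coincides with the difference operator on even
functions (`hasMValue_opM`). Since the kernel is even in x, only the even part of a test function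
matters. The theta factors are even and the periodicity conditions on ψ survive passage to even
parts, so annihilation by the difference operators implies annihilation by the integral
(`intKills_of_diffKills`). Incommensurability enters in the simplicity of the poles and in the
choice of a k for which θ_k has no zero on the orbit of z. -/

/-! ### Theta functions: quasi-periodicity and the addition formula. -/

lemma exp_eq_exp_of_int {a b : ℂ} (k : ℤ) (h : a = b + k * (2 * Real.pi * I)) : exp a = exp b :=
  exp_eq_exp_iff_exists_int.mpr ⟨k, h⟩

lemma exp_eq_neg_exp_of_int {a b : ℂ} (k : ℤ) (h : a = b + Real.pi * I + k * (2 * Real.pi * I)) :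
    exp a = -exp b := by
  rw [exp_eq_exp_of_int k h, exp_add, exp_pi_mul_I, mul_neg_one]

/-- Completing the square in the half-integer series, followed by an index shift by one, gives
Mathlib's two-variable theta function, whose quasi-periodicity then becomes available. -/
lemma theta3_eq (z τ : ℂ) : theta3 z τ = jacobiTheta₂ z τ := by
  unfold theta3 theta2 theta1 jacobiTheta₂
  rw [← (Equiv.addRight (1 : ℤ)).tsum_eq (fun n => jacobiTheta₂_term n z τ), mul_neg,
    ← tsum_mul_left, ← tsum_neg]
  refine tsum_congr fun n => ?_
  rw [jacobiTheta₂_term, Equiv.coe_addRight, ← exp_add, ← exp_add, neg_eq_iff_eq_neg]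
  refine exp_eq_neg_exp_of_int n ?_
  push_cast
  ring

lemma theta4_eq (z τ : ℂ) : theta4 z τ = jacobiTheta₂ (z + 1 / 2) τ := by
  rw [theta4, theta3_eq]

lemma theta1_eq (z τ : ℂ) : theta1 z τ =
    -(exp (Real.pi * I * (τ / 4 + z + 1 / 2)) * jacobiTheta₂ (z + 1 / 2 + τ / 2) τ) := by
  unfold theta1 jacobiTheta₂
  rw [← tsum_mul_left]
  congr 1
  refine tsum_congr fun n => ?_
  rw [jacobiTheta₂_term, ← exp_add, ← exp_add]
  congr 1
  ring

lemma jacobiTheta₂_sub_period (z τ : ℂ) :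
    jacobiTheta₂ (z - τ) τ = exp (-Real.pi * I * (τ - 2 * z)) * jacobiTheta₂ z τ := by
  have h := jacobiTheta₂_add_left' (z - τ) τ
  rw [sub_add_cancel] at h
  rw [h, ← mul_assoc, ← exp_add]
  ring_nf; simp

lemma theta1_neg (z τ : ℂ) : theta1 (-z) τ = -theta1 z τ := by
  rw [theta1_eq, theta1_eq]
  have h : jacobiTheta₂ (-z + 1 / 2 + τ / 2) τ =
     -exp (Real.pi * I * (2 * z)) * jacobiTheta₂ (z + 1 / 2 + τ / 2) τ := by
    rw [← jacobiTheta₂_neg_left, ← jacobiTheta₂_add_left,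
      show -(-z + 1 / 2 + τ / 2) + 1 = z + 1 / 2 + τ / 2 - τ by ring, jacobiTheta₂_sub_period]
    congr 1
    refine exp_eq_neg_exp_of_int 0 ?_
    push_cast; ring
  rw [h]
  have : exp (Real.pi * I * (τ / 4 + z + 1 / 2)) =
      exp (Real.pi * I * (τ / 4 + -z + 1 / 2)) * exp (Real.pi * I * (2 * z)) := by
    rw [← exp_add]; ring_nf
  rw [this]; ring

lemma theta1_add_one (z τ : ℂ) : theta1 (z + 1) τ = -theta1 z τ := by
  rw [theta1_eq, theta1_eq, show z + 1 + 1 / 2 + τ / 2 = z + 1 / 2 + τ / 2 + 1 by ring,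
    jacobiTheta₂_add_left,
    exp_eq_neg_exp_of_int 0 (b := Real.pi * I * (τ / 4 + z + 1 / 2)) (by push_cast; ring)]
  ring

lemma theta1_add_period (z τ : ℂ) :
    theta1 (z + τ) τ = -exp (-(Real.pi * I * (τ + 2 * z))) * theta1 z τ := by
  rw [theta1_eq, theta1_eq, show z + τ + 1 / 2 + τ / 2 = z + 1 / 2 + τ / 2 + τ by ring,
    jacobiTheta₂_add_left']
  have : exp (Real.pi * I * (τ / 4 + (z + τ) + 1 / 2)) *
      exp (-Real.pi * I * (τ + 2 * (z + 1 / 2 + τ / 2))) =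
      -(exp (-(Real.pi * I * (τ + 2 * z))) * exp (Real.pi * I * (τ / 4 + z + 1 / 2))) := by
    rw [← exp_add, ← exp_add]
    refine exp_eq_neg_exp_of_int (-1) ?_
    push_cast; ring
  linear_combination (-jacobiTheta₂ (z + 1 / 2 + τ / 2) τ) * this

lemma jacobiTheta₂_term_add_half (n : ℤ) (z τ : ℂ) :
    jacobiTheta₂_term n (z + 1 / 2) τ = exp (Real.pi * I * n) * jacobiTheta₂_term n z τ := by
  rw [jacobiTheta₂_term, jacobiTheta₂_term, ← exp_add]; ring_nf

/-- Rests on (a+½)² + (b+½)² = ((a+b+1)² + (a-b)²)/2: rotating the index lattice halves τ and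
separates x from y. -/
lemma jacobiTheta₂_term_mul_half (a b : ℤ) (x y τ : ℂ) :
    exp (Real.pi * I * (τ / 4 + (x + y) + 1 / 2)) *
          exp (Real.pi * I * (τ / 4 + (x - y) + 1 / 2)) *
        (jacobiTheta₂_term a (x + y + 1 / 2 + τ / 2) τ *
          jacobiTheta₂_term b (x - y + 1 / 2 + τ / 2) τ) =
        -(exp (Real.pi * I * ((a - b : ℤ) : ℂ)) *
        (jacobiTheta₂_term (a + b + 1) x (τ / 2) * jacobiTheta₂_term (a - b) y (τ / 2))) := by
  simp only [jacobiTheta₂_term, ← exp_add]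
  refine exp_eq_neg_exp_of_int b ?_
  push_cast; ring

lemma half_im_pos {τ : ℂ} (hτ : 0 < τ.im) : 0 < (τ / 2).im := by
  rw [show τ / 2 = τ * (1 / 2 : ℝ) by push_cast; ring, Complex.im_mul_ofReal]; positivity

/-- The map (a, b) ↦ (a+b+1, a-b) is injective and its image consists of the pairs of opposite
parity; the hypothesis removes the pairs of equal parity. -/
lemma tsum_odd_pairs {f : ℤ × ℤ → ℂ} (hf : ∀ n r : ℤ, f (n + 2 * r, n) = 0) :
    ∑' k : ℤ × ℤ, f (k.1 + k.2 + 1, k.1 - k.2) = ∑' k, f k := by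
  have hinj : Function.Injective fun k : ℤ × ℤ => ((k.1 + k.2 + 1, k.1 - k.2) : ℤ × ℤ) := by
    intro a b h
    simp only [Prod.mk.injEq] at h
    ext <;> omega
  refine hinj.tsum_eq fun nk hnk => ?_
  by_contra hr
  apply hnk
  have hev : Even (nk.1 - nk.2) := by
    by_contra hodd
    rw [Int.not_even_iff_odd] at hodd
    obtain ⟨r, hr'⟩ := hodd
    refine hr ⟨(nk.2 + r, r), ?_⟩
    ext <;> simp <;> omega
  obtain ⟨r, hr'⟩ := hev
  have : nk = (nk.2 + 2 * r, nk.2) := by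
    ext
    · simp; omega
    · simp
  rw [this]
  exact hf _ _

lemma tsum_mul_tsum_sub {f g f' g' : ℤ → ℂ} (hf : Summable fun n => ‖f n‖)
    (hg : Summable fun n => ‖g n‖) (hf' : Summable fun n => ‖f' n‖)
    (hg' : Summable fun n => ‖g' n‖) :
    (∑' n, f n) * (∑' n, g n) - (∑' n, f' n) * (∑' n, g' n) =
      ∑' k : ℤ × ℤ, (f k.1 * g k.2 - f' k.1 * g' k.2) := by
  have h1 : Summable fun k : ℤ × ℤ => f k.1 * g k.2 := summable_mul_of_summable_norm hf hg
  have h2 : Summable fun k : ℤ × ℤ => f' k.1 * g' k.2 := summable_mul_of_summable_norm hf' hg'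
  have h3 := tsum_mul_tsum_of_summable_norm hf hg
  have h4 := tsum_mul_tsum_of_summable_norm hf' hg'
  rw [h3, h4, h1.tsum_sub h2]

/-- The product of theta functions with nome ratio `τ` in terms of theta functions with nome
ratio `τ / 2`. -/
lemma two_mul_theta1_mul_theta1 {τ : ℂ} (hτ : 0 < τ.im) (x y : ℂ) :
    2 * (theta1 (x + y) τ * theta1 (x - y) τ) =
      theta4 x (τ / 2) * theta3 y (τ / 2) - theta4 y (τ / 2) * theta3 x (τ / 2) := by
  have hs : ∀ z, Summable fun n => ‖jacobiTheta₂_term n z (τ / 2)‖ := fun z =>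
    ((summable_jacobiTheta₂_term_iff z _).mpr (half_im_pos hτ)).norm
  have hs1 : ∀ z, Summable fun n => ‖jacobiTheta₂_term n z τ‖ := fun z =>
    ((summable_jacobiTheta₂_term_iff z _).mpr hτ).norm
  -- A shift by 1/2 inserts (-1)^n. The antisymmetric combination carries (-1)^n - (-1)^k, which
  -- vanishes for equal parity and is twice a sign otherwise; this is the factor 2 of the formula.
  have hterm : ∀ n k : ℤ, jacobiTheta₂_term n (x + 1 / 2) (τ / 2) * jacobiTheta₂_term k y (τ / 2) -
      jacobiTheta₂_term n x (τ / 2) * jacobiTheta₂_term k (y + 1 / 2) (τ / 2) =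
      (exp (Real.pi * I * n) - exp (Real.pi * I * k)) *
        (jacobiTheta₂_term n x (τ / 2) * jacobiTheta₂_term k y (τ / 2)) := by
    intro n k
    rw [jacobiTheta₂_term_add_half, jacobiTheta₂_term_add_half]; ring
  have hR : theta4 x (τ / 2) * theta3 y (τ / 2) - theta4 y (τ / 2) * theta3 x (τ / 2) =
      ∑' k : ℤ × ℤ, (exp (Real.pi * I * k.1) - exp (Real.pi * I * k.2)) *
        (jacobiTheta₂_term k.1 x (τ / 2) * jacobiTheta₂_term k.2 y (τ / 2)) := by
    rw [theta4_eq, theta4_eq, theta3_eq, theta3_eq, mul_comm (jacobiTheta₂ (y + 1 / 2) _)]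
    refine (tsum_mul_tsum_sub (hs (x + 1 / 2)) (hs y) (hs x) (hs (y + 1 / 2))).trans ?_
    exact tsum_congr fun k => hterm k.1 k.2
  have hL : theta1 (x + y) τ * theta1 (x - y) τ = ∑' k : ℤ × ℤ,
      -(exp (Real.pi * I * ((k.1 - k.2 : ℤ) : ℂ)) * (jacobiTheta₂_term (k.1 + k.2 + 1) x (τ / 2) *
        jacobiTheta₂_term (k.1 - k.2) y (τ / 2))) := by
    rw [theta1_eq, theta1_eq, neg_mul_neg, mul_mul_mul_comm, jacobiTheta₂, jacobiTheta₂,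
      tsum_mul_tsum_of_summable_norm (hs1 (x + y + 1 / 2 + τ / 2)) (hs1 (x - y + 1 / 2 + τ / 2)),
      ← tsum_mul_left]
    exact tsum_congr fun k => jacobiTheta₂_term_mul_half k.1 k.2 x y τ
  rw [hR, hL, ← tsum_mul_left]
  refine Eq.trans ?_ (tsum_odd_pairs ?_)
  · refine tsum_congr fun k => ?_
    dsimp only
    have h1 : exp (Real.pi * I * ((k.1 + k.2 + 1 : ℤ) : ℂ)) =
        -exp (Real.pi * I * ((k.1 - k.2 : ℤ) : ℂ)) := by
      refine exp_eq_neg_exp_of_int k.2 ?_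
      push_cast; ring
    rw [h1]
    ring
  · intro n r
    rw [exp_eq_exp_of_int (b := Real.pi * I * n) r, sub_self, zero_mul]
    push_cast; ring

/-! ### Infinite products -/

/-- The entire function `t ↦ ∏ (1 - t c_k)`. -/
def zeroProd {ι : Type*} (c : ι → ℂ) (t : ℂ) : ℂ := ∏' k, (1 - t * c k)

section zeroProd

variable {ι : Type*} {c : ι → ℂ}

lemma multipliable_zeroProd (hc : Summable fun k => ‖c k‖) (t : ℂ) :
    Multipliable fun k => 1 - t * c k := by
  simp only [sub_eq_add_neg]
  refine multipliable_one_add_of_summable ?_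
  simpa only [norm_neg, norm_mul] using hc.mul_left ‖t‖

lemma zeroProd_eq_zero_iff (hc : Summable fun k => ‖c k‖) (t : ℂ) :
    zeroProd c t = 0 ↔ ∃ k, t * c k = 1 := by
  constructor
  · intro h
    by_contra! hn
    refine tprod_one_add_ne_zero_of_summable (f := fun k => -(t * c k)) (fun k hk => hn k ?_) ?_ ?_
    · linear_combination -hk
    · simpa only [norm_neg, norm_mul] using hc.mul_left ‖t‖
    · simpa only [zeroProd, sub_eq_add_neg] using h
  · rintro ⟨k, hk⟩
    exact (hasProd_zero_of_exists_eq_zero ⟨k, by rw [hk, sub_self]⟩).tprod_eq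

lemma differentiable_zeroProd (hc : Summable fun k => ‖c k‖) : Differentiable ℂ (zeroProd c) := by
  intro t
  have h : HasProdLocallyUniformlyOn (fun k t => 1 + -(t * c k))
      (fun t => ∏' k, (1 + -(t * c k))) (Metric.ball 0 (‖t‖ + 1)) := by
    refine Summable.hasProdLocallyUniformlyOn_one_add (u := fun k => (‖t‖ + 1) * ‖c k‖)
      Metric.isOpen_ball (hc.mul_left _) (Eventually.of_forall fun k x hx => ?_) fun k => by fun_prop
    rw [norm_neg, norm_mul]
    have : ‖x‖ < ‖t‖ + 1 := by simpa using hx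
    gcongr
  have h2 := TendstoLocallyUniformlyOn.differentiableOn
    (hasProdLocallyUniformlyOn_iff_tendstoLocallyUniformlyOn.mp h)
    (Eventually.of_forall fun s => by fun_prop) Metric.isOpen_ball
  have h3 := (h2 t (by simp)).differentiableAt (Metric.isOpen_ball.mem_nhds (by simp))
  simp only [← sub_eq_add_neg] at h3
  exact h3

/-- Replacing c by 0 on s turns those factors into 1, so the tail is again a `zeroProd` and inherits
its analyticity and description of zeros. -/
lemma zeroProd_eq_prod_mul [DecidableEq ι] (hc : Summable fun k => ‖c k‖) (s : Finset ι) (t : ℂ) :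
    zeroProd c t = (∏ k ∈ s, (1 - t * c k)) * zeroProd (fun k => if k ∈ s then 0 else c k) t := by
  have h1 : Summable fun k => ‖(fun k => if k ∈ s then 0 else c k) k‖ :=
    hc.of_nonneg_of_le (fun k => norm_nonneg _) fun k => by
      by_cases h : k ∈ s <;> simp [h]
  have h2 : HasProd (fun k => if k ∈ s then 1 - t * c k else 1) (∏ k ∈ s, (1 - t * c k)) := by
    have := hasProd_prod_of_ne_finset_one (s := s) (f := fun k => if k ∈ s then 1 - t * c k else 1)
      (L := .unconditional ι) (fun b hb => by simp [hb])
    rwa [Finset.prod_congr rfl fun k hk => if_pos hk] at this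
  refine ((h2.mul (multipliable_zeroProd h1 t).hasProd).tprod_eq.symm.trans ?_).symm
  refine tprod_congr fun k => ?_
  by_cases h : k ∈ s <;> simp [h]

lemma zeroProd_comp_equiv {κ : Type*} (e : κ ≃ ι) (t : ℂ) :
    zeroProd (c ∘ e) t = zeroProd c t :=
  e.tprod_eq fun k => 1 - t * c k

end zeroProd

/-! ### The products (t; p)_∞ and the exponential `nome`. -/

lemma summable_norm_pow {p : ℂ} (hp : ‖p‖ < 1) : Summable fun k : ℕ => ‖p ^ k‖ := by
  simpa only [norm_pow] using summable_geometric_of_lt_one (norm_nonneg p) hp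

lemma qPoch_eq_zero_iff {p : ℂ} (hp : ‖p‖ < 1) (t : ℂ) :
    qPoch t p = 0 ↔ ∃ k : ℕ, t * p ^ k = 1 :=
  zeroProd_eq_zero_iff (summable_norm_pow hp) t

lemma qPoch_self_ne_zero {p : ℂ} (hp : ‖p‖ < 1) : qPoch p p ≠ 0 := by
  rw [Ne, qPoch_eq_zero_iff hp]
  rintro ⟨k, hk⟩
  have := congrArg norm hk
  rw [← pow_succ', norm_pow, norm_one] at this
  exact (pow_lt_one₀ (norm_nonneg p) hp (Nat.succ_ne_zero k)).ne this

lemma norm_nome_lt_one {ω : ℂ} (hω : 0 < ω.im) : ‖nome ω‖ < 1 := by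
  rw [nome, norm_exp, Real.exp_lt_one_iff]
  simp; positivity

lemma nome_ne_zero (ω : ℂ) : nome ω ≠ 0 := exp_ne_zero _

lemma norm_nome (ω : ℂ) : ‖nome ω‖ = Real.exp (-(2 * Real.pi * ω.im)) := by
  rw [nome, norm_exp]; simp

lemma nome_add (a b : ℂ) : nome (a + b) = nome a * nome b := by
  rw [nome, nome, nome, ← exp_add]; ring_nf

lemma nome_neg (a : ℂ) : nome (-a) = (nome a)⁻¹ := by
  rw [nome, nome, ← exp_neg]; ring_nf

lemma nome_sub (a b : ℂ) : nome (a - b) = nome a / nome b := by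
  rw [sub_eq_add_neg, nome_add, nome_neg, div_eq_mul_inv]

lemma nome_intCast (k : ℤ) : nome k = 1 := by
  rw [nome, mul_comm]; exact exp_int_mul_two_pi_mul_I k

lemma nome_zero : nome 0 = 1 := by simp [nome]

lemma nome_one : nome 1 = 1 := by simpa using nome_intCast 1

lemma nome_nat_mul (k : ℕ) (a : ℂ) : nome (k * a) = nome a ^ k := by
  rw [nome, nome, ← exp_nat_mul]; ring_nf

lemma nome_int_mul (k : ℤ) (a : ℂ) : nome (k * a) = nome a ^ k := by
  rw [nome, nome, ← exp_int_mul]; ring_nf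

lemma nome_eq_one_iff (a : ℂ) : nome a = 1 ↔ ∃ k : ℤ, a = k := by
  rw [nome, exp_eq_one_iff]
  refine exists_congr fun k => ?_
  rw [mul_comm, mul_left_inj' (by simp [Real.pi_ne_zero])]

/-! ### Jacobi's triple product -/

section TripleProduct

variable {p : ℂ}

lemma pow_ne_one_of_norm_lt (hp : ‖p‖ < 1) {k : ℕ} (hk : k ≠ 0) : p ^ k ≠ 1 := fun h => by
  have := congrArg norm h
  rw [norm_pow, norm_one] at this
  exact (pow_lt_one₀ (norm_nonneg p) hp hk).ne this

/-- `(p; p)_k`. -/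
def pochFin (p : ℂ) (k : ℕ) : ℂ := ∏ i ∈ Finset.range k, (1 - p ^ (i + 1))

/-- `1 / (p; p)_k`, extended by zero to negative `k`. -/
def invPoch (p : ℂ) (k : ℤ) : ℂ := if 0 ≤ k then (pochFin p k.toNat)⁻¹ else 0

/-- The extension by zero makes the recursion valid for every integer: at k = 0 the factor 1 - p^0
vanishes. -/
lemma invPoch_sub_one (hp : ‖p‖ < 1) (k : ℤ) : invPoch p (k - 1) = (1 - p ^ k) * invPoch p k := by
  rcases lt_trichotomy k 0 with h | rfl | h
  · simp [invPoch, not_le.mpr h, show ¬ (1 ≤ k) by omega]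
  · simp [invPoch]
  · obtain ⟨m, rfl⟩ : ∃ m : ℕ, k = m + 1 := ⟨(k - 1).toNat, by omega⟩
    have h1 : ((m : ℤ) + 1).toNat = m + 1 := by omega
    have h2 : (1 : ℂ) - p ^ (m + 1) ≠ 0 :=
      sub_ne_zero.mpr (pow_ne_one_of_norm_lt hp m.succ_ne_zero).symm
    rw [invPoch, invPoch, if_pos (by omega), if_pos (by omega), h1, add_sub_cancel_right,
      Int.toNat_natCast, pochFin, pochFin, Finset.prod_range_succ, mul_inv, mul_left_comm,
      show (p : ℂ) ^ ((m : ℤ) + 1) = p ^ (m + 1) by norm_cast, mul_inv_cancel₀ h2, mul_one]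

/-- The finite form of the triple product identity. -/
lemma hasSum_finite_tripleProduct (hp : ‖p‖ < 1) (hp0 : p ≠ 0) {t : ℂ} (ht : t ≠ 0) {d : ℤ → ℂ}
    (hd0 : d 0 = 1) (hd : ∀ n, d (n + 1) = -(p ^ n * t * d n)) (N : ℕ) :
    HasSum (fun n : ℤ => pochFin p (2 * N) * invPoch p (N - n) * invPoch p (N + n) * d n)
      (∏ k ∈ Finset.range N, ((1 - t * p ^ k) * (1 - p * t⁻¹ * p ^ k))) := by
  induction N with
  | zero =>
    have := hasSum_single (f := fun n : ℤ => pochFin p (2 * 0) * invPoch p ((0 : ℕ) - n) *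
      invPoch p ((0 : ℕ) + n) * d n) 0 (fun n hn => ?_)
    · simpa [hd0, invPoch, pochFin] using this
    · rcases lt_or_gt_of_ne hn with h | h
      · simp [invPoch, not_le.mpr h]
      · simp [invPoch, not_le.mpr h]
  | succ N ih =>
    rw [Finset.prod_range_succ]
    -- The new factor expands to 1 + p^(2N+1) - t p^N - p t⁻¹ p^N. The powers t and t⁻¹ move the
    -- index of `d` by one, hence the two reindexed sums.
    have h1 := ih.mul_left (1 + p ^ (2 * N + 1))
    have h2 := (Equiv.addRight (-1 : ℤ)).hasSum_iff.mpr (ih.mul_left (-(t * p ^ N)))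
    have h3 := (Equiv.addRight (1 : ℤ)).hasSum_iff.mpr (ih.mul_left (-(p * t⁻¹ * p ^ N)))
    have key := (h1.add h2).add h3
    have hval : (∏ k ∈ Finset.range N, ((1 - t * p ^ k) * (1 - p * t⁻¹ * p ^ k))) *
        ((1 - t * p ^ N) * (1 - p * t⁻¹ * p ^ N)) =
        (1 + p ^ (2 * N + 1)) * (∏ k ∈ Finset.range N, ((1 - t * p ^ k) * (1 - p * t⁻¹ * p ^ k))) +
        -(t * p ^ N) * (∏ k ∈ Finset.range N, ((1 - t * p ^ k) * (1 - p * t⁻¹ * p ^ k))) +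
        -(p * t⁻¹ * p ^ N) *
          (∏ k ∈ Finset.range N, ((1 - t * p ^ k) * (1 - p * t⁻¹ * p ^ k))) := by
      have htt : t⁻¹ * t = 1 := inv_mul_cancel₀ ht
      linear_combination (p ^ (2 * N + 1) *
        (∏ k ∈ Finset.range N, ((1 - t * p ^ k) * (1 - p * t⁻¹ * p ^ k)))) * htt
    rw [hval]
    refine Eq.mp (congrArg (HasSum · _) (funext fun n => ?_)) key
    · symm
      simp only [Function.comp_apply, Equiv.coe_addRight]
      -- Every `invPoch` reduces to the extreme values x and y by `invPoch_sub_one`; what remains is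
      -- a polynomial identity in powers of p and t.
      set x := invPoch p ((N + 1 : ℕ) - n) with hx
      set y := invPoch p ((N + 1 : ℕ) + n) with hy
      have ex1 : invPoch p (N - n) = (1 - p ^ (N + 1 - n : ℤ)) * x := by
        rw [hx, ← Nat.cast_succ, ← invPoch_sub_one hp]; congr 1; push_cast; ring
      have ey1 : invPoch p (N + n) = (1 - p ^ (N + 1 + n : ℤ)) * y := by
        rw [hy, ← Nat.cast_succ, ← invPoch_sub_one hp]; congr 1; push_cast; ring
      have ex2 : invPoch p (N - (n + -1)) = x := by rw [hx]; congr 1; push_cast; ring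
      have ey2 : invPoch p (N + (n + -1)) = (1 - p ^ (N + n : ℤ)) * invPoch p (N + n) := by
        rw [← invPoch_sub_one hp]; congr 1; ring
      have ex3 : invPoch p (N - (n + 1)) = (1 - p ^ (N - n : ℤ)) * invPoch p (N - n) := by
        rw [← invPoch_sub_one hp]; congr 1; ring
      have ey3 : invPoch p (N + (n + 1)) = y := by rw [hy]; congr 1; push_cast; ring
      have ed1 : d (n + 1) = -(p ^ n * t * d n) := hd n
      have ed2 : t * d (n + -1) = -(p ^ (1 - n) * d n) := by
        have := hd (n + -1)
        rw [neg_add_cancel_right] at this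
        rw [this, show (1 - n : ℤ) = -(n + -1) by ring, zpow_neg]
        have : p ^ (n + -1) ≠ 0 := zpow_ne_zero _ hp0
        field_simp
      have eA : pochFin p (2 * (N + 1)) =
          pochFin p (2 * N) * (1 - p ^ (2 * N + 1)) * (1 - p ^ (2 * N + 1 + 1)) := by
        rw [pochFin, show 2 * (N + 1) = 2 * N + 1 + 1 by ring, Finset.prod_range_succ,
          Finset.prod_range_succ, pochFin]
      rw [eA, ex2, ey2, ex3, ey3, ex1, ey1, ed1]
      set r := p ^ (N + 1 - n : ℤ) with hr
      set s := p ^ (N + 1 + n : ℤ) with hs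
      have hr' : p ^ (N - n : ℤ) * p = r := by
        rw [hr, ← zpow_add_one₀ hp0]; congr 1; ring
      have hs' : p ^ (N + n : ℤ) * p = s := by
        rw [hs, ← zpow_add_one₀ hp0]; congr 1; ring
      have hrs : p ^ (2 * N + 1) = p ^ (N - n : ℤ) * p ^ (N + n : ℤ) * p := by
        rw [← zpow_add₀ hp0, ← zpow_add_one₀ hp0, ← zpow_natCast]; congr 1; push_cast; ring
      have hN1 : p ^ N * p ^ (1 - n) = r := by
        rw [hr, ← zpow_natCast, ← zpow_add₀ hp0]; congr 1; ring
      have hN2 : p ^ N * p ^ n = p ^ (N + n : ℤ) := by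
        rw [← zpow_natCast, ← zpow_add₀ hp0]
      rw [pow_succ p (2 * N + 1), hrs]
      set r' := p ^ (N - n : ℤ)
      set s' := p ^ (N + n : ℤ)
      rw [← hr'] at hN1 ⊢
      rw [← hs']
      have htt : t⁻¹ * t = 1 := inv_mul_cancel₀ ht
      linear_combination (p ^ N * (pochFin p (2 * N) * x * ((1 - s') * ((1 - s' * p) * y)))) * ed2
        - (pochFin p (2 * N) * x * ((1 - s') * ((1 - s' * p) * y)) * d n) * hN1
        - (p * p ^ N * p ^ n * (pochFin p (2 * N) * ((1 - r') * ((1 - r' * p) * x)) * y) * d n) * htt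
        - (p * (pochFin p (2 * N) * ((1 - r') * ((1 - r' * p) * x)) * y) * d n) * hN2

lemma tendsto_pochFin (hp : ‖p‖ < 1) : Tendsto (pochFin p) atTop (𝓝 (qPoch p p)) := by
  have := (multipliable_zeroProd (summable_norm_pow hp) p).hasProd.tendsto_prod_nat
  simp only [← pow_succ'] at this
  simp only [qPoch, ← pow_succ']
  exact this

lemma tendsto_invPoch (hp : ‖p‖ < 1) : Tendsto (invPoch p) atTop (𝓝 (qPoch p p)⁻¹) := by
  have h0 : Tendsto Int.toNat atTop atTop :=
    tendsto_atTop_atTop.mpr fun b => ⟨b, fun k hk => by omega⟩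
  have h1 : Tendsto (fun k : ℤ => (pochFin p k.toNat)⁻¹) atTop (𝓝 (qPoch p p)⁻¹) :=
    ((tendsto_pochFin hp).comp h0).inv₀ (qPoch_self_ne_zero hp)
  refine h1.congr' ?_
  filter_upwards [eventually_ge_atTop 0] with k hk
  rw [invPoch, if_pos hk]

lemma exists_bound_pochFin (hp : ‖p‖ < 1) :
    ∃ C : ℝ, (∀ k, ‖pochFin p k‖ ≤ C) ∧ ∀ k, ‖invPoch p k‖ ≤ C := by
  obtain ⟨C1, h1⟩ := (tendsto_pochFin hp).norm.bddAbove_range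
  obtain ⟨C2, h2⟩ := ((tendsto_pochFin hp).inv₀ (qPoch_self_ne_zero hp)).norm.bddAbove_range
  have h2' : ∀ k, ‖(pochFin p k)⁻¹‖ ≤ C2 := fun k => h2 ⟨k, rfl⟩
  refine ⟨max C1 C2, fun k => (h1 ⟨k, rfl⟩).trans (le_max_left _ _), fun k => ?_⟩
  refine le_trans ?_ (le_max_right C1 C2)
  unfold invPoch
  split_ifs
  · exact h2' _
  · simpa using (norm_nonneg _).trans (h2' 0)

/-- Jacobi's triple product identity, for coefficients `d` given by their recursion. -/
lemma mTheta_mul_qPoch_eq_tsum (hp : ‖p‖ < 1) (hp0 : p ≠ 0) {t : ℂ} (ht : t ≠ 0) {d : ℤ → ℂ}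
    (hd0 : d 0 = 1) (hd : ∀ n, d (n + 1) = -(p ^ n * t * d n)) (hs : Summable fun n => ‖d n‖) :
    mTheta t p * qPoch p p = ∑' n, d n := by
  have hE := qPoch_self_ne_zero hp
  obtain ⟨C, hC1, hC2⟩ := exists_bound_pochFin hp
  have hC0 : 0 ≤ C := (norm_nonneg _).trans (hC1 0)
  have hL : Tendsto (fun N => ∏ k ∈ Finset.range N, ((1 - t * p ^ k) * (1 - p * t⁻¹ * p ^ k)))
      atTop (𝓝 (mTheta t p)) := by
    simp only [Finset.prod_mul_distrib]
    exact (multipliable_zeroProd (summable_norm_pow hp) t).hasProd.tendsto_prod_nat.mul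
      (multipliable_zeroProd (summable_norm_pow hp) (p * t⁻¹)).hasProd.tendsto_prod_nat
  have hR : Tendsto (fun N : ℕ => ∑' n : ℤ, pochFin p (2 * N) * invPoch p (N - n) *
      invPoch p (N + n) * d n) atTop (𝓝 (∑' n, (qPoch p p)⁻¹ * d n)) := by
    refine tendsto_tsum_of_dominated_convergence (bound := fun n => C * C * C * ‖d n‖)
      (hs.mul_left _) (fun n => ?_) (Eventually.of_forall fun N n => ?_)
    -- The factor `pochFin` tends to (p;p)_∞ and each `invPoch` to its inverse, so the coefficient
    -- tends to a single inverse.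
    · have e : (qPoch p p)⁻¹ = qPoch p p * (qPoch p p)⁻¹ * (qPoch p p)⁻¹ := by
        rw [mul_inv_cancel₀ hE, one_mul]
      have hN : Tendsto (fun N : ℕ => (N : ℤ)) atTop atTop := tendsto_natCast_atTop_atTop
      rw [e]
      refine ((Tendsto.mul ?_ ?_).mul ?_).mul_const _
      · exact (tendsto_pochFin hp).comp (tendsto_id.const_mul_atTop' two_pos)
      · exact (tendsto_invPoch hp).comp (tendsto_atTop_add_const_right _ (-n) hN)
      · exact (tendsto_invPoch hp).comp (tendsto_atTop_add_const_right _ n hN)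
    · rw [norm_mul, norm_mul, norm_mul]
      gcongr
      · exact hC1 _
      · exact hC2 _
      · exact hC2 _
  have h := tendsto_nhds_unique hL
    (hR.congr fun N => (hasSum_finite_tripleProduct hp hp0 ht hd0 hd N).tsum_eq)
  rw [h, tsum_mul_left, mul_comm, ← mul_assoc, mul_inv_cancel₀ hE, one_mul]
end TripleProduct

/-- The product formula for `θ₁`. -/
lemma Rconst_mul_theta1 {τ : ℂ} (hτ : 0 < τ.im) (u : ℂ) :
    Rconst τ * theta1 u τ = exp (-(Real.pi * I * u)) * mTheta (nome u) (nome τ) := by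
  have hE := qPoch_self_ne_zero (norm_nome_lt_one hτ)
  -- These are (-1)^n p^{n(n-1)/2} t^n with t = e^{2πiu}, the coefficients of the triple product.
  -- They are also theta terms at a shifted argument, which gives summability.
  set d : ℤ → ℂ := fun n => exp (Real.pi * I * n + Real.pi * I * τ * (n * (n - 1)) +
    2 * Real.pi * I * n * u) with hd
  have hdt : ∀ n, d n = jacobiTheta₂_term n (u + 1 / 2 - τ / 2) τ := fun n => by
    rw [hd, jacobiTheta₂_term]; ring_nf
  have key := mTheta_mul_qPoch_eq_tsum (norm_nome_lt_one hτ) (nome_ne_zero τ) (nome_ne_zero u)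
    (d := d) (by simp [hd]) (fun n => by
      rw [hd, ← nome_int_mul, nome, nome, ← exp_add, ← exp_add]
      refine exp_eq_neg_exp_of_int 0 ?_
      push_cast; ring) (by
      simp only [hdt]
      exact ((summable_jacobiTheta₂_term_iff _ _).mpr hτ).norm)
  have h1 : theta1 u τ = I * exp (Real.pi * I * τ / 4) * exp (-(Real.pi * I * u)) * ∑' n, d n := by
    rw [theta1, ← (Equiv.addRight (-1 : ℤ)).tsum_eq, ← tsum_mul_left, ← tsum_neg]
    refine tsum_congr fun n => ?_
    have h2 : ∀ a b : ℂ, a = b + Real.pi / 2 * I - Real.pi * I → -exp a = I * exp b := by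
      rintro a b rfl
      rw [exp_sub, exp_add, exp_pi_mul_I, exp_pi_div_two_mul_I]
      ring
    simp only [hd, Equiv.coe_addRight]
    rw [mul_assoc I, mul_assoc I, ← exp_add, ← exp_add, ← exp_add]
    refine h2 _ _ ?_
    push_cast; ring
  rw [Rconst, h1, ← key]
  have : exp (-(Real.pi * I * τ / 4)) * exp (Real.pi * I * τ / 4) = 1 := by
    rw [← exp_add, neg_add_cancel, exp_zero]
  field_simp
  linear_combination (mTheta (nome u) (nome τ)) * this

lemma Rconst_ne_zero {τ : ℂ} (hτ : 0 < τ.im) : Rconst τ ≠ 0 :=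
  div_ne_zero (exp_ne_zero _) (mul_ne_zero I_ne_zero (qPoch_self_ne_zero (norm_nome_lt_one hτ)))

lemma mTheta_nome_eq_zero {τ : ℂ} (hτ : 0 < τ.im) {u : ℂ} (h : mTheta (nome u) (nome τ) = 0) :
    ∃ a b : ℤ, u = a + b * τ := by
  have hp := norm_nome_lt_one hτ
  rcases mul_eq_zero.mp h with h | h
  · obtain ⟨k, hk⟩ := (qPoch_eq_zero_iff hp _).mp h
    rw [← nome_nat_mul, ← nome_add, nome_eq_one_iff] at hk
    obtain ⟨a, ha⟩ := hk
    exact ⟨a, -k, by push_cast; linear_combination ha⟩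
  · obtain ⟨k, hk⟩ := (qPoch_eq_zero_iff hp _).mp h
    rw [← nome_nat_mul, ← nome_neg, ← nome_add, ← nome_add, nome_eq_one_iff] at hk
    obtain ⟨a, ha⟩ := hk
    exact ⟨-a, k + 1, by push_cast; linear_combination -ha⟩

lemma theta1_eq_zero {τ : ℂ} (hτ : 0 < τ.im) {u : ℂ} (h : theta1 u τ = 0) :
    ∃ a b : ℤ, u = a + b * τ := by
  have := Rconst_mul_theta1 hτ u
  rw [h, mul_zero, eq_comm, mul_eq_zero, or_iff_right (exp_ne_zero _)] at this
  exact mTheta_nome_eq_zero hτ this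

lemma jacobiTheta₂_eq_zero {τ : ℂ} (hτ : 0 < τ.im) {u : ℂ} (h : jacobiTheta₂ u τ = 0) :
    ∃ a b : ℤ, u = a + 1 / 2 + b * τ + τ / 2 := by
  have h1 : theta1 (u - 1 / 2 - τ / 2) τ = 0 := by
    rw [theta1_eq, show u - 1 / 2 - τ / 2 + 1 / 2 + τ / 2 = u by ring, h, mul_zero, neg_zero]
  obtain ⟨a, b, hab⟩ := theta1_eq_zero hτ h1
  exact ⟨a, b, by linear_combination hab⟩

/-! ### The theta functions `θ₃` and `θ₄` -/

section Vartheta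

variable {ϑ : ℂ → ℂ → ℂ} (hϑ : ϑ = theta3 ∨ ϑ = theta4)
include hϑ

lemma vartheta_add_one (z ω : ℂ) : ϑ (z + 1) ω = ϑ z ω := by
  rcases hϑ with rfl | rfl
  · rw [theta3_eq, theta3_eq, jacobiTheta₂_add_left]
  · rw [theta4_eq, theta4_eq, add_right_comm, jacobiTheta₂_add_left]

lemma vartheta_neg (z ω : ℂ) : ϑ (-z) ω = ϑ z ω := by
  rcases hϑ with rfl | rfl
  · rw [theta3_eq, theta3_eq, jacobiTheta₂_neg_left]
  · rw [theta4_eq, theta4_eq, ← jacobiTheta₂_neg_left, ← jacobiTheta₂_add_left]; ring_nf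

lemma vartheta_add_period :
    ∃ σ : ℂ, σ ^ 2 = 1 ∧ ∀ z ω, ϑ (z + ω) ω = σ * exp (-(Real.pi * I * (ω + 2 * z))) * ϑ z ω := by
  rcases hϑ with rfl | rfl
  · refine ⟨1, one_pow 2, fun z ω => ?_⟩
    rw [theta3_eq, theta3_eq, jacobiTheta₂_add_left']; ring_nf
  · refine ⟨-1, by norm_num, fun z ω => ?_⟩
    rw [theta4_eq, theta4_eq, add_right_comm, jacobiTheta₂_add_left',
      exp_eq_neg_exp_of_int (b := -(Real.pi * I * (ω + 2 * z))) (-1) (by push_cast; ring)]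
    ring

/-- Across two periods the sign σ enters only as σ² = 1, so θ₃ and θ₄ have the same multiplier. -/
lemma vartheta_add_period_eq (u ω : ℂ) : ϑ (u + ω) ω = (nome u ^ 2)⁻¹ * ϑ (u - ω) ω := by
  obtain ⟨σ, hσ, h⟩ := vartheta_add_period hϑ
  have h1 := h (u - ω) ω
  rw [sub_add_cancel] at h1
  rw [h, h1, nome, ← exp_nat_mul, ← exp_neg]
  have : exp (-((2 : ℕ) * (2 * Real.pi * I * u))) = exp (-(Real.pi * I * (ω + 2 * u))) *
      exp (-(Real.pi * I * (ω + 2 * (u - ω)))) := by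
    rw [← exp_add]; push_cast; ring_nf
  rw [this]
  linear_combination (exp (-(Real.pi * I * (ω + 2 * u))) *
      exp (-(Real.pi * I * (ω + 2 * (u - ω)))) * ϑ (u - ω) ω) * hσ

lemma differentiable_vartheta {ω : ℂ} (hω : 0 < ω.im) : Differentiable ℂ fun z => ϑ z ω := by
  rcases hϑ with rfl | rfl
  · simp only [theta3_eq]
    exact fun z => differentiableAt_jacobiTheta₂_fst z hω
  · simp only [theta4_eq]
    intro z
    have h : DifferentiableAt ℂ (fun z : ℂ => z + 1 / 2) z := by fun_prop
    exact (differentiableAt_jacobiTheta₂_fst (z + 1 / 2) hω).comp z h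

/-- Each of `θ₃`, `θ₄` comes with a partner, namely the other one. -/
lemma exists_partner :
    ∃ (ϑ' : ℂ → ℂ → ℂ) (κ : ℂ), (∀ τ : ℂ, 0 < τ.im → ∀ x y, ϑ' x (τ / 2) * ϑ y (τ / 2) -
      ϑ' y (τ / 2) * ϑ x (τ / 2) = κ * (theta1 (x + y) τ * theta1 (x - y) τ)) ∧
      ∀ n j : ℕ, j < n → ∃ k < n, ∀ z ω, (ϑ z ω ^ n)⁻¹ * (theta3 z ω ^ j * theta4 z ω ^ (n - 1 - j)) =
        (ϑ z ω)⁻¹ * (ϑ' z ω / ϑ z ω) ^ k := by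
  rcases hϑ with rfl | rfl
  · refine ⟨theta4, 2, fun τ hτ x y => by rw [two_mul_theta1_mul_theta1 hτ],
      fun n j hj => ⟨n - 1 - j, by omega, fun z ω => ?_⟩⟩
    obtain ⟨r, rfl⟩ : ∃ r, n = j + r + 1 := ⟨n - 1 - j, by omega⟩
    rw [show j + r + 1 - 1 - j = r by omega]
    by_cases h : theta3 z ω = 0
    · simp [h]
    · rw [div_pow]
      field_simp
      ring
  · refine ⟨theta3, -2, fun τ hτ x y => ?_, fun n j hj => ⟨j, hj, fun z ω => ?_⟩⟩
    · linear_combination two_mul_theta1_mul_theta1 hτ x y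
    obtain ⟨r, rfl⟩ : ∃ r, n = j + r + 1 := ⟨n - 1 - j, by omega⟩
    rw [show j + r + 1 - 1 - j = r by omega]
    by_cases h : theta4 z ω = 0
    · simp [h]
    · rw [div_pow]
      field_simp
      ring

/-- By the addition formula each product of two θ₁ is a 2×2 minor in (θ₃, θ₄) at two of the points
z+g, z-g, x. The relation is the vanishing of a 3×3 determinant with a repeated column. -/
lemma vartheta_three_term {τ : ℂ} (hτ : 0 < τ.im) (z g x : ℂ) :
    ϑ (z + g) (τ / 2) * (theta1 (z - g + x) τ * theta1 (z - g - x) τ) -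
      ϑ (z - g) (τ / 2) * (theta1 (z + g + x) τ * theta1 (z + g - x) τ) =
    -(ϑ x (τ / 2) * (theta1 (2 * z) τ * theta1 (2 * g) τ)) := by
  have h1 := two_mul_theta1_mul_theta1 hτ (z - g) x
  have h2 := two_mul_theta1_mul_theta1 hτ (z + g) x
  have h3 := two_mul_theta1_mul_theta1 hτ (z + g) (z - g)
  rw [show z + g + (z - g) = 2 * z by ring, show z + g - (z - g) = 2 * g by ring] at h3
  rcases hϑ with rfl | rfl
  · linear_combination (1 / 2) * (theta3 (z + g) (τ / 2) * h1 - theta3 (z - g) (τ / 2) * h2 +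
      theta3 x (τ / 2) * h3)
  · linear_combination (1 / 2) * (theta4 (z + g) (τ / 2) * h1 - theta4 (z - g) (τ / 2) * h2 +
      theta4 x (τ / 2) * h3)

end Vartheta

/-! ### The difference operators -/

/-- The symmetry (η, τ) ↦ (τ/2, 2η) makes every statement about A blocks a statement about B blocks.
-/
lemma opB_eq (η τ : ℂ) (ϑ : ℂ → ℂ → ℂ) (g : ℂ) (f : ℂ → ℂ) :
    opB η τ ϑ g f = opA (τ / 2) (2 * η) ϑ g f := by
  have h : ∀ x : ℂ, 2 * Real.pi * I * x ^ 2 / τ = Real.pi * I * x ^ 2 / (τ / 2) := fun x => by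
    rw [div_div_eq_mul_div]; ring_nf
  funext z
  simp only [opB, opA, h, mul_div_cancel_left₀ η (two_ne_zero' ℂ)]

lemma iterB_eq (η τ : ℂ) (ϑ : ℂ → ℂ → ℂ) (g : ℂ) (m : ℕ) (f : ℂ → ℂ) :
    iterB η τ ϑ g m f = iterA (τ / 2) (2 * η) ϑ g m f := by
  induction m with
  | zero => rfl
  | succ m ih => rw [iterB, iterA, ih, opB_eq]

/-- Completing the square: the Gaussians together with e^{πiη} collapse to e^{∓2πiz}. -/
lemma opA_apply {η : ℂ} (hη : η ≠ 0) (τ : ℂ) (ϑ : ℂ → ℂ → ℂ) (g : ℂ) (f : ℂ → ℂ) (z : ℂ) :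
    opA η τ ϑ g f z = (Rconst τ * theta1 (2 * z) τ)⁻¹ *
      (ϑ (z + g + η) (τ / 2) * ((nome z)⁻¹ * f (z + η)) -
        ϑ (z - g - η) (τ / 2) * (nome z * f (z - η))) := by
  have h1 : exp (Real.pi * I * z ^ 2 / η) * exp (Real.pi * I * η) *
      exp (-(Real.pi * I * (z + η) ^ 2 / η)) = (nome z)⁻¹ := by
    rw [nome, ← exp_neg, ← exp_add, ← exp_add]; congr 1; field_simp; ring
  have h2 : exp (Real.pi * I * z ^ 2 / η) * exp (Real.pi * I * η) *
      exp (-(Real.pi * I * (z - η) ^ 2 / η)) = nome z := by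
    rw [nome, ← exp_add, ← exp_add]; congr 1; field_simp; ring
  rw [opA, mul_inv, div_div, div_eq_mul_inv (exp (Real.pi * I * η)), mul_inv]
  linear_combination ((Rconst τ)⁻¹ * (theta1 (2 * z) τ)⁻¹) *
    (ϑ (z + g + η) (τ / 2) * f (z + η) * h1 - ϑ (z - g - η) (τ / 2) * f (z - η) * h2)

lemma theta1_two_mul_add (z ω : ℂ) :
    theta1 (2 * (z + ω / 2)) ω = -(nome z ^ 2 * nome (ω / 2))⁻¹ * theta1 (2 * z) ω := by
  rw [show 2 * (z + ω / 2) = 2 * z + ω by ring, theta1_add_period, nome, nome, ← exp_nat_mul,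
    ← exp_add, ← exp_neg]
  push_cast; ring_nf

lemma theta1_two_mul_sub (z ω : ℂ) :
    theta1 (2 * (z - ω / 2)) ω = -(nome z ^ 2 * (nome (ω / 2))⁻¹) * theta1 (2 * z) ω := by
  have h := theta1_two_mul_add (z - ω / 2) ω
  have h1 := nome_ne_zero z
  have h2 := nome_ne_zero (ω / 2)
  rw [sub_add_cancel, nome_sub] at h
  rw [h]
  field_simp

/-- Both sides are combinations of the four values f(z ± η ± τ/2). The denominators are
quasi-periodic under the shift made by the other operator, and the numerators that disagree differ
by two periods. The increments τ/2 and η of the spin are what makes all multipliers match. -/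
lemma opA_opB_comm {η τ : ℂ} (hη : η ≠ 0) (hτ : τ ≠ 0) {ϑ : ℂ → ℂ → ℂ}
    (hϑ : ϑ = theta3 ∨ ϑ = theta4) (g : ℂ) (f : ℂ → ℂ) :
    opA η τ ϑ (g + τ / 2) (opB η τ ϑ g f) = opB η τ ϑ (g + η) (opA η τ ϑ g f) := by
  have hτ2 : τ / 2 ≠ 0 := by simpa using hτ
  funext z
  have e1 := theta1_two_mul_add z (2 * η)
  have e2 := theta1_two_mul_sub z (2 * η)
  have e3 := theta1_two_mul_add z τ
  have e4 := theta1_two_mul_sub z τ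
  rw [mul_div_cancel_left₀ η (two_ne_zero' ℂ)] at e1 e2
  have q1 := vartheta_add_period_eq hϑ (z + g + η) (τ / 2)
  have q2 := vartheta_add_period_eq hϑ (z - g - τ / 2) η
  have q3 := vartheta_add_period_eq hϑ (z + g + τ / 2) η
  have q4 := vartheta_add_period_eq hϑ (z - g - η) (τ / 2)
  simp only [opB_eq, opA_apply hη, opA_apply hτ2, e1, e2, e3, e4, mul_inv, inv_inv,
    mul_div_cancel_left₀ η (two_ne_zero' ℂ), nome_add, nome_sub, inv_neg] at q1 q2 q3 q4 ⊢
  rw [show z + (g + τ / 2) + η = z + g + η + τ / 2 by ring,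
    show z - (g + τ / 2) - η = z - g - η - τ / 2 by ring,
    show z + η + g + τ / 2 = z + g + τ / 2 + η by ring,
    show z + η - g - τ / 2 = z - g - τ / 2 + η by ring,
    show z - η + g + τ / 2 = z + g + τ / 2 - η by ring,
    show z - η - g - τ / 2 = z - g - τ / 2 - η by ring,
    show z + (g + η) + τ / 2 = z + g + τ / 2 + η by ring,
    show z - (g + η) - τ / 2 = z - g - τ / 2 - η by ring,
    show z + τ / 2 + g + η = z + g + η + τ / 2 by ring,
    show z + τ / 2 - g - η = z - g - η + τ / 2 by ring,
    show z - τ / 2 + g + η = z + g + η - τ / 2 by ring,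
    show z - τ / 2 - g - η = z - g - η - τ / 2 by ring,
    show z + τ / 2 + η = z + η + τ / 2 by ring, show z + τ / 2 - η = z - η + τ / 2 by ring,
    show z - τ / 2 + η = z + η - τ / 2 by ring, show z - τ / 2 - η = z - η - τ / 2 by ring,
    q1, q2, q3, q4]
  have hz := nome_ne_zero z
  have hg := nome_ne_zero g
  have hh := nome_ne_zero η
  have ht := nome_ne_zero (τ / 2)
  -- The inverses are treated as letters instead of being cleared, so the identity also holds where
  -- a denominator vanishes.
  generalize (Rconst τ)⁻¹ = r1, (theta1 (2 * z) τ)⁻¹ = r2, (Rconst (2 * η))⁻¹ = r3,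
    (theta1 (2 * z) (2 * η))⁻¹ = r4
  field_simp
  ring

lemma iterA_iterB_comm {η τ : ℂ} (hη : η ≠ 0) (hτ : τ ≠ 0) {ϑ : ℂ → ℂ → ℂ}
    (hϑ : ϑ = theta3 ∨ ϑ = theta4) (g : ℂ) (n m : ℕ) (f : ℂ → ℂ) :
    iterA η τ ϑ (g + m * (τ / 2)) n (iterB η τ ϑ g m f) =
      iterB η τ ϑ (g + n * η) m (iterA η τ ϑ g n f) := by
  have h1 : ∀ (g : ℂ) (f : ℂ → ℂ), iterA η τ ϑ (g + τ / 2) n (opB η τ ϑ g f) =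
      opB η τ ϑ (g + n * η) (iterA η τ ϑ g n f) := by
    intro g f
    induction n with
    | zero => simp [iterA]
    | succ n ih =>
      rw [iterA, ih, iterA, show g + τ / 2 + n * η = g + n * η + τ / 2 by ring,
        opA_opB_comm hη hτ hϑ]
      congr 1; push_cast; ring
  induction m with
  | zero => simp [iterB]
  | succ m ih =>
    rw [iterB, iterB, show g + ((m + 1 : ℕ) : ℂ) * (τ / 2) = g + m * (τ / 2) + τ / 2 by
      push_cast; ring, h1, ih]
    congr 1; ring

/-! ### Divided differences of monomials -/

/-- The divided difference of `y ↦ y ^ k` at the nodes `Y 0, …, Y r`. -/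
def monomialDiff : ℕ → ℕ → (ℕ → ℂ) → ℂ
  | k, 0, Y => Y 0 ^ k
  | 0, _ + 1, _ => 0
  | k + 1, r + 1, Y => Y (r + 1) * monomialDiff k (r + 1) Y + monomialDiff k r Y

lemma monomialDiff_eq_zero {k r : ℕ} (h : k < r) (Y : ℕ → ℂ) : monomialDiff k r Y = 0 := by
  induction k generalizing r with
  | zero =>
    obtain ⟨r, rfl⟩ := Nat.exists_eq_succ_of_ne_zero h.ne'
    rfl
  | succ k ih =>
    obtain ⟨r, rfl⟩ := Nat.exists_eq_succ_of_ne_zero (Nat.ne_of_gt (Nat.zero_lt_of_lt h))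
    rw [Nat.succ_eq_add_one, monomialDiff, ih (by omega), ih (by omega), mul_zero, add_zero]

/-- The usual quotient recursion in multiplied form. Since the definition proceeds by the Leibniz
rule in the exponent, no distinctness of the nodes is needed. -/
lemma monomialDiff_succ (k r : ℕ) (Y : ℕ → ℂ) :
    monomialDiff k r (fun i => Y (i + 1)) - monomialDiff k r Y =
      (Y (r + 1) - Y 0) * monomialDiff k (r + 1) Y := by
  induction k generalizing r with
  | zero => cases r <;> simp [monomialDiff]
  | succ k ih =>
    cases r with
    | zero =>
      have := ih 0
      simp only [monomialDiff, zero_add] at this ⊢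
      linear_combination Y 1 * this
    | succ r =>
      have h1 := ih r
      have h2 := ih (r + 1)
      rw [monomialDiff, monomialDiff, monomialDiff]
      linear_combination Y (r + 1 + 1) * h2 + h1

/-! ### Annihilation by the difference operators -/

/-- The algebra of one application of A_k to a divided difference, in abstract letters: θ stands for
the denominator θ₁(2z), and `hy` is the addition formula that cancels it. -/
lemma combine_terms {R θ x₀ x₁ n g Q D₀ D₁ D y t κ ε : ℂ} (hθ : θ ≠ 0) (h₁ : x₁ ≠ 0)
    (h₀ : x₀ ≠ 0) (hn : n ≠ 0) (hQ : Q ≠ 0) (hD : D₁ - D₀ = y * D)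
    (hy : x₁ * x₀ * y = κ * (ε * θ * t)) :
    (R * θ)⁻¹ * (x₁ * (n⁻¹ * (n ^ 2 * g * (Q * x₁)⁻¹ * D₁)) - x₀ * (n * (g * (Q * x₀)⁻¹ * D₀))) =
      R⁻¹ * (κ * ε * t) * (n * g) * (Q * x₀ * x₁)⁻¹ * D := by
  rw [sub_eq_iff_eq_add.mp hD, mul_inv]
  field_simp
  linear_combination (R⁻¹ * g * D) * hy

/-- The condition on G gives the two terms of A_k a common prefactor. Their difference is then that
of two divided differences of order r, and the addition formula converts Y_{r+1} - Y_0 into the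
denominator θ₁(2z) and a constant. Hence each A_k raises the order by one. -/
lemma iterA_eq_monomialDiff {η τ : ℂ} (hη : η ≠ 0) {ϑ ϑ' : ℂ → ℂ → ℂ} {κ s : ℂ}
    (hκ : ∀ x y, ϑ' x (τ / 2) * ϑ y (τ / 2) - ϑ' y (τ / 2) * ϑ x (τ / 2) =
      κ * (theta1 (x + y) τ * theta1 (x - y) τ))
    (hs : ∀ z, ϑ (z - s) (τ / 2) = ϑ (z + s) (τ / 2))
    {ε : ℂ} (hε : ∀ z, theta1 (2 * z + 2 * s) τ = ε * theta1 (2 * z) τ)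
    {G : ℂ → ℂ} (hG : ∀ z, G (z + η) = nome z ^ 2 * G (z - η)) (k r : ℕ) :
    ∃ G' : ℂ → ℂ, (∀ z, G' (z + η) = nome z ^ 2 * G' (z - η)) ∧
      ∀ z, (∀ a : ℤ, |a| < r → theta1 (2 * (z + a * η)) τ ≠ 0) →
        (∀ a : ℤ, |a| ≤ r → ϑ (z + s + a * η) (τ / 2) ≠ 0) →
        iterA η τ ϑ s r (fun z => G z * ((ϑ (z + s) (τ / 2))⁻¹ *
          (ϑ' (z + s) (τ / 2) / ϑ (z + s) (τ / 2)) ^ k)) z =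
        G' z * (∏ c ∈ Finset.range (r + 1), ϑ (z + s + (2 * c - r) * η) (τ / 2))⁻¹ *
          monomialDiff k r (fun c => ϑ' (z + s + (2 * c - r) * η) (τ / 2) /
            ϑ (z + s + (2 * c - r) * η) (τ / 2)) := by
  induction r with
  | zero => exact ⟨G, hG, fun z _ _ => by simp [iterA, monomialDiff, mul_assoc]⟩
  | succ r ih =>
    obtain ⟨G₀, hG₀, ih⟩ := ih
    -- The constant θ₁(2(r+1)η) is the other factor of the addition formula at the two extreme
    -- nodes, whose difference is 2(r+1)η.
    refine ⟨fun z => (Rconst τ)⁻¹ * (κ * ε * theta1 (2 * (r + 1) * η) τ) * (nome z * G₀ (z - η)),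
      fun z => ?_, fun z h1 h2 => ?_⟩
    · have hz := nome_ne_zero η
      have h' := hG₀ (z - η)
      rw [sub_add_cancel] at h'
      dsimp only
      rw [add_sub_cancel_right, h', nome_add, nome_sub]
      field_simp
    · set X : ℕ → ℂ := fun c => ϑ (z + s + (2 * c - (r + 1 : ℕ)) * η) (τ / 2) with hX
      set Y : ℕ → ℂ := fun c => ϑ' (z + s + (2 * c - (r + 1 : ℕ)) * η) (τ / 2) / X c with hY
      have hX0 : ∀ c ≤ r + 1, X c ≠ 0 := fun c hc => by
        have := h2 (2 * c - (r + 1 : ℕ)) (by rw [abs_le]; push_cast; omega)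
        push_cast at this
        simpa [hX] using this
      have up := ih (z + η) (fun a ha => by
          have := h1 (a + 1) (by rw [abs_lt] at ha ⊢; push_cast; omega)
          push_cast at this
          rwa [show z + η + a * η = z + (a + 1) * η by ring]) (fun a ha => by
          have := h2 (a + 1) (by rw [abs_le] at ha ⊢; push_cast; omega)
          push_cast at this
          rwa [show z + η + s + a * η = z + s + (a + 1) * η by ring])
      have dn := ih (z - η) (fun a ha => by
          have := h1 (a - 1) (by rw [abs_lt] at ha ⊢; push_cast; omega)
          push_cast at this
          rwa [show z - η + a * η = z + (a - 1) * η by ring]) (fun a ha => by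
          have := h2 (a - 1) (by rw [abs_le] at ha ⊢; push_cast; omega)
          push_cast at this
          rwa [show z - η + s + a * η = z + s + (a - 1) * η by ring])
      -- Of the r+2 nodes around z, the value at z+η involves nodes 1, …, r+1 and the value at z-η
      -- nodes 0, …, r, the two tuples compared in `monomialDiff_succ`.
      have eup : ∀ c : ℕ, z + η + s + (2 * c - r) * η =
          z + s + (2 * ((c + 1 : ℕ) : ℂ) - (r + 1 : ℕ)) * η := fun c => by push_cast; ring
      have edn : ∀ c : ℕ, z - η + s + (2 * c - r) * η =
          z + s + (2 * (c : ℂ) - (r + 1 : ℕ)) * η := fun c => by push_cast; ring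
      simp only [eup] at up
      simp only [edn] at dn
      rw [iterA, opA_apply hη, up, dn, hG₀ z]
      have et : ϑ (z + (s + r * η) + η) (τ / 2) = X (r + 1) := by
        simp only [hX]; congr 1; push_cast; ring
      -- The coefficient of the backward shift is evaluated at -s rather than +s; as 2s is 0 or 1,
      -- periodicity identifies it with ϑ at the lowest node.
      have eb : ϑ (z - (s + r * η) - η) (τ / 2) = X 0 := by
        rw [show z - (s + r * η) - η = (z - (r + 1) * η) - s by ring, hs]
        simp only [hX]; congr 1; push_cast; ring
      have hdiff := monomialDiff_succ k r Y
      have hYX : X (r + 1) * X 0 * (Y (r + 1) - Y 0) =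
          κ * (ε * theta1 (2 * z) τ * theta1 (2 * (r + 1) * η) τ) := by
        have := hκ (z + s + (2 * (r + 1 : ℕ) - (r + 1 : ℕ)) * η) (z + s + (2 * (0 : ℕ) - (r + 1 : ℕ)) * η)
        rw [show z + s + (2 * ((r + 1 : ℕ) : ℂ) - (r + 1 : ℕ)) * η +
          (z + s + (2 * ((0 : ℕ) : ℂ) - (r + 1 : ℕ)) * η) = 2 * z + 2 * s by push_cast; ring,
          show z + s + (2 * ((r + 1 : ℕ) : ℂ) - (r + 1 : ℕ)) * η -
          (z + s + (2 * ((0 : ℕ) : ℂ) - (r + 1 : ℕ)) * η) = 2 * (r + 1) * η by push_cast; ring,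
          hε] at this
        rw [← this]
        have a1 := hX0 (r + 1) le_rfl
        have a2 := hX0 0 (Nat.zero_le _)
        have e : ∀ a b x y : ℂ, x ≠ 0 → y ≠ 0 → x * y * (a / x - b / y) = a * y - b * x :=
          fun a b x y hx hy => by field_simp
        exact e _ _ _ _ a1 a2
      have hθ : theta1 (2 * z) τ ≠ 0 := by simpa using h1 0 (by simp)
      rw [et, eb]
      change _ * (X (r + 1) * (_ * (_ * (∏ c ∈ Finset.range (r + 1), X (c + 1))⁻¹ *
          monomialDiff k r (fun c => Y (c + 1)))) - X 0 * (_ * (_ * (∏ c ∈ Finset.range (r + 1), X c)⁻¹ *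
          monomialDiff k r Y))) = _ * (∏ c ∈ Finset.range (r + 1 + 1), X c)⁻¹ * monomialDiff k (r + 1) Y
      have p1 : ∏ c ∈ Finset.range (r + 1), X (c + 1) =
          (∏ c ∈ Finset.range r, X (c + 1)) * X (r + 1) := Finset.prod_range_succ _ _
      have p2 : ∏ c ∈ Finset.range (r + 1), X c = (∏ c ∈ Finset.range r, X (c + 1)) * X 0 :=
        Finset.prod_range_succ' _ _
      rw [Finset.prod_range_succ _ (r + 1), p1, p2]
      have hQ : ∏ c ∈ Finset.range r, X (c + 1) ≠ 0 :=
        Finset.prod_ne_zero_iff.mpr fun c hc => hX0 _ (by have := Finset.mem_range.mp hc; omega)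
      have a1 := hX0 (r + 1) le_rfl
      have a2 := hX0 0 (Nat.zero_le _)
      have hz := nome_ne_zero z
      exact combine_terms hθ a1 a2 hz hQ hdiff hYX

/-- The monomial has degree k < n, so its divided difference of order n vanishes. -/
lemma iterA_eq_zero {η τ : ℂ} (hη : η ≠ 0) (hτ : 0 < τ.im) {ϑ : ℂ → ℂ → ℂ}
    (hϑ : ϑ = theta3 ∨ ϑ = theta4) {s : ℂ} (hs : s = 0 ∨ s = 1 / 2)
    {G : ℂ → ℂ} (hG : ∀ z, G (z + η) = nome z ^ 2 * G (z - η)) {n j : ℕ} (hj : j < n) {z : ℂ}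
    (h1 : ∀ a : ℤ, |a| < n → theta1 (2 * (z + a * η)) τ ≠ 0)
    (h2 : ∀ a : ℤ, |a| ≤ n → ϑ (z + s + a * η) (τ / 2) ≠ 0) :
    iterA η τ ϑ s n (fun z => G z * ((ϑ (z + s) (τ / 2) ^ n)⁻¹ *
      (theta3 (z + s) (τ / 2) ^ j * theta4 (z + s) (τ / 2) ^ (n - 1 - j)))) z = 0 := by
  obtain ⟨ϑ', κ, hκ, hk⟩ := exists_partner hϑ
  obtain ⟨k, hkn, hk⟩ := hk n j hj
  have hs1 : ∀ z, ϑ (z - s) (τ / 2) = ϑ (z + s) (τ / 2) := by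
    rcases hs with rfl | rfl
    · simp
    · intro z; rw [← vartheta_add_one hϑ (z - 1 / 2)]; ring_nf
  have hε : ∃ ε : ℂ, ∀ z, theta1 (2 * z + 2 * s) τ = ε * theta1 (2 * z) τ := by
    rcases hs with rfl | rfl
    · exact ⟨1, fun z => by simp⟩
    · exact ⟨-1, fun z => by rw [show 2 * z + 2 * (1 / 2) = 2 * z + 1 by ring, theta1_add_one]; ring⟩
  obtain ⟨ε, hε⟩ := hε
  obtain ⟨G', -, h⟩ := iterA_eq_monomialDiff hη (hκ τ hτ) hs1 hε hG k n
  simp only [hk]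
  rw [h z h1 h2, monomialDiff_eq_zero hkn, mul_zero]

/-- Carries the condition along z + (ω/2)ℤ; `Regular` controls θ₁(2·|τ) only on z + ηℤ. -/
lemma theta1_two_mul_add_int_ne_zero {z ω : ℂ} (h : theta1 (2 * z) ω ≠ 0) (b : ℤ) :
    theta1 (2 * (z + b * (ω / 2))) ω ≠ 0 := by
  induction b with
  | zero => simpa using h
  | succ b ih =>
    rw [show z + ((b + 1 : ℤ) : ℂ) * (ω / 2) = z + (b : ℤ) * (ω / 2) + ω / 2 by push_cast; ring,
      theta1_two_mul_add]
    exact mul_ne_zero (neg_ne_zero.mpr (inv_ne_zero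
      (mul_ne_zero (pow_ne_zero _ (nome_ne_zero _)) (nome_ne_zero _)))) ih
  | pred b ih =>
    rw [show z + ((-b - 1 : ℤ) : ℂ) * (ω / 2) = z + (-b : ℤ) * (ω / 2) - ω / 2 by push_cast; ring,
      theta1_two_mul_sub]
    exact mul_ne_zero (neg_ne_zero.mpr (mul_ne_zero (pow_ne_zero _ (nome_ne_zero _))
      (inv_ne_zero (nome_ne_zero _)))) ih

/-- An operator `A_k ⋯ A_k` or `B_k ⋯ B_k` evaluated at `z` depends only on the values of the
function on `z + ηℤ`. -/
lemma iterA_congr_zero {η : ℂ} (hη : η ≠ 0) (τ : ℂ) (ϑ : ℂ → ℂ → ℂ) (g : ℂ) (n : ℕ) {f : ℂ → ℂ} {z : ℂ}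
    (hf : ∀ a : ℤ, |a| ≤ n → f (z + a * η) = 0) : iterA η τ ϑ g n f z = 0 := by
  induction n generalizing z with
  | zero => simpa [iterA] using hf 0
  | succ n ih =>
    rw [iterA, opA_apply hη, ih, ih]
    · simp
    · intro a ha
      rw [show z - η + a * η = z + (a - 1 : ℤ) * η by push_cast; ring]
      exact hf _ (by rw [abs_le] at ha ⊢; push_cast; omega)
    · intro a ha
      rw [show z + η + a * η = z + (a + 1 : ℤ) * η by push_cast; ring]
      exact hf _ (by rw [abs_le] at ha ⊢; push_cast; omega)

/-- The quasi-periodic factor `θ_k^{-n} θ₃^j θ₄^{n-1-j}` with nome ratio `η`. -/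
lemma vartheta_ratio_add {ϑ : ℂ → ℂ → ℂ} (hϑ : ϑ = theta3 ∨ ϑ = theta4) {n j : ℕ} (hj : j < n)
    (s : ℂ) (hs : s = 0 ∨ s = 1 / 2) (ω z : ℂ) :
    (ϑ (z + ω + s) ω ^ n)⁻¹ * (theta3 (z + ω + s) ω ^ j * theta4 (z + ω + s) ω ^ (n - 1 - j)) =
    nome z ^ 2 * ((ϑ (z - ω + s) ω ^ n)⁻¹ *
      (theta3 (z - ω + s) ω ^ j * theta4 (z - ω + s) ω ^ (n - 1 - j))) := by
  have hn : nome (z + s) ^ 2 = nome z ^ 2 := by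
    rcases hs with rfl | rfl
    · simp
    · rw [← nome_nat_mul, ← nome_nat_mul, show ((2 : ℕ) : ℂ) * (z + 1 / 2) = (2 : ℕ) * z + 1 by
        push_cast; ring, nome_add, nome_one, mul_one]
  rw [add_right_comm, sub_add_eq_add_sub, vartheta_add_period_eq hϑ,
    vartheta_add_period_eq (Or.inl rfl : theta3 = theta3 ∨ theta3 = theta4),
    vartheta_add_period_eq (Or.inr rfl : theta4 = theta3 ∨ theta4 = theta4), hn]
  obtain ⟨r, rfl⟩ : ∃ r, n = j + r + 1 := ⟨n - 1 - j, by omega⟩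
  rw [show j + r + 1 - 1 - j = r by omega]
  have := nome_ne_zero z
  simp only [mul_pow, mul_inv, inv_pow, inv_inv]
  field_simp
  ring

/-- One of the two theta quotients becomes the monomial that is annihilated. The other, of total
degree -1, supplies the multiplier e^{4πiz} required of G, and ψ must have the period 2η or τ of the
block that annihilates. -/
lemma diffKills_phi {η τ : ℂ} (hη : 0 < η.im) (hτ : 0 < τ.im) {n m j l : ℕ} (hj : j < n)
    (hl : l < m) {s : ℂ} (hs : s = 0 ∨ s = 1 / 2) {ψ : ℂ → ℂ}
    (hψ : Function.Periodic ψ (2 * η) ∨ Function.Periodic ψ τ) :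
    DiffKills η τ s n m (fun z => phi η τ n m j l z * ψ z) := by
  intro ϑ hϑ z ⟨hz1, hz2, hz3⟩
  have hη0 : η ≠ 0 := by rintro rfl; simp at hη
  have hτ0 : τ ≠ 0 := by rintro rfl; simp at hτ
  have hτ2 : τ / 2 ≠ 0 := by simpa using hτ0
  have h2η : 0 < (2 * η).im := by simpa using hη
  have h2 : 2 * η / 2 = η := mul_div_cancel_left₀ η (two_ne_zero' ℂ)
  have hz3' : ∀ a b : ℤ, |a| ≤ n → |b| ≤ m → ϑ (z + s + a * η + b * (τ / 2)) η ≠ 0 ∧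
      ϑ (z + s + a * η + b * (τ / 2)) (τ / 2) ≠ 0 := fun a b ha hb => by
    have := mul_ne_zero_iff.mp (hz3 a b ha hb)
    exact ⟨fun h => this.1 (by rw [h, zero_pow (by omega)]),
      fun h => this.2 (by rw [h, zero_pow (by omega)])⟩
  rw [opM]
  rcases hψ with hψ | hψ
  -- The blocks are interchanged so that the A block acts first; the B block then only sees zeros
  -- along z + (τ/2)ℤ.
  · rw [iterA_iterB_comm hη0 hτ0 hϑ, iterB_eq]
    refine iterA_congr_zero hτ2 _ _ _ _ fun b hb => ?_
    have key := iterA_eq_zero hη0 hτ hϑ hs (n := n) (j := j) (z := z + b * (τ / 2))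
      (G := fun z => (ϑ (z + s) η ^ m)⁻¹ * (theta3 (z + s) η ^ l * theta4 (z + s) η ^ (m - 1 - l)) *
        ψ (z + s)) (fun z => ?_) hj (fun a ha => ?_) (fun a ha => ?_)
    · refine (congrArg (fun f => iterA η τ ϑ s n f _) (funext fun z => ?_)).trans key
      simp only [phi]; ring
    · rw [vartheta_ratio_add hϑ hl s hs, show z + η + s = z - η + s + 2 * η by ring, hψ]
      ring
    · rw [add_right_comm]
      exact theta1_two_mul_add_int_ne_zero (hz1 a ha) b
    · rw [show z + b * (τ / 2) + s + a * η = z + s + a * η + b * (τ / 2) by ring]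
      exact (hz3' a b ha hb).2
  -- Here the B block already acts first and annihilates the function at every point z + aη read by
  -- the A block.
  · refine iterA_congr_zero hη0 _ _ _ _ fun a ha => ?_
    rw [iterB_eq]
    have key := iterA_eq_zero hτ2 h2η hϑ hs (n := m) (j := l) (z := z + a * η)
      (G := fun z => (ϑ (z + s) (τ / 2) ^ n)⁻¹ * (theta3 (z + s) (τ / 2) ^ j *
        theta4 (z + s) (τ / 2) ^ (n - 1 - j)) * ψ (z + s)) (fun z => ?_) hl (fun b hb => ?_)
      (fun b hb => ?_)
    · refine (congrArg (fun f => iterA (τ / 2) (2 * η) ϑ s m f _) (funext fun z => ?_)).trans key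
      simp only [phi, h2]; ring
    · rw [vartheta_ratio_add hϑ hj s hs, show z + τ / 2 + s = z - τ / 2 + s + τ by ring, hψ]
      ring
    · exact hz2 a b ha hb
    · rw [h2, show z + a * η + s + b * (τ / 2) = z + s + a * η + b * (τ / 2) by ring]
      exact (hz3' a b ha hb).1

/-! ### The theta functions in the denominators -/

lemma qPoch_eq_mul {p : ℂ} (hp : ‖p‖ < 1) (t : ℂ) : qPoch t p = (1 - t) * qPoch (t * p) p := by
  rw [qPoch, tprod_eq_zero_mul']
  · simp [qPoch, pow_succ', mul_assoc]
  · simpa [pow_succ', mul_assoc] using multipliable_zeroProd (summable_norm_pow hp) (t * p)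

lemma mTheta_mul {p : ℂ} (hp : ‖p‖ < 1) (hp0 : p ≠ 0) {t : ℂ} (ht : t ≠ 0) :
    mTheta (t * p) p = -t⁻¹ * mTheta t p := by
  rw [mTheta, mTheta, qPoch_eq_mul hp t, show p * (t * p)⁻¹ = t⁻¹ by field_simp,
    qPoch_eq_mul hp t⁻¹, mul_comm t⁻¹ p]
  field_simp
  ring

/-- The inverse of this denominator has exactly the multiplier required of G, replacing the missing
theta quotient when n or m is zero. The constant r^{-1/4} cancels here; it matters only for the
position of the zeros. -/
lemma thetaDen_add_period {ω : ℂ} (hω : 0 < ω.im) (z : ℂ) :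
    thetaDen ω (z + ω / 2) = (nome z ^ 2)⁻¹ * thetaDen ω (z - ω / 2) := by
  have hp := norm_nome_lt_one hω
  have hp0 := nome_ne_zero ω
  set c := exp (-(Real.pi * I * ω / 2)) with hc
  have hc0 : c ≠ 0 := exp_ne_zero _
  have e : ∀ w, exp (2 * Real.pi * I * w) = nome w := fun w => rfl
  simp only [thetaDen, ← hc, e]
  have h1 : c * nome (z + ω / 2) = c * nome (z - ω / 2) * nome ω := by
    rw [mul_assoc, ← nome_add]; ring_nf
  have h2 : c * (nome (z - ω / 2))⁻¹ = c * (nome (z + ω / 2))⁻¹ * nome ω := by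
    rw [mul_assoc, ← nome_neg, ← nome_neg, ← nome_add]; ring_nf
  rw [h1, h2, mTheta_mul hp hp0 (mul_ne_zero hc0 (nome_ne_zero _)),
    mTheta_mul hp hp0 (mul_ne_zero hc0 (inv_ne_zero (nome_ne_zero _)))]
  rw [nome_add, nome_sub]
  have := nome_ne_zero z
  have := nome_ne_zero (ω / 2)
  field_simp

lemma diffKills_phiEta {η τ : ℂ} (hη : 0 < η.im) (hτ : 0 < τ.im) {n j : ℕ} (hj : j < n) {ψ : ℂ → ℂ}
    (hψ : Function.Periodic ψ (2 * η)) :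
    DiffKills η τ 0 n 0 (fun z => phiEta η τ n j z * ψ z) := by
  intro ϑ hϑ z ⟨hz1, _, hz3⟩
  have hη0 : η ≠ 0 := by rintro rfl; simp at hη
  have h2η : 0 < (2 * η).im := by simpa using hη
  have h2 : 2 * η / 2 = η := mul_div_cancel_left₀ η (two_ne_zero' ℂ)
  have key := iterA_eq_zero hη0 hτ hϑ (s := 0) (Or.inl rfl) (n := n) (j := j) (z := z)
    (G := fun z => (thetaDen (2 * η) z)⁻¹ * ψ z) (fun z => ?_) hj hz1 (fun a ha h => ?_)
  · rw [opM, iterB, Nat.cast_zero, zero_mul, add_zero]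
    refine (congrArg (fun f => iterA η τ ϑ 0 n f _) (funext fun z => ?_)).trans key
    simp only [phiEta, add_zero]
    rw [div_eq_mul_inv]; ring
  · have h := thetaDen_add_period h2η z
    rw [h2] at h
    rw [h, show z + η = z - η + 2 * η by ring, hψ, mul_inv, inv_inv, mul_assoc]
  · refine hz3 a 0 ha (by simp) ?_
    rw [Int.cast_zero, zero_mul, add_zero, h, zero_pow (by omega), mul_zero]

lemma diffKills_phiTau {η τ : ℂ} (hη : 0 < η.im) (hτ : 0 < τ.im) {m l : ℕ} (hl : l < m) {ψ : ℂ → ℂ}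
    (hψ : Function.Periodic ψ τ) :
    DiffKills η τ 0 0 m (fun z => phiTau η τ m l z * ψ z) := by
  intro ϑ hϑ z ⟨_, hz2, hz3⟩
  have hτ0 : τ / 2 ≠ 0 := by rw [div_ne_zero_iff]; refine ⟨?_, two_ne_zero⟩; rintro rfl; simp at hτ
  have h2η : 0 < (2 * η).im := by simpa using hη
  have h2 : 2 * η / 2 = η := mul_div_cancel_left₀ η (two_ne_zero' ℂ)
  have key := iterA_eq_zero hτ0 h2η hϑ (s := 0) (Or.inl rfl) (n := m) (j := l) (z := z)
    (G := fun z => (thetaDen τ z)⁻¹ * ψ z) (fun z => ?_) hl (fun b hb => ?_) (fun a ha h => ?_)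
  · rw [opM, iterA, iterB_eq]
    refine (congrArg (fun f => iterA (τ / 2) (2 * η) ϑ 0 m f _) (funext fun z => ?_)).trans key
    simp only [phiTau, add_zero, h2]
    rw [div_eq_mul_inv]; ring
  · have h := thetaDen_add_period hτ z
    rw [h, show z + τ / 2 = z - τ / 2 + τ by ring, hψ, mul_inv, inv_inv, mul_assoc]
  · simpa using hz2 0 b (by simp) hb
  · refine hz3 0 a (by simp) ha ?_
    rw [h2] at h
    rw [Int.cast_zero, zero_mul, add_zero, h, zero_pow (by omega), zero_mul]

/-! ### The elliptic gamma function -/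

/-- `p^a q^b` with `p = exp (2πiτ)`, `q = exp (4πiη)`. -/
def nomePow (η τ : ℂ) (k : ℕ × ℕ) : ℂ := nome τ ^ k.1 * nome (2 * η) ^ k.2

/-- `∏ (1 - t p^a q^b)`. -/
def doublePoch (η τ t : ℂ) : ℂ := zeroProd (nomePow η τ) t

section

variable {η τ : ℂ} (hη : 0 < η.im) (hτ : 0 < τ.im)

lemma two_mul_im_pos {η : ℂ} (hη : 0 < η.im) : 0 < (2 * η).im := by simpa using hη

include hη hτ

lemma summable_nomePow : Summable fun k => ‖nomePow η τ k‖ :=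
  Summable.mul_norm (summable_norm_pow (norm_nome_lt_one hτ))
    (summable_norm_pow (norm_nome_lt_one (two_mul_im_pos hη)))

lemma differentiable_doublePoch : Differentiable ℂ (doublePoch η τ) :=
  differentiable_zeroProd (summable_nomePow hη hτ)

lemma norm_nomePow_le_one (k : ℕ × ℕ) : ‖nomePow η τ k‖ ≤ 1 := by
  rw [nomePow, norm_mul, norm_pow, norm_pow]
  exact mul_le_one₀ (pow_le_one₀ (norm_nonneg _) (norm_nome_lt_one hτ).le) (by positivity)
    (pow_le_one₀ (norm_nonneg _) (norm_nome_lt_one (two_mul_im_pos hη)).le)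

lemma doublePoch_ne_zero {t : ℂ} (ht : ‖t‖ < 1) : doublePoch η τ t ≠ 0 := by
  rw [doublePoch, Ne, zeroProd_eq_zero_iff (summable_nomePow hη hτ)]
  rintro ⟨k, hk⟩
  have := congrArg norm hk
  rw [norm_mul, norm_one] at this
  nlinarith [norm_nomePow_le_one hη hτ k, norm_nonneg t, norm_nonneg (nomePow η τ k)]

lemma eGamma_eq (u : ℂ) : eGamma η τ u =
    doublePoch η τ (nome τ * nome (2 * η) * (nome u)⁻¹) / doublePoch η τ (nome u) := by
  have hs := summable_nomePow hη hτ
  have e : ∀ k : ℕ × ℕ,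
      (1 - exp (-(2 * Real.pi * I * u)) * nome τ ^ (k.1 + 1) * nome (2 * η) ^ (k.2 + 1)) /
        (1 - exp (2 * Real.pi * I * u) * nome τ ^ k.1 * nome (2 * η) ^ k.2) =
      (1 - nome τ * nome (2 * η) * (nome u)⁻¹ * nomePow η τ k) *
        (1 - nome u * nomePow η τ k)⁻¹ := fun k => by
    rw [exp_neg, div_eq_mul_inv, nomePow]
    change (1 - (nome u)⁻¹ * _ * _) * (1 - nome u * _ * _)⁻¹ = _
    ring_nf
  rw [eGamma, tprod_congr e]
  -- At a pole both sides are 0 by the convention x / 0 = 0: one factor of the infinite product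
  -- vanishes.
  by_cases h : doublePoch η τ (nome u) = 0
  · obtain ⟨k, hk⟩ := (zeroProd_eq_zero_iff hs _).mp h
    rw [h, div_zero]
    exact (hasProd_zero_of_exists_eq_zero ⟨k, by rw [hk, sub_self, inv_zero, mul_zero]⟩).tprod_eq
  · have h1 := (multipliable_zeroProd hs (nome τ * nome (2 * η) * (nome u)⁻¹)).hasProd
    have h2 := (multipliable_zeroProd hs (nome u)).hasProd
    have h3 := h2.inv₀ h
    exact ((h1.mul h3).tprod_eq).trans (div_eq_mul_inv _ _).symm

lemma eGamma_inv (u : ℂ) : (eGamma η τ u)⁻¹ =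
    doublePoch η τ (nome u) / doublePoch η τ (nome τ * nome (2 * η) * (nome u)⁻¹) := by
  rw [eGamma_eq hη hτ, inv_div]

end

lemma eGamma_swap (η τ u : ℂ) : eGamma (τ / 2) (2 * η) u = eGamma η τ u := by
  rw [eGamma, eGamma, ← (Equiv.prodComm ℕ ℕ).tprod_eq]
  refine tprod_congr fun k => ?_
  simp only [Equiv.prodComm_apply, Prod.fst_swap, Prod.snd_swap, mul_div_cancel₀ τ (two_ne_zero' ℂ)]
  ring_nf

lemma eGamma_add_one (η τ u : ℂ) : eGamma η τ (u + 1) = eGamma η τ u := by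
  rw [eGamma, eGamma]
  refine tprod_congr fun k => ?_
  rw [exp_neg, exp_neg]
  change (1 - (nome (u + 1))⁻¹ * _ * _) / (1 - nome (u + 1) * _ * _) = _
  rw [nome_add, nome_one, mul_one]; rfl

/-- Splitting `ℕ × ℕ` into a column and the rest. -/
lemma doublePoch_eq_mul {η τ : ℂ} (hη : 0 < η.im) (hτ : 0 < τ.im) (t : ℂ) :
    doublePoch η τ t = qPoch t (nome τ) * doublePoch η τ (t * nome (2 * η)) := by
  have hs := summable_nomePow hη hτ
  have hp := summable_norm_pow (norm_nome_lt_one hτ)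
  have i1 : Function.Injective fun a : ℕ => ((a, 0) : ℕ × ℕ) := fun a b h => by simpa using h
  have i2 : Function.Injective fun k : ℕ × ℕ => ((k.1, k.2 + 1) : ℕ × ℕ) := fun a b h => by
    ext <;> simp_all
  have h1 : HasProd (fun k : ℕ × ℕ => if k.2 = 0 then 1 - t * nomePow η τ k else 1)
      (qPoch t (nome τ)) := by
    refine (i1.hasProd_iff fun k hk => if_neg fun h => hk ⟨k.1, Prod.ext rfl h.symm⟩).mp ?_
    convert (multipliable_zeroProd hp t).hasProd using 1
    · funext a; simp [nomePow]
    · rfl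
  have h2 : HasProd (fun k : ℕ × ℕ => if k.2 = 0 then 1 else 1 - t * nomePow η τ k)
      (doublePoch η τ (t * nome (2 * η))) := by
    refine (i2.hasProd_iff fun k hk => if_pos ?_).mp ?_
    · by_contra h
      exact hk ⟨(k.1, k.2 - 1), Prod.ext rfl (by simp; omega)⟩
    · convert (multipliable_zeroProd hs (t * nome (2 * η))).hasProd using 1
      · funext a; simp [nomePow, pow_succ]; ring
      · rfl
  have h3 := (h1.mul h2).tprod_eq
  rw [← h3, doublePoch, zeroProd]
  refine tprod_congr fun k => ?_
  split_ifs <;> simp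

/-- The shift by 2η removes one column from the lower double product and adds one to the upper;
these two columns form θ(e^{2πiu}; p). The condition on u excludes poles. -/
lemma eGamma_add_two_eta {η τ : ℂ} (hη : 0 < η.im) (hτ : 0 < τ.im) {u : ℂ} (hu : 0 < u.im) :
    eGamma η τ (u + 2 * η) = mTheta (nome u) (nome τ) * eGamma η τ u := by
  have h0 := nome_ne_zero u
  have h1 := nome_ne_zero (2 * η)
  have h2 : qPoch (nome u) (nome τ) ≠ 0 := by
    have := doublePoch_ne_zero hη hτ (norm_nome_lt_one hu)
    rw [doublePoch_eq_mul hη hτ] at this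
    exact left_ne_zero_of_mul this
  rw [eGamma_eq hη hτ, eGamma_eq hη hτ, doublePoch_eq_mul hη hτ (nome u), nome_add, mTheta,
    show nome τ * nome (2 * η) * (nome u * nome (2 * η))⁻¹ = nome τ * (nome u)⁻¹ by field_simp,
    doublePoch_eq_mul hη hτ (nome τ * (nome u)⁻¹),
    show nome τ * (nome u)⁻¹ * nome (2 * η) = nome τ * nome (2 * η) * (nome u)⁻¹ by ring]
  rw [mul_div_assoc, mul_comm (qPoch (nome u) _) (doublePoch _ _ _), ← div_div]
  field_simp

lemma differentiable_nome : Differentiable ℂ nome := by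
  unfold nome; fun_prop

section

variable {η τ : ℂ} (hη : 0 < η.im) (hτ : 0 < τ.im)
include hη hτ

lemma differentiableAt_eGamma {u : ℂ} (hu : 0 < u.im) : DifferentiableAt ℂ (eGamma η τ) u := by
  rw [funext (eGamma_eq hη hτ)]
  have hd := differentiable_doublePoch hη hτ
  have hn := differentiable_nome
  refine DifferentiableAt.div ?_ ?_ (doublePoch_ne_zero hη hτ (norm_nome_lt_one hu))
  · have : DifferentiableAt ℂ (fun u => nome τ * nome (2 * η) * (nome u)⁻¹) u :=
      ((hn u).inv (nome_ne_zero u)).const_mul _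
    exact (hd _).comp u this
  · exact (hd _).comp u (hn u)

lemma differentiableAt_eGamma_inv {u : ℂ} (hu : u.im < τ.im + (2 * η).im) :
    DifferentiableAt ℂ (fun u => (eGamma η τ u)⁻¹) u := by
  rw [funext (eGamma_inv hη hτ)]
  have hd := differentiable_doublePoch hη hτ
  have hn := differentiable_nome
  refine DifferentiableAt.div ?_ ?_ (doublePoch_ne_zero hη hτ ?_)
  · exact (hd _).comp u (hn u)
  · have : DifferentiableAt ℂ (fun u => nome τ * nome (2 * η) * (nome u)⁻¹) u :=
      ((hn u).inv (nome_ne_zero u)).const_mul _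
    exact (hd _).comp u this
  · rw [← nome_neg, ← nome_add, ← nome_add]
    refine norm_nome_lt_one ?_
    rw [add_im, add_im, neg_im]; linarith

end

/-! ### The kernel of the integral operator -/

/-- The kernel of the integral operator. -/
def kernelM (η τ g z x : ℂ) : ℂ :=
  eGamma η τ (z + x - g) * eGamma η τ (z - x - g) *
          eGamma η τ (-z + x - g) * eGamma η τ (-z - x - g) /
        (eGamma η τ (-(2 * g)) * eGamma η τ (2 * x) * eGamma η τ (-(2 * x)))

lemma intM_eq (η τ g : ℂ) (Φ : ℂ → ℂ) (z : ℂ) : intM η τ g Φ z =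
    qPoch (nome (2 * η)) (nome (2 * η)) * qPoch (nome τ) (nome τ) / 2 *
    ∫ x in (0 : ℝ)..1, kernelM η τ g z x * Φ x := rfl

lemma kernelM_swap (η τ g z x : ℂ) : kernelM (τ / 2) (2 * η) g z x = kernelM η τ g z x := by
  simp only [kernelM, eGamma_swap]

lemma intM_swap (η τ g : ℂ) (Φ : ℂ → ℂ) (z : ℂ) : intM (τ / 2) (2 * η) g Φ z = intM η τ g Φ z := by
  simp only [intM_eq, kernelM_swap, mul_div_cancel₀ τ (two_ne_zero' ℂ)]
  ring

lemma kernelM_neg (η τ g z x : ℂ) : kernelM η τ g z (-x) = kernelM η τ g z x := by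
  simp only [kernelM, mul_neg, neg_neg, sub_neg_eq_add, ← sub_eq_add_neg]
  ring

lemma eGamma_sub_one (η τ u : ℂ) : eGamma η τ (u - 1) = eGamma η τ u := by
  rw [← eGamma_add_one, sub_add_cancel]

lemma kernelM_add_one (η τ g z x : ℂ) : kernelM η τ g z (x + 1) = kernelM η τ g z x := by
  rw [kernelM, kernelM]
  rw [show z + (x + 1) - g = z + x - g + 1 by ring, show z - (x + 1) - g = z - x - g - 1 by ring,
    show -z + (x + 1) - g = -z + x - g + 1 by ring, show -z - (x + 1) - g = -z - x - g - 1 by ring,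
    show 2 * (x + 1) = 2 * x + 1 + 1 by ring, show -(2 * x + 1 + 1) = -(2 * x) - 1 - 1 by ring]
  simp only [eGamma_add_one, eGamma_sub_one]

lemma kernelM_add_half (η τ g z x : ℂ) :
    kernelM η τ (g + 1 / 2) z (x + 1 / 2) = kernelM η τ g z x := by
  rw [kernelM, kernelM]
  rw [show z + (x + 1 / 2) - (g + 1 / 2) = z + x - g by ring,
    show z - (x + 1 / 2) - (g + 1 / 2) = z - x - g - 1 by ring,
    show -z + (x + 1 / 2) - (g + 1 / 2) = -z + x - g by ring,
    show -z - (x + 1 / 2) - (g + 1 / 2) = -z - x - g - 1 by ring,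
    show 2 * (x + 1 / 2) = 2 * x + 1 by ring, show -(2 * x + 1) = -(2 * x) - 1 by ring,
    show -(2 * (g + 1 / 2)) = -(2 * g) - 1 by ring]
  simp only [eGamma_add_one, eGamma_sub_one]

/-- Adding 1/2 to both g and x leaves the kernel unchanged, and a 1-periodic integrand may be
shifted. This reduces s = 1/2 to s = 0 with a translated test function. -/
lemma intM_add_half (η τ g : ℂ) {Φ : ℂ → ℂ} (hΦ : Function.Periodic Φ 1) (z : ℂ) :
    intM η τ (g + 1 / 2) Φ z = intM η τ g (fun x => Φ (x + 1 / 2)) z := by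
  rw [intM_eq, intM_eq]
  congr 1
  have hp : Function.Periodic (fun x : ℝ => kernelM η τ (g + 1 / 2) z x * Φ x) 1 := fun x => by
    dsimp only
    push_cast
    rw [kernelM_add_one, hΦ]
  have h := hp.intervalIntegral_add_eq 0 (1 / 2)
  rw [zero_add] at h
  rw [h]
  have h2 := intervalIntegral.integral_comp_add_right (a := 0) (b := 1)
    (fun x : ℝ => kernelM η τ (g + 1 / 2) z x * Φ x) (1 / 2)
  rw [zero_add, add_comm (1 : ℝ)] at h2
  rw [← h2]
  refine intervalIntegral.integral_congr fun x _ => ?_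
  push_cast
  rw [kernelM_add_half]

lemma intM_comp_neg (η τ g : ℂ) {Φ : ℂ → ℂ} (hΦ : Function.Periodic Φ 1) (z : ℂ) :
    intM η τ g (fun x => Φ (-x)) z = intM η τ g Φ z := by
  rw [intM_eq, intM_eq]
  congr 1
  have hp : Function.Periodic (fun x : ℝ => kernelM η τ g z x * Φ x) 1 := fun x => by
    dsimp only
    push_cast
    rw [kernelM_add_one, hΦ]
  have h := hp.intervalIntegral_add_eq 0 (-1)
  rw [zero_add, neg_add_cancel] at h
  have h2 := intervalIntegral.integral_comp_neg (a := 0) (b := 1)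
    (fun x : ℝ => kernelM η τ g z x * Φ x)
  rw [neg_zero, ← h] at h2
  rw [← h2]
  refine intervalIntegral.integral_congr fun x _ => ?_
  push_cast
  rw [kernelM_neg]

lemma abs_im_lt_iff {g z : ℂ} : |z.im| < -g.im ↔ 0 < (-g + z).im ∧ 0 < (-g - z).im := by
  rw [abs_lt, add_im, sub_im, neg_im]
  constructor <;> rintro ⟨h1, h2⟩ <;> constructor <;> linarith

lemma continuous_kernelM {η τ : ℂ} (hη : 0 < η.im) (hτ : 0 < τ.im) {g z : ℂ} (h : |z.im| < -g.im) :
    Continuous fun x : ℝ => kernelM η τ g z x := by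
  obtain ⟨h1, h2⟩ := abs_lt.mp h
  rw [continuous_iff_continuousAt]
  intro x
  have hG : ∀ u : ℝ → ℂ, Continuous u → 0 < (u x).im → ContinuousAt (fun x => eGamma η τ (u x)) x :=
    fun u hu hx => (differentiableAt_eGamma hη hτ hx).continuousAt.comp hu.continuousAt
  have hI : ∀ u : ℝ → ℂ, Continuous u → (u x).im = 0 →
      ContinuousAt (fun x => (eGamma η τ (u x))⁻¹) x := fun u hu hx =>
    ContinuousAt.comp (f := u) (g := fun u => (eGamma η τ u)⁻¹)
      (differentiableAt_eGamma_inv hη hτ (by rw [hx]; have := two_mul_im_pos hη; positivity)).continuousAt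
      hu.continuousAt
  simp only [kernelM, div_eq_mul_inv, mul_inv]
  refine ContinuousAt.mul (((ContinuousAt.mul ?_ ?_).mul ?_).mul ?_)
    ((continuousAt_const.mul ?_).mul ?_)
  · exact hG _ (by fun_prop) (by simp; linarith)
  · exact hG _ (by fun_prop) (by simp; linarith)
  · exact hG _ (by fun_prop) (by simp; linarith)
  · exact hG _ (by fun_prop) (by simp; linarith)
  · exact hI _ (by fun_prop) (by simp)
  · exact hI _ (by fun_prop) (by simp)

lemma mTheta_nome_eq {τ : ℂ} (hτ : 0 < τ.im) (u : ℂ) :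
    mTheta (nome u) (nome τ) = Rconst τ * theta1 u τ * nome (u / 2) := by
  have h : exp (-(Real.pi * I * u)) * nome (u / 2) = 1 := by
    rw [nome, ← exp_add, show -(Real.pi * I * u) + 2 * Real.pi * I * (u / 2) = 0 by ring, exp_zero]
  rw [Rconst_mul_theta1 hτ, mul_right_comm, h, one_mul]

/-- The contiguity relation of the kernel. -/
lemma kernelM_contiguity {η τ : ℂ} (hη : 0 < η.im) (hτ : 0 < τ.im) {ϑ : ℂ → ℂ → ℂ}
    (hϑ : ϑ = theta3 ∨ ϑ = theta4) {g z : ℂ} (h : |z.im| < -(g + η).im)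
    (hz : theta1 (2 * z) τ ≠ 0) (hg : theta1 (2 * (g + η)) τ ≠ 0) (x : ℝ)
    (hx : ϑ x (τ / 2) ≠ 0) :
    kernelM η τ (g + η) z x = (Rconst τ * theta1 (2 * z) τ)⁻¹ *
      (ϑ (z + g + η) (τ / 2) * ((nome z)⁻¹ * kernelM η τ g (z + η) x) -
        ϑ (z - g - η) (τ / 2) * (nome z * kernelM η τ g (z - η) x)) / ϑ x (τ / 2) := by
  obtain ⟨h1, h2⟩ := abs_lt.mp h
  set G := g + η with hG
  have hgG : g = G - η := by rw [hG]; ring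
  have hR := Rconst_ne_zero hτ
  have s1 : ∀ u : ℂ, 0 < u.im → eGamma η τ (u + 2 * η) =
      Rconst τ * theta1 u τ * nome (u / 2) * eGamma η τ u := fun u hu => by
    rw [eGamma_add_two_eta hη hτ hu, mTheta_nome_eq hτ]
  have three := vartheta_three_term hϑ hτ z G x
  rw [kernelM, kernelM, kernelM, hgG]
  -- Passing to (g, z ± η) = (G - η, z ± η) raises two of the four gamma functions by 2η and fixes
  -- the other two. The shift equation then produces the θ₁ products of the three-term relation.
  rw [show z + η + x - (G - η) = z + x - G + 2 * η by ring,
    show z + η - x - (G - η) = z - x - G + 2 * η by ring,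
    show -(z + η) + x - (G - η) = -z + x - G by ring,
    show -(z + η) - x - (G - η) = -z - x - G by ring,
    show -(2 * (G - η)) = -(2 * G) + 2 * η by ring,
    show z - η + x - (G - η) = z + x - G by ring,
    show z - η - x - (G - η) = z - x - G by ring,
    show -(z - η) + x - (G - η) = -z + x - G + 2 * η by ring,
    show -(z - η) - x - (G - η) = -z - x - G + 2 * η by ring,
    show z + (G - η) + η = z + G by ring, show z - (G - η) - η = z - G by ring]
  rw [s1 (z + x - G) (by simp; linarith), s1 (z - x - G) (by simp; linarith),
    s1 (-z + x - G) (by simp; linarith), s1 (-z - x - G) (by simp; linarith),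
    s1 (-(2 * G)) (by simp; have := (abs_nonneg z.im).trans_lt h; linarith)]
  rw [show z + x - G = z - G + x by ring, show z - x - G = z - G - x by ring] at *
  have e1 : theta1 (-z + x - G) τ = -theta1 (z + G - x) τ := by
    rw [← theta1_neg]; congr 1; ring
  have e2 : theta1 (-z - x - G) τ = -theta1 (z + G + x) τ := by
    rw [← theta1_neg]; congr 1; ring
  rw [e1, e2, theta1_neg (2 * G)]
  have n1 : nome ((z - G + x) / 2) * nome ((z - G - x) / 2) = nome z * (nome G)⁻¹ := by
    rw [← nome_add, ← nome_neg, ← nome_add]; congr 1; ring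
  have n2 : nome ((-z + x - G) / 2) * nome ((-z - x - G) / 2) = (nome z)⁻¹ * (nome G)⁻¹ := by
    rw [← nome_add, ← nome_neg, ← nome_neg, ← nome_add]; congr 1; ring
  have n3 : nome (-(2 * G) / 2) = (nome G)⁻¹ := by
    rw [← nome_neg]; congr 1; ring
  rw [n3]
  have hz0 := nome_ne_zero z
  have hG0 := nome_ne_zero G
  set N := eGamma η τ (z - G + x) * eGamma η τ (z - G - x) * eGamma η τ (-z + x - G) *
    eGamma η τ (-z - x - G) with hN
  set D := eGamma η τ (-(2 * G)) * eGamma η τ (2 * x) * eGamma η τ (-(2 * x)) with hD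
  have k1 : Rconst τ * theta1 (z - G + x) τ * nome ((z - G + x) / 2) * eGamma η τ (z - G + x) *
      (Rconst τ * theta1 (z - G - x) τ * nome ((z - G - x) / 2) * eGamma η τ (z - G - x)) *
      eGamma η τ (-z + x - G) * eGamma η τ (-z - x - G) =
      Rconst τ ^ 2 * (theta1 (z - G + x) τ * theta1 (z - G - x) τ) * (nome z * (nome G)⁻¹) * N := by
    rw [← n1]; ring
  have k2 : eGamma η τ (z - G + x) * eGamma η τ (z - G - x) *
      (Rconst τ * -theta1 (z + G - x) τ * nome ((-z + x - G) / 2) * eGamma η τ (-z + x - G)) *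
      (Rconst τ * -theta1 (z + G + x) τ * nome ((-z - x - G) / 2) * eGamma η τ (-z - x - G)) =
      Rconst τ ^ 2 * (theta1 (z + G + x) τ * theta1 (z + G - x) τ) * ((nome z)⁻¹ * (nome G)⁻¹) *
        N := by
    rw [← n2]; ring
  have k3 : Rconst τ * -theta1 (2 * G) τ * (nome G)⁻¹ * eGamma η τ (-(2 * G)) * eGamma η τ (2 * x) *
      eGamma η τ (-(2 * x)) = -(Rconst τ * theta1 (2 * G) τ * (nome G)⁻¹) * D := by ring
  rw [k1, k2, k3, div_eq_mul_inv N D, div_eq_mul_inv _ (-_ * D), div_eq_mul_inv _ (-_ * D), mul_inv _ D]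
  generalize D⁻¹ = D'
  clear_value N
  rw [eq_div_iff hx]
  have final : N * D' * ϑ x (τ / 2) = (Rconst τ * theta1 (2 * z) τ)⁻¹ *
      (-(Rconst τ * theta1 (2 * G) τ * (nome G)⁻¹))⁻¹ * Rconst τ ^ 2 * (nome G)⁻¹ * N * D' *
      -(ϑ x (τ / 2) * (theta1 (2 * z) τ * theta1 (2 * G) τ)) := by
    field_simp
  rw [final, ← three]
  field_simp
  ring

/-- Integrates the kernel relation; its factor 1/ϑ(x) is absorbed into the test function. -/
lemma intM_contiguity {η τ : ℂ} (hη : 0 < η.im) (hτ : 0 < τ.im) {ϑ : ℂ → ℂ → ℂ}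
    (hϑ : ϑ = theta3 ∨ ϑ = theta4) {g z : ℂ} (h : |z.im| < -(g + η).im)
    (hz : theta1 (2 * z) τ ≠ 0) (hg : theta1 (2 * (g + η)) τ ≠ 0)
    (hx : ∀ x : ℝ, ϑ x (τ / 2) ≠ 0) {Φ : ℂ → ℂ} (hΦ : Continuous fun x : ℝ => Φ x) :
    intM η τ (g + η) Φ z = opA η τ ϑ g (intM η τ g (fun x => (ϑ x (τ / 2))⁻¹ * Φ x)) z := by
  have hη0 : η ≠ 0 := by rintro rfl; simp at hη
  have hc : Continuous fun x : ℝ => (ϑ x (τ / 2))⁻¹ * Φ x :=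
    (((differentiable_vartheta hϑ (half_im_pos hτ)).continuous.comp continuous_ofReal).inv₀ hx).mul hΦ
  have hp : |(z + η).im| < -g.im := by
    rw [abs_lt] at *; simp only [add_im] at *; constructor <;> linarith
  have hm : |(z - η).im| < -g.im := by
    rw [abs_lt] at *; simp only [add_im, sub_im] at *; constructor <;> linarith
  have i1 : IntervalIntegrable (fun x : ℝ => kernelM η τ g (z + η) x * ((ϑ x (τ / 2))⁻¹ * Φ x))
      MeasureTheory.volume 0 1 := ((continuous_kernelM hη hτ hp).mul hc).intervalIntegrable 0 1
  have i2 : IntervalIntegrable (fun x : ℝ => kernelM η τ g (z - η) x * ((ϑ x (τ / 2))⁻¹ * Φ x))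
      MeasureTheory.volume 0 1 := ((continuous_kernelM hη hτ hm).mul hc).intervalIntegrable 0 1
  rw [opA_apply hη0, intM_eq, intM_eq, intM_eq]
  have e : ∀ x : ℝ, kernelM η τ (g + η) z x * Φ x =
      ((Rconst τ * theta1 (2 * z) τ)⁻¹ * ϑ (z + g + η) (τ / 2) * (nome z)⁻¹) *
        (kernelM η τ g (z + η) x * ((ϑ x (τ / 2))⁻¹ * Φ x)) -
      ((Rconst τ * theta1 (2 * z) τ)⁻¹ * ϑ (z - g - η) (τ / 2) * nome z) *
        (kernelM η τ g (z - η) x * ((ϑ x (τ / 2))⁻¹ * Φ x)) := fun x => by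
    rw [kernelM_contiguity hη hτ hϑ h hz hg x (hx x), div_eq_mul_inv]; ring
  simp only [e]
  rw [intervalIntegral.integral_sub (i1.const_mul _) (i2.const_mul _),
    intervalIntegral.integral_const_mul, intervalIntegral.integral_const_mul]
  ring

/-! ### Integrals of periodic functions over horizontal segments -/

/-- The integral over the segment from `δ i` to `1 + δ i`. -/
def lineInt (δ : ℝ) (h : ℂ → ℂ) : ℂ := ∫ x in (0 : ℝ)..1, h (x + δ * I)

lemma lineInt_eq_shift (δ r : ℝ) {h : ℂ → ℂ} (hp : Function.Periodic h 1) :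
    lineInt δ h = ∫ x in r..(r + 1), h (x + δ * I) := by
  have hp' : Function.Periodic (fun x : ℝ => h (x + δ * I)) 1 := fun x => by
    dsimp only
    rw [ofReal_add, ofReal_one, add_right_comm, hp]
  have := hp'.intervalIntegral_add_eq 0 r
  rwa [zero_add] at this

lemma lineInt_neg (δ : ℝ) {h : ℂ → ℂ} (hp : Function.Periodic h 1) :
    lineInt δ (fun x => h (-x)) = lineInt (-δ) h := by
  rw [lineInt_eq_shift (-δ) (-1) hp, lineInt, neg_add_cancel]
  have := intervalIntegral.integral_comp_neg (a := 0) (b := 1) (fun x : ℝ => h (x + (-δ : ℝ) * I))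
  rw [neg_zero] at this
  rw [← this]
  refine intervalIntegral.integral_congr fun x _ => ?_
  push_cast
  ring_nf

lemma lineInt_congr {δ : ℝ} {f h : ℂ → ℂ} (e : ∀ x : ℂ, x.im = δ → f x = h x) :
    lineInt δ f = lineInt δ h :=
  intervalIntegral.integral_congr fun x _ => e _ (by simp)

lemma intervalIntegrable_line {δ : ℝ} {h : ℂ → ℂ} (hh : ∀ x : ℂ, x.im = δ → ContinuousAt h x) :
    IntervalIntegrable (fun x : ℝ => h (x + δ * I)) MeasureTheory.volume 0 1 := by
  refine Continuous.intervalIntegrable (continuous_iff_continuousAt.mpr fun x => ?_) _ _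
  exact (hh (x + δ * I) (by simp)).comp (f := fun x : ℝ => (x : ℂ) + δ * I) (by fun_prop)

lemma lineInt_sub {δ : ℝ} {f h : ℂ → ℂ} (hf : ∀ x : ℂ, x.im = δ → ContinuousAt f x)
    (hh : ∀ x : ℂ, x.im = δ → ContinuousAt h x) :
    lineInt δ (fun x => f x - h x) = lineInt δ f - lineInt δ h :=
  intervalIntegral.integral_sub (intervalIntegrable_line hf) (intervalIntegrable_line hh)

lemma lineInt_const_mul (δ : ℝ) (c : ℂ) (h : ℂ → ℂ) :
    lineInt δ (fun x => c * h x) = c * lineInt δ h :=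
  intervalIntegral.integral_const_mul _ _

/-- Cauchy's theorem for periodic functions, on a rectangle of width one. -/
lemma integral_eq_of_rect {k : ℂ → ℂ} {r a b : ℝ}
    (hd : DifferentiableOn ℂ k (Set.uIcc r (r + 1) ×ℂ Set.uIcc a b))
    (hp : ∀ y : ℝ, k ((r + 1 : ℝ) + y * I) = k (r + y * I)) :
    ∫ x in r..(r + 1), k (x + a * I) = ∫ x in r..(r + 1), k (x + b * I) := by
  have h := Complex.integral_boundary_rect_eq_zero_of_differentiableOn k (r + a * I)
    ((r + 1 : ℝ) + b * I) (by simpa using hd)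
  simp only [add_re, ofReal_re, mul_re, I_re, mul_zero, ofReal_im, I_im, mul_one, sub_self, add_zero,
    add_im, mul_im, zero_add, hp] at h
  linear_combination h

lemma lineInt_eq_of_differentiable {k : ℂ → ℂ} {a b : ℝ} (hp : Function.Periodic k 1)
    (hd : ∀ x : ℂ, x.im ∈ Set.uIcc a b → DifferentiableAt ℂ k x) : lineInt a k = lineInt b k := by
  rw [lineInt_eq_shift a 0 hp, lineInt_eq_shift b 0 hp]
  refine integral_eq_of_rect (fun x hx => (hd x hx.2).differentiableWithinAt) fun y => ?_
  rw [ofReal_add, ofReal_one, add_right_comm, hp]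

lemma hasDerivAt_nome (u : ℂ) : HasDerivAt nome (2 * Real.pi * I * nome u) u := by
  have h : HasDerivAt (fun u : ℂ => 2 * Real.pi * I * u) (2 * Real.pi * I) u := by
    simpa using (hasDerivAt_id u).const_mul (2 * Real.pi * I)
  exact h.cexp.congr_deriv (mul_comm _ _)

lemma one_sub_nome_ne_zero {u : ℂ} (h : u.im ≠ 0) : 1 - nome u ≠ 0 := fun h0 => by
  obtain ⟨k, rfl⟩ := (nome_eq_one_iff u).mp (sub_eq_zero.mp h0).symm
  simp at h

/-- Above y one has |e^{2πi(x-y)}| < 1, so x - log(1 - e^{2πi(x-y)})/(2πi) is an antiderivative with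
the principal logarithm. Its logarithmic part is 1-periodic and drops out. -/
lemma lineInt_inv_above {δ : ℝ} {y : ℂ} (h : y.im < δ) :
    lineInt δ (fun x => (1 - nome (x - y))⁻¹) = 1 := by
  have hn : ∀ x : ℝ, ‖nome (x + δ * I - y)‖ < 1 := fun x => norm_nome_lt_one (by simpa using h)
  have hD : ∀ x : ℝ, HasDerivAt (fun x : ℝ => (x : ℂ) - log (1 - nome (x + δ * I - y)) /
      (2 * Real.pi * I)) ((1 - nome (x + δ * I - y))⁻¹) x := fun x => by
    have h1 : HasDerivAt (fun x : ℝ => 1 - nome (x + δ * I - y))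
        (-(2 * Real.pi * I * nome (x + δ * I - y))) x := by
      have h0 : HasDerivAt (fun x : ℝ => (x : ℂ) + δ * I - y) 1 x :=
        ((hasDerivAt_id x).ofReal_comp.add_const _).sub_const _
      simpa using ((hasDerivAt_nome _).comp x h0).const_sub 1
    have hs : 1 - nome (x + δ * I - y) ∈ slitPlane := by
      rw [sub_eq_add_neg]; exact mem_slitPlane_of_norm_lt_one (by simpa using hn x)
    have h2 := ((hasDerivAt_id x).ofReal_comp).sub ((h1.clog_real hs).div_const (2 * Real.pi * I))
    refine h2.congr_deriv ?_
    have e1 := slitPlane_ne_zero hs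
    rw [neg_div, neg_div, mul_div_assoc, mul_div_cancel_left₀ _ two_pi_I_ne_zero, ofReal_one,
      sub_neg_eq_add]
    field_simp
    ring
  have hc : ∀ x : ℂ, x.im = δ → ContinuousAt (fun x => (1 - nome (x - y))⁻¹) x := fun x hx => by
    have : Continuous fun x => 1 - nome (x - y) := by
      have := differentiable_nome.continuous; fun_prop
    exact this.continuousAt.inv₀ (one_sub_nome_ne_zero (by rw [sub_im, hx]; exact (sub_pos.mpr h).ne'))
  rw [lineInt, intervalIntegral.integral_eq_sub_of_hasDerivAt (fun x _ => hD x)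
    (intervalIntegrable_line hc)]
  have : nome (((1 : ℝ) : ℂ) + δ * I - y) = nome (((0 : ℝ) : ℂ) + δ * I - y) := by
    rw [show ((1 : ℝ) : ℂ) + δ * I - y = ((0 : ℝ) : ℂ) + δ * I - y + 1 by push_cast; ring, nome_add,
      nome_one, mul_one]
  rw [this]; simp

/-- The reflection x ↦ -x and 1/(1 - w⁻¹) = 1 - 1/(1 - w) reduce this to the case above the pole. -/
lemma lineInt_inv_below {δ : ℝ} {y : ℂ} (h : δ < y.im) :
    lineInt δ (fun x => (1 - nome (x - y))⁻¹) = 0 := by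
  have h1 := lineInt_inv_above (δ := -δ) (y := -y) (by simpa using h)
  have hp : Function.Periodic (fun x => (1 - nome (x - y))⁻¹) 1 := fun x => by
    dsimp only
    rw [add_sub_right_comm, nome_add, nome_one, mul_one]
  have h2 := lineInt_neg (-δ) hp
  rw [neg_neg] at h2
  rw [← h2]
  have hc : ∀ x : ℂ, x.im = -δ → ContinuousAt (fun x => (1 - nome (x - -y))⁻¹) x := fun x hx => by
    have : Continuous fun x => 1 - nome (x - -y) := by
      have := differentiable_nome.continuous; fun_prop
    exact this.continuousAt.inv₀ (one_sub_nome_ne_zero (by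
      rw [sub_im, hx, neg_im]; intro h0; linarith))
  have h3 := lineInt_sub (f := fun _ => 1) (δ := -δ) (fun x _ => continuousAt_const) hc
  rw [h1] at h3
  have h4 : lineInt (-δ) (fun _ => 1) = 1 := by simp [lineInt]
  rw [h4, sub_self] at h3
  rw [← h3]
  refine lineInt_congr fun x hx => ?_
  have a1 : 1 - nome (x - -y) ≠ 0 := one_sub_nome_ne_zero (by
    rw [sub_im, hx, neg_im]; intro h0; linarith)
  have e : nome (-x - y) = (nome (x - -y))⁻¹ := by rw [← nome_neg]; congr 1; ring
  have a2 := nome_ne_zero (x - -y)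
  have a3 : nome (x - -y) - 1 ≠ 0 := fun h => a1 (by linear_combination -h)
  rw [e]
  field_simp
  ring

/-- The residue theorem for a periodic function with one simple pole per period. -/
lemma lineInt_residue {δ : ℝ} {h : ℂ → ℂ} (hp : Function.Periodic h 1)
    (hd : ∀ x : ℂ, |x.im| ≤ δ → DifferentiableAt ℂ h x) {y : ℂ} (hy : |y.im| < δ) :
    lineInt δ (fun x => h x * (1 - nome (x - y))⁻¹) =
      h y + lineInt (-δ) (fun x => h x * (1 - nome (x - y))⁻¹) := by
  obtain ⟨hy1, hy2⟩ := abs_lt.mp hy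
  have hδ : 0 < δ := (abs_nonneg _).trans_lt hy
  set E : ℂ → ℂ := fun x => 1 - nome (x - y) with hE
  have hEd : Differentiable ℂ E := by
    have := differentiable_nome; simp only [hE]; fun_prop
  have hEy : E y = 0 := by simp [hE, nome_zero]
  have hEp : Function.Periodic E 1 := fun x => by
    simp only [hE]; rw [add_sub_right_comm, nome_add, nome_one, mul_one]
  have hE' : deriv E y = -(2 * Real.pi * I) := by
    have h0 : HasDerivAt (fun x => x - y) 1 y := (hasDerivAt_id y).sub_const y
    have h1 := (HasDerivAt.comp (h₂ := nome) (h := fun x => x - y) y (hasDerivAt_nome (y - y)) h0).const_sub 1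
    rw [sub_self, nome_zero, mul_one, mul_one] at h1
    exact h1.deriv
  -- The quotient of divided slopes is (h(x) - h(y))/E(x) with the singularity at y removed.
  -- Cauchy's theorem applies to it, and the subtracted h(y)/E contributes h(y) above and 0 below.
  set k : ℂ → ℂ := fun x => dslope h y x * (dslope E y x)⁻¹ with hk
  have hkne : ∀ x, x ≠ y → k x = (h x - h y) * (E x)⁻¹ := fun x hx => by
    have : x - y ≠ 0 := sub_ne_zero.mpr hx
    simp only [hk]
    rw [dslope_of_ne _ hx, dslope_of_ne _ hx, slope_def_field, slope_def_field, hEy, sub_zero]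
    rw [inv_div]; field_simp
  have hEdd : Differentiable ℂ (dslope E y) := by
    rw [← differentiableOn_univ, differentiableOn_dslope univ_mem]; exact hEd.differentiableOn
  have hdd : ∀ x : ℂ, |x.im| ≤ δ → DifferentiableAt ℂ (dslope h y) x := fun x hx => by
    by_cases hxy : x = y
    · subst hxy
      have ho : IsOpen {x : ℂ | |x.im| < δ} := isOpen_lt (by fun_prop) (by fun_prop)
      have : DifferentiableOn ℂ (dslope h x) {x : ℂ | |x.im| < δ} :=
        (differentiableOn_dslope (ho.mem_nhds hy)).mpr
          fun x hx => (hd x (le_of_lt hx)).differentiableWithinAt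
      exact (this x hy).differentiableAt (ho.mem_nhds hy)
    · exact (differentiableAt_dslope_of_ne hxy).mpr (hd x hx)
  -- The rectangle has width one and is centred at Re y, so among the zeros y + ℤ of E it contains
  -- only y.
  have key : ∫ x in (y.re - 1 / 2)..(y.re - 1 / 2 + 1), k (x + (-δ : ℝ) * I) =
      ∫ x in (y.re - 1 / 2)..(y.re - 1 / 2 + 1), k (x + δ * I) := by
    refine integral_eq_of_rect (fun x hx => ?_) fun t => ?_
    · rw [mem_reProdIm, Set.uIcc_of_le (by linarith), Set.uIcc_of_le (by linarith)] at hx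
      obtain ⟨⟨hx1, hx2⟩, hx3⟩ := hx
      refine ((hdd x (abs_le.mpr hx3)).mul ((hEdd x).inv ?_)).differentiableWithinAt
      by_cases hxy : x = y
      · rw [hxy, dslope_same, hE']; exact neg_ne_zero.mpr two_pi_I_ne_zero
      · rw [dslope_of_ne _ hxy, slope_def_field, hEy, sub_zero]
        refine div_ne_zero (fun h0 => hxy ?_) (sub_ne_zero.mpr hxy)
        obtain ⟨n, hn⟩ := (nome_eq_one_iff _).mp (sub_eq_zero.mp h0).symm
        have hre : x.re - y.re = n := by rw [← sub_re, hn]; simp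
        have hn0 : n = 0 := by
          have a : (n : ℝ) < 1 := by linarith
          have b : (-1 : ℝ) < n := by linarith
          have a' : n < 1 := by exact_mod_cast a
          have b' : -1 < n := by exact_mod_cast b
          omega
        rw [hn0, Int.cast_zero, sub_eq_zero] at hn
        exact hn
    · have n1 : ((y.re - 1 / 2 + 1 : ℝ) : ℂ) + t * I ≠ y := fun h0 => by
        have := congrArg re h0; simp at this; linarith
      have n2 : ((y.re - 1 / 2 : ℝ) : ℂ) + t * I ≠ y := fun h0 => by
        have := congrArg re h0; simp at this
      rw [hkne _ n1, hkne _ n2, ofReal_add, ofReal_one, add_right_comm, hp, hEp]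
  set k' : ℂ → ℂ := fun x => h x * (E x)⁻¹ - h y * (E x)⁻¹ with hk'
  have hk'p : Function.Periodic k' 1 := fun x => by simp only [hk', hp x, hEp x]
  have hline : ∀ (d r : ℝ), d ≠ y.im → ∫ x in r..(r + 1), k (x + d * I) = lineInt d k' := by
    intro d r hdy
    rw [lineInt_eq_shift d r hk'p]
    refine intervalIntegral.integral_congr fun x _ => ?_
    have : (x : ℂ) + d * I ≠ y := fun h0 => hdy (by rw [← h0]; simp)
    simp only [hk']
    rw [hkne _ this]; ring
  rw [hline _ _ (by linarith), hline _ _ (by linarith)] at key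
  have hEc : ∀ d : ℝ, d ≠ y.im → ∀ x : ℂ, x.im = d → ContinuousAt (fun x => (E x)⁻¹) x :=
    fun d hdy x hx => (hEd x).continuousAt.inv₀ (one_sub_nome_ne_zero (by
      rw [sub_im, hx]; exact sub_ne_zero.mpr hdy))
  have hsplit : ∀ d : ℝ, d ≠ y.im → |d| ≤ δ → lineInt d k' =
      lineInt d (fun x => h x * (E x)⁻¹) - h y * lineInt d (fun x => (E x)⁻¹) := by
    intro d hdy hd'
    rw [← lineInt_const_mul]
    exact lineInt_sub (fun x hx => (hd x (by rwa [hx])).continuousAt.mul (hEc d hdy x hx))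
      fun x hx => continuousAt_const.mul (hEc d hdy x hx)
  rw [hsplit _ (by linarith) (by rw [abs_neg, abs_of_pos hδ]), hsplit _ (by linarith)
    (by rw [abs_of_pos hδ]), lineInt_inv_above hy2, lineInt_inv_below hy1] at key
  linear_combination -key

/-! ### The continued Cauchy transform -/

/-- The continuation in `y` of `∫ h(x) / (1 - exp (2πi(x - y))) dx` from the lower half-plane. -/
def cauchyT (δ : ℝ) (h : ℂ → ℂ) (y : ℂ) : ℂ :=
  if y.im < 0 then lineInt δ (fun x => h x * (1 - nome (x - y))⁻¹)
  else h y + lineInt (-δ) (fun x => h x * (1 - nome (x - y))⁻¹)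

lemma periodic_cauchy_integrand {h : ℂ → ℂ} (hp : Function.Periodic h 1) (y : ℂ) :
    Function.Periodic (fun x => h x * (1 - nome (x - y))⁻¹) 1 :=
  fun x => by
    dsimp only
    rw [hp, add_sub_right_comm, nome_add, nome_one, mul_one]

section cauchyT

variable {δ : ℝ} {h : ℂ → ℂ} (hp : Function.Periodic h 1)
  (hd : ∀ x : ℂ, |x.im| ≤ δ → DifferentiableAt ℂ h x) {y : ℂ}
include hp hd

lemma cauchyT_of_lt (hy : y.im < δ) :
    cauchyT δ h y = lineInt δ (fun x => h x * (1 - nome (x - y))⁻¹) := by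
  unfold cauchyT
  split_ifs with h0
  · rfl
  · exact (lineInt_residue hp hd (by rw [abs_of_nonneg (not_lt.mp h0)]; exact hy)).symm

/-- With `cauchyT_of_lt` this gives two representations that agree on |Im y| < δ by the residue
theorem, so the case distinction in `cauchyT` creates no discontinuity. -/
lemma cauchyT_of_gt (hy : -δ < y.im) :
    cauchyT δ h y = h y + lineInt (-δ) (fun x => h x * (1 - nome (x - y))⁻¹) := by
  unfold cauchyT
  split_ifs with h0
  · exact lineInt_residue hp hd (by rw [abs_of_neg h0]; linarith)
  · rfl

lemma cauchyT_of_neg (hδ : 0 < δ) (hy : y.im < 0) :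
    cauchyT δ h y = lineInt 0 (fun x => h x * (1 - nome (x - y))⁻¹) := by
  rw [cauchyT, if_pos hy]
  refine (lineInt_eq_of_differentiable (periodic_cauchy_integrand hp y) fun x hx => ?_).symm
  rw [Set.uIcc_of_le hδ.le] at hx
  have hE : DifferentiableAt ℂ (fun x => 1 - nome (x - y)) x := by
    have := differentiable_nome; fun_prop
  refine (hd x (abs_le.mpr ⟨by linarith [hx.1], hx.2⟩)).mul (hE.inv (one_sub_nome_ne_zero ?_))
  rw [sub_im]; linarith [hx.1]

/-- Reflecting x ↦ -x turns the kernel at -y into 1 minus the kernel at y, on the line Im x = -δ.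
The integrals against the kernel at y cancel, leaving the residue h(y) and ∫h. -/
lemma cauchyT_add_cauchyT_neg_of_nonneg (hδ : 0 < δ) (he : ∀ x, h (-x) = h x) (hy : 0 ≤ y.im) :
    cauchyT δ h y + cauchyT δ h (-y) = h y + lineInt 0 h := by
  have hc : ∀ x : ℂ, x.im = -δ → ContinuousAt h x := fun x hx =>
    (hd x (by rw [hx, abs_neg, abs_of_pos hδ])).continuousAt
  rw [cauchyT_of_gt hp hd (by linarith), cauchyT_of_lt hp hd (y := -y) (by simp; linarith)]
  have h1 := lineInt_neg (-δ) (periodic_cauchy_integrand hp (-y))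
  rw [neg_neg] at h1
  have hE : ∀ x : ℂ, x.im = -δ → 1 - nome (x - y) ≠ 0 := fun x hx =>
    one_sub_nome_ne_zero (by rw [sub_im, hx]; intro h0; linarith)
  have h2 : lineInt (-δ) (fun x => h (-x) * (1 - nome (-x - -y))⁻¹) =
      lineInt (-δ) (fun x => h x - h x * (1 - nome (x - y))⁻¹) := by
    refine lineInt_congr fun x hx => ?_
    have a1 := hE x hx
    have e : nome (-x - -y) = (nome (x - y))⁻¹ := by rw [← nome_neg]; congr 1; ring
    have a2 := nome_ne_zero (x - y)
    have a3 : nome (x - y) - 1 ≠ 0 := fun h => a1 (by linear_combination -h)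
    rw [e, he]
    field_simp
    ring
  have hc' : ∀ x : ℂ, x.im = -δ → ContinuousAt (fun x => h x * (1 - nome (x - y))⁻¹) x :=
    fun x hx => by
      have : Continuous fun x => 1 - nome (x - y) := by
        have := differentiable_nome.continuous; fun_prop
      exact (hc x hx).mul (this.continuousAt.inv₀ (hE x hx))
  rw [lineInt_sub hc hc'] at h2
  have h3 : lineInt (-δ) h = lineInt 0 h := lineInt_eq_of_differentiable hp fun x hx => by
    rw [Set.uIcc_of_le (by linarith)] at hx
    exact hd x (abs_le.mpr ⟨hx.1, by linarith [hx.2]⟩)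
  rw [← h1, h2, h3]
  ring

/-- The reflection formula of the continued Cauchy transform. -/
lemma cauchyT_add_cauchyT_neg (hδ : 0 < δ) (he : ∀ x, h (-x) = h x) :
    cauchyT δ h y + cauchyT δ h (-y) = h y + lineInt 0 h := by
  rcases le_total 0 y.im with hy | hy
  · exact cauchyT_add_cauchyT_neg_of_nonneg hp hd hδ he hy
  · have := cauchyT_add_cauchyT_neg_of_nonneg hp hd hδ he (y := -y) (by simpa using hy)
    rw [neg_neg, he] at this
    rw [← this, add_comm]

end cauchyT

/-! ### Holomorphic dependence on a parameter -/

/-- Joint continuity bounds the integrand on a compact set, and Cauchy's estimate turns this into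
the dominating bound for the derivative. -/
lemma differentiableOn_integral_param {k : ℂ → ℝ → ℂ} {U : Set ℂ} (hU : IsOpen U)
    (hk : ContinuousOn (Function.uncurry k) (U ×ˢ Set.univ))
    (hd : ∀ x, DifferentiableOn ℂ (fun g => k g x) U) :
    DifferentiableOn ℂ (fun g => ∫ x in (0 : ℝ)..1, k g x) U := by
  intro g hg
  refine DifferentiableAt.differentiableWithinAt ?_
  obtain ⟨r, hr, hrU⟩ := Metric.nhds_basis_closedBall.mem_iff.mp (hU.mem_nhds hg)
  have hr2 : 0 < r / 2 := half_pos hr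
  have hcpt : IsCompact (Metric.closedBall g r ×ˢ Set.Icc (0 : ℝ) 1) :=
    (isCompact_closedBall g r).prod isCompact_Icc
  obtain ⟨M, hM⟩ := hcpt.exists_bound_of_continuousOn
    (hk.mono (Set.prod_mono hrU (Set.subset_univ _)))
  have hkc : ∀ w ∈ U, Continuous (k w) := fun w hw => by
    rw [← continuousOn_univ]
    exact hk.comp (f := fun x => (w, x)) (by fun_prop) fun x _ => ⟨hw, Set.mem_univ _⟩
  have hbU : ∀ w ∈ Metric.ball g (r / 2), w ∈ U := fun w hw =>
    hrU (Metric.ball_subset_closedBall (Metric.ball_subset_ball (by linarith) hw))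
  refine (intervalIntegral.hasDerivAt_integral_of_dominated_loc_of_deriv_le (F := k)
    (F' := fun w x => deriv (fun g => k g x) w) (bound := fun _ => M / (r / 2))
    (Metric.ball_mem_nhds g hr2) ?_ ?_ ?_ ?_ ?_ ?_).2.differentiableAt
  · filter_upwards [hU.mem_nhds hg] with w hw
    exact (hkc w hw).aestronglyMeasurable
  · exact (hkc g hg).intervalIntegrable _ _
  -- Measurability of the derivative in x: it is the pointwise limit of continuous difference
  -- quotients along the increments 1/(n+1).
  · have hu : Tendsto (fun n : ℕ => ((1 : ℂ) / ((n : ℂ) + 1))) atTop (𝓝[≠] 0) := by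
      refine tendsto_nhdsWithin_iff.mpr ⟨tendsto_one_div_add_atTop_nhds_zero_nat, ?_⟩
      exact .of_forall fun n => one_div_ne_zero (Nat.cast_add_one_ne_zero n)
    have hu' := hu.mono_right nhdsWithin_le_nhds
    have hgu : ∀ᶠ n : ℕ in atTop, g + (1 : ℂ) / ((n : ℂ) + 1) ∈ U := by
      have : Tendsto (fun n : ℕ => g + (1 : ℂ) / ((n : ℂ) + 1)) atTop (𝓝 (g + 0)) :=
        hu'.const_add g
      rw [add_zero] at this
      exact this.eventually_mem (hU.mem_nhds hg)
    obtain ⟨N, hN⟩ := eventually_atTop.mp hgu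
    refine aestronglyMeasurable_of_tendsto_ae atTop (f := fun (n : ℕ) (x : ℝ) =>
      ((1 : ℂ) / (((n + N : ℕ) : ℂ) + 1))⁻¹ • (k (g + (1 : ℂ) / (((n + N : ℕ) : ℂ) + 1)) x - k g x))
      (fun n => ?_) (.of_forall fun x => ?_)
    · refine Continuous.aestronglyMeasurable ?_
      exact ((hkc _ (hN _ (Nat.le_add_left _ _))).sub (hkc g hg)).const_smul ((1 : ℂ) / (((n + N : ℕ) : ℂ) + 1))⁻¹
    · have := ((hd x g hg).differentiableAt (hU.mem_nhds hg)).hasDerivAt.tendsto_slope_zero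
      exact (this.comp hu).comp (tendsto_add_atTop_nat N)
  -- Discs of radius r/2 centred in the ball of radius r/2 about g stay in the closed ball of radius
  -- r, where M is a bound.
  · refine .of_forall fun x hx w hw => ?_
    rw [Set.uIoc_of_le zero_le_one] at hx
    refine Complex.norm_deriv_le_of_forall_mem_sphere_norm_le hr2 ?_ fun v hv => ?_
    · refine (DifferentiableOn.mono (hd x) ?_).diffContOnCl
      refine (closure_mono Metric.ball_subset_closedBall).trans ?_
      rw [Metric.isClosed_closedBall.closure_eq]
      refine (Metric.closedBall_subset_closedBall' ?_).trans hrU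
      linarith [Metric.mem_ball.mp hw]
    · refine hM (v, x) ⟨?_, hx.1.le, hx.2⟩
      rw [Metric.mem_closedBall]
      linarith [dist_triangle v w g, Metric.mem_sphere.mp hv, Metric.mem_ball.mp hw]
  · exact intervalIntegrable_const
  · refine .of_forall fun x _ w hw => ?_
    exact ((hd x w (hbU w hw)).differentiableAt (hU.mem_nhds (hbU w hw))).hasDerivAt

lemma differentiableOn_lineInt {k : ℂ → ℂ → ℂ} {U : Set ℂ} {δ : ℝ} (hU : IsOpen U)
    (hd : ∀ g ∈ U, ∀ x : ℂ, x.im = δ → DifferentiableAt ℂ (Function.uncurry k) (g, x)) :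
    DifferentiableOn ℂ (fun g => lineInt δ (k g)) U := by
  refine differentiableOn_integral_param hU (k := fun g x => k g (x + δ * I)) ?_ ?_
  · rintro ⟨g, x⟩ ⟨hg, -⟩
    have h1 := (hd g hg (x + δ * I) (by simp)).continuousAt
    exact (ContinuousAt.comp (f := fun v : ℂ × ℝ => (v.1, (v.2 : ℂ) + δ * I)) (x := (g, x)) h1
      (by fun_prop)).continuousWithinAt
  · intro x g hg
    have h1 := hd g hg (x + δ * I) (by simp)
    exact (DifferentiableAt.comp (f := fun v : ℂ => (v, (x : ℂ) + δ * I)) g h1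
      (by fun_prop)).differentiableWithinAt

section cauchyT_param

variable {δ c : ℝ} {h : ℂ → ℂ → ℂ} (hp : ∀ g, Function.Periodic (h g) 1)
  (hd : ∀ g x : ℂ, g.im < c → |x.im| ≤ δ → DifferentiableAt ℂ (Function.uncurry h) (g, x))
include hd

lemma differentiableAt_of_uncurry {g x : ℂ} (hg : g.im < c) (hx : |x.im| ≤ δ) :
    DifferentiableAt ℂ (h g) x :=
  DifferentiableAt.comp (f := fun v : ℂ => (g, v)) x (hd g x hg hx) (by fun_prop)

lemma differentiableOn_lineInt_cauchy (β : ℂ) {U : Set ℂ} {d : ℝ} (hU : IsOpen U)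
    (hUc : ∀ g ∈ U, g.im < c) (hdδ : |d| ≤ δ) (hUd : ∀ g ∈ U, d ≠ (g + β).im) :
    DifferentiableOn ℂ (fun g => lineInt d (fun x => h g x * (1 - nome (x - (g + β)))⁻¹)) U := by
  refine differentiableOn_lineInt (k := fun g x => h g x * (1 - nome (x - (g + β)))⁻¹) hU ?_
  intro g hg x hx
  have h1 := hd g x (hUc g hg) (by rwa [hx])
  have h2 : Differentiable ℂ fun v : ℂ × ℂ => 1 - nome (v.2 - (v.1 + β)) := by
    have := differentiable_nome
    fun_prop
  exact h1.mul ((h2 (g, x)).inv (one_sub_nome_ne_zero (by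
    rw [sub_im, hx]; exact sub_ne_zero.mpr (hUd g hg))))

include hp

/-- Either line Im x = ±δ gives an integral analytic in the parameter as long as the pole stays on
one side. Hence the only possible singularities of the continuation are those of the residue g ↦
h(g, g+β). -/
lemma cauchyT_param_eventually (hδ : 0 < δ) {g : ℂ} (β : ℂ) (hg : g.im < c) :
    ∃ f : ℂ → ℂ, AnalyticAt ℂ f g ∧
      ((∀ᶠ w in 𝓝 g, cauchyT δ (h w) (w + β) = f w) ∨
        ∀ᶠ w in 𝓝 g, cauchyT δ (h w) (w + β) = h w (w + β) + f w) := by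
  have hc : ∀ w : ℂ, w.im < c → ∀ x : ℂ, |x.im| ≤ δ → DifferentiableAt ℂ (h w) x :=
    fun w hw x hx => differentiableAt_of_uncurry hd hw hx
  rcases lt_or_ge (g + β).im δ with h1 | h1
  · have hU : IsOpen {w : ℂ | w.im < c ∧ (w + β).im < δ} :=
      (isOpen_lt (by fun_prop) (by fun_prop)).and (isOpen_lt (by fun_prop) (by fun_prop))
    refine ⟨_, (differentiableOn_lineInt_cauchy hd β hU (fun w hw => hw.1) (abs_of_pos hδ).le
      fun w hw => hw.2.ne').analyticAt (hU.mem_nhds ⟨hg, h1⟩), Or.inl ?_⟩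
    filter_upwards [hU.mem_nhds ⟨hg, h1⟩] with w hw
    exact cauchyT_of_lt (hp w) (hc w hw.1) hw.2
  · have hU : IsOpen {w : ℂ | w.im < c ∧ -δ < (w + β).im} :=
      (isOpen_lt (by fun_prop) (by fun_prop)).and (isOpen_lt (by fun_prop) (by fun_prop))
    have hgU : g ∈ {w : ℂ | w.im < c ∧ -δ < (w + β).im} := ⟨hg, by linarith⟩
    refine ⟨_, (differentiableOn_lineInt_cauchy hd β hU (fun w hw => hw.1) (d := -δ)
      (by rw [abs_neg, abs_of_pos hδ]) fun w hw => hw.2.ne).analyticAt (hU.mem_nhds hgU), Or.inr ?_⟩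
    filter_upwards [hU.mem_nhds hgU] with w hw
    exact cauchyT_of_gt (hp w) (hc w hw.1) hw.2

lemma meromorphicAt_cauchyT (hδ : 0 < δ) {g β : ℂ} (hg : g.im < c)
    (hm : MeromorphicAt (fun w => h w (w + β)) g) :
    MeromorphicAt (fun w => cauchyT δ (h w) (w + β)) g := by
  obtain ⟨f, hf, h1 | h1⟩ := cauchyT_param_eventually hp hd hδ β hg
  · exact hf.meromorphicAt.congr ((EventuallyEq.symm h1).filter_mono nhdsWithin_le_nhds)
  · exact (hm.add hf.meromorphicAt).congr ((EventuallyEq.symm h1).filter_mono nhdsWithin_le_nhds)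

lemma continuousAt_cauchyT (hδ : 0 < δ) {g β : ℂ} (hg : g.im < c)
    (hm : ContinuousAt (fun w => h w (w + β)) g) :
    ContinuousAt (fun w => cauchyT δ (h w) (w + β)) g := by
  obtain ⟨f, hf, h1 | h1⟩ := cauchyT_param_eventually hp hd hδ β hg
  · exact hf.continuousAt.congr (EventuallyEq.symm h1)
  · exact (hm.add hf.continuousAt).congr (EventuallyEq.symm h1)

end cauchyT_param

/-! ### Partial fractions -/

/-- Lagrange interpolation of the constant 1 at the nodes -vᵢ, evaluated at -c; the signs produce
the differences vᵢ - c. -/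
lemma prod_inv_eq_sum {ι : Type*} [DecidableEq ι] {s : Finset ι} (hs : s.Nonempty) {v : ι → ℂ}
    (hv : Set.InjOn v s) {c : ℂ} (hc : ∀ i ∈ s, v i ≠ c) :
    ∏ i ∈ s, (v i - c)⁻¹ = ∑ i ∈ s, (∏ j ∈ s.erase i, (v j - v i)⁻¹) * (v i - c)⁻¹ := by
  have h1 := Lagrange.eval_interpolate_not_at_node (s := s) (v := fun i => -v i) (x := -c) 1
    fun i hi h => hc i hi (neg_injective h.symm)
  rw [Lagrange.interpolate_one (fun i hi j hj h => hv hi hj (neg_injective h)) hs,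
    Polynomial.eval_one, Lagrange.eval_nodal] at h1
  rw [Finset.prod_inv_distrib]
  refine inv_eq_of_mul_eq_one_right ?_
  rw [h1]
  simp only [Lagrange.nodalWeight, Pi.one_apply, mul_one, neg_sub_neg]

/-- The partial fraction expansion of `∏ 1 / ((1 - wᵢ X) (1 - wᵢ / X))`. -/
lemma prod_inv_eq_sum_of_inv {ι : Type*} [DecidableEq ι] {s : Finset ι} (hs : s.Nonempty)
    {w : ι → ℂ} (hw : ∀ i ∈ s, w i ≠ 0) (h1 : Set.InjOn w s)
    (h2 : ∀ i ∈ s, ∀ j ∈ s, w i * w j ≠ 1) {X : ℂ} (hX : X ≠ 0)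
    (h3 : ∀ i ∈ s, (1 - X * w i) * (1 - X⁻¹ * w i) ≠ 0) :
    ∏ i ∈ s, ((1 - X * w i) * (1 - X⁻¹ * w i))⁻¹ =
      ∑ i ∈ s, (∏ j ∈ s.erase i, ((1 - w i * w j) * (1 - (w i)⁻¹ * w j))⁻¹) *
        ((1 - X * w i) * (1 - X⁻¹ * w i))⁻¹ := by
  -- Each pair of factors is linear in Y + Y⁻¹. The new nodes wᵢ + wᵢ⁻¹ are distinct because neither
  -- wᵢ = wⱼ (for i ≠ j) nor wᵢwⱼ = 1 can hold.
  have e : ∀ Y : ℂ, Y ≠ 0 → ∀ i ∈ s, (1 - Y * w i) * (1 - Y⁻¹ * w i) =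
      w i * ((w i + (w i)⁻¹) - (Y + Y⁻¹)) := fun Y hY i hi => by
    have := hw i hi
    field_simp
    ring
  have hinj : Set.InjOn (fun i => w i + (w i)⁻¹) s := fun i hi j hj h => by
    have e1 := e (w j) (hw j hj) i hi
    dsimp only at h
    rw [h, sub_self, mul_zero, mul_eq_zero] at e1
    rcases e1 with e1 | e1
    · exact absurd (sub_eq_zero.mp e1).symm (h2 j hj i hi)
    · refine h1 hi hj ?_
      have := hw j hj
      field_simp at e1
      rw [mul_zero] at e1
      exact (sub_eq_zero.mp e1).symm
  have hc : ∀ i ∈ s, w i + (w i)⁻¹ ≠ X + X⁻¹ := fun i hi h => h3 i hi (by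
    rw [e X hX i hi, h, sub_self, mul_zero])
  have key := prod_inv_eq_sum hs hinj hc
  have l1 : ∏ i ∈ s, ((1 - X * w i) * (1 - X⁻¹ * w i))⁻¹ =
      (∏ i ∈ s, (w i)⁻¹) * ∏ i ∈ s, (w i + (w i)⁻¹ - (X + X⁻¹))⁻¹ := by
    rw [← Finset.prod_mul_distrib]
    exact Finset.prod_congr rfl fun i hi => by rw [e X hX i hi, mul_inv]
  rw [l1, key, Finset.mul_sum]
  refine Finset.sum_congr rfl fun i hi => ?_
  have l2 : ∏ j ∈ s.erase i, ((1 - w i * w j) * (1 - (w i)⁻¹ * w j))⁻¹ =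
      (∏ j ∈ s.erase i, (w j)⁻¹) * ∏ j ∈ s.erase i, (w j + (w j)⁻¹ - (w i + (w i)⁻¹))⁻¹ := by
    rw [← Finset.prod_mul_distrib]
    exact Finset.prod_congr rfl fun j hj => by
      rw [e (w i) (hw i hi) j (Finset.mem_of_mem_erase hj), mul_inv]
  rw [l2, e X hX i hi, ← Finset.mul_prod_erase s _ hi, mul_inv]
  ring

lemma lineInt_add {δ : ℝ} {f h : ℂ → ℂ} (hf : ∀ x : ℂ, x.im = δ → ContinuousAt f x)
    (hh : ∀ x : ℂ, x.im = δ → ContinuousAt h x) :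
    lineInt δ (fun x => f x + h x) = lineInt δ f + lineInt δ h :=
  intervalIntegral.integral_add (intervalIntegrable_line hf) (intervalIntegrable_line hh)

lemma lineInt_sum {ι : Type*} {δ : ℝ} {s : Finset ι} {f : ι → ℂ → ℂ}
    (hf : ∀ i ∈ s, ∀ x : ℂ, x.im = δ → ContinuousAt (f i) x) :
    lineInt δ (fun x => ∑ i ∈ s, f i x) = ∑ i ∈ s, lineInt δ (f i) :=
  intervalIntegral.integral_finsetSum fun i hi => intervalIntegrable_line (hf i hi)

lemma inv_mul_inv_eq {w X : ℂ} (hX : X ≠ 0) (h1 : 1 - X * w ≠ 0) (h2 : 1 - X⁻¹ * w ≠ 0)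
    (h3 : 1 - w * w ≠ 0) : ((1 - X * w) * (1 - X⁻¹ * w))⁻¹ =
      (1 - w * w)⁻¹ * ((1 - X * w)⁻¹ + (1 - X⁻¹ * w)⁻¹ - 1) := by
  have h4 : X - w ≠ 0 := fun h => h2 (by rw [sub_eq_zero.mp h |>.symm, inv_mul_cancel₀ hX, sub_self])
  have e : 1 - X⁻¹ * w = (X - w) / X := by field_simp
  rw [← pow_two] at h3 ⊢
  rw [e] at h2 ⊢
  field_simp
  ring

/-- The integral of an even function against a product of Cauchy kernels. -/
lemma lineInt_mul_prod_inv {ι : Type*} [DecidableEq ι] {s : Finset ι} (hs : s.Nonempty) {δ : ℝ}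
    (hδ : 0 < δ) {h : ℂ → ℂ} (hp : Function.Periodic h 1) (he : ∀ x, h (-x) = h x)
    (hd : ∀ x : ℂ, |x.im| ≤ δ → DifferentiableAt ℂ h x) {y : ι → ℂ}
    (hy : ∀ i ∈ s, (y i).im < 0) (hinj : ∀ i ∈ s, ∀ j ∈ s, nome (y i - y j) = 1 → i = j) :
    lineInt 0 (fun x => h x * ∏ i ∈ s, ((1 - nome (x - y i)) * (1 - nome (-x - y i)))⁻¹) =
      ∑ i ∈ s, (∏ j ∈ s.erase i, ((1 - nome (-(y i + y j))) * (1 - nome (y i - y j)))⁻¹) *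
        (1 - nome (-(2 * y i)))⁻¹ * (2 * cauchyT δ h (y i) - lineInt 0 h) := by
  set w : ι → ℂ := fun i => nome (-y i) with hw
  have hw0 : ∀ i, w i ≠ 0 := fun i => nome_ne_zero _
  have hwinv : ∀ i, (w i)⁻¹ = nome (y i) := fun i => by simp only [hw, nome_neg, inv_inv]
  have ew : ∀ x i, nome (x - y i) = nome x * w i := fun x i => by
    rw [sub_eq_add_neg, nome_add]
  have hwlt : ∀ i ∈ s, ‖w i‖ < 1 := fun i hi => norm_nome_lt_one (by simpa using hy i hi)
  have hww : ∀ i ∈ s, ∀ j ∈ s, w i * w j ≠ 1 := fun i hi j hj h0 => by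
    have := congrArg norm h0
    rw [norm_mul, norm_one] at this
    nlinarith [hwlt i hi, hwlt j hj, norm_nonneg (w i), norm_nonneg (w j)]
  have hE1 : ∀ i ∈ s, ∀ x : ℂ, x.im = 0 → 1 - nome (x - y i) ≠ 0 := fun i hi x hx =>
    one_sub_nome_ne_zero (by rw [sub_im, hx]; linarith [hy i hi])
  have hE2 : ∀ i ∈ s, ∀ x : ℂ, x.im = 0 → 1 - nome (-x - y i) ≠ 0 := fun i hi x hx =>
    one_sub_nome_ne_zero (by rw [sub_im, neg_im, hx]; linarith [hy i hi])
  have hh0 : ∀ x : ℂ, x.im = 0 → ContinuousAt h x := fun x hx =>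
    (hd x (by rw [hx, abs_zero]; exact hδ.le)).continuousAt
  have hc1 : ∀ i ∈ s, ∀ x : ℂ, x.im = 0 → ContinuousAt (fun x => h x * (1 - nome (x - y i))⁻¹) x := by
    intro i hi x hx
    have : Continuous fun x => 1 - nome (x - y i) := by
      have := differentiable_nome.continuous; fun_prop
    exact (hh0 x hx).mul (this.continuousAt.inv₀ (hE1 i hi x hx))
  have hc2 : ∀ i ∈ s, ∀ x : ℂ, x.im = 0 → ContinuousAt (fun x => h x * (1 - nome (-x - y i))⁻¹) x := by
    intro i hi x hx
    have : Continuous fun x => 1 - nome (-x - y i) := by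
      have := differentiable_nome.continuous; fun_prop
    exact (hh0 x hx).mul (this.continuousAt.inv₀ (hE2 i hi x hx))
  set a : ι → ℂ := fun i =>
    (∏ j ∈ s.erase i, ((1 - nome (-(y i + y j))) * (1 - nome (y i - y j)))⁻¹) *
      (1 - nome (-(2 * y i)))⁻¹ with ha
  have hsum : lineInt 0 (fun x => h x * ∏ i ∈ s, ((1 - nome (x - y i)) * (1 - nome (-x - y i)))⁻¹) =
      lineInt 0 (fun x => ∑ i ∈ s, a i * ((h x * (1 - nome (x - y i))⁻¹ +
        h x * (1 - nome (-x - y i))⁻¹) - h x)) := by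
    refine lineInt_congr fun x hx => ?_
    have key := prod_inv_eq_sum_of_inv hs (w := w) (fun i _ => hw0 i) (fun i hi j hj hij => by
      refine hinj i hi j hj ?_
      rw [ew, ← hwinv, hij, inv_mul_cancel₀ (hw0 j)]) hww (nome_ne_zero x) (fun i hi => by
      rw [← ew, ← nome_neg, ← ew]; exact mul_ne_zero (hE1 i hi x hx) (hE2 i hi x hx))
    have e1 : ∏ i ∈ s, ((1 - nome (x - y i)) * (1 - nome (-x - y i)))⁻¹ =
        ∏ i ∈ s, ((1 - nome x * w i) * (1 - (nome x)⁻¹ * w i))⁻¹ :=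
      Finset.prod_congr rfl fun i _ => by rw [ew, ew, nome_neg]
    rw [e1, key, Finset.mul_sum]
    refine Finset.sum_congr rfl fun i hi => ?_
    have n1 := hE1 i hi x hx
    have n2 := hE2 i hi x hx
    rw [ew] at n1 n2
    rw [nome_neg] at n2
    rw [inv_mul_inv_eq (nome_ne_zero x) n1 n2 (sub_ne_zero.mpr (hww i hi i hi).symm)]
    have e2 : ∏ j ∈ s.erase i, ((1 - w i * w j) * (1 - (w i)⁻¹ * w j))⁻¹ =
        ∏ j ∈ s.erase i, ((1 - nome (-(y i + y j))) * (1 - nome (y i - y j)))⁻¹ :=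
      Finset.prod_congr rfl fun j _ => by rw [ew, hwinv, neg_add, nome_add]
    have e3 : w i * w i = nome (-(2 * y i)) := by
      simp only [hw]; rw [← nome_add]; congr 1; ring
    rw [e2, e3, ew, ew, nome_neg x]
    simp only [ha]
    ring
  have hc3 : ∀ i ∈ s, ∀ x : ℂ, x.im = 0 → ContinuousAt (fun x => h x * (1 - nome (x - y i))⁻¹ +
      h x * (1 - nome (-x - y i))⁻¹) x := fun i hi x hx => (hc1 i hi x hx).add (hc2 i hi x hx)
  have hc4 : ∀ i ∈ s, ∀ x : ℂ, x.im = 0 → ContinuousAt (fun x => a i * (h x * (1 - nome (x - y i))⁻¹ +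
      h x * (1 - nome (-x - y i))⁻¹ - h x)) x := fun i hi x hx =>
    continuousAt_const.mul ((hc3 i hi x hx).sub (hh0 x hx))
  rw [hsum, lineInt_sum hc4]
  refine Finset.sum_congr rfl fun i hi => ?_
  rw [lineInt_const_mul, lineInt_sub (hc3 i hi) hh0,
    lineInt_add (hc1 i hi) (hc2 i hi)]
  -- Since h is even, the kernels at x and -x have the same integral, whence the factor 2.
  have h4 := lineInt_neg 0 (periodic_cauchy_integrand hp (y i))
  simp only [he, neg_zero] at h4
  rw [h4, ← cauchyT_of_neg hp hd hδ (hy i hi), ← two_mul]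

lemma analyticAt_one_sub_nome (a b g : ℂ) : AnalyticAt ℂ (fun g => 1 - nome (a * g + b)) g := by
  have : Differentiable ℂ fun g => 1 - nome (a * g + b) := by
    have := differentiable_nome; fun_prop
  exact this.analyticAt g

lemma eventually_nome_neg_two_mul_ne_one : ∀ᶠ g in 𝓝[≠] (0 : ℂ), 1 - nome (-(2 * g)) ≠ 0 := by
  have h1 : ∀ᶠ g in 𝓝[≠] (0 : ℂ), ‖2 * g‖ < 1 :=
    ((by fun_prop : Continuous fun g : ℂ => ‖2 * g‖).tendsto' 0 0 (by simp)).eventually_lt_const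
      one_pos |>.filter_mono nhdsWithin_le_nhds
  filter_upwards [h1, self_mem_nhdsWithin] with g hg hg0 h0
  obtain ⟨k, hk⟩ := (nome_eq_one_iff _).mp (sub_eq_zero.mp h0).symm
  rw [← norm_neg, hk, Complex.norm_intCast] at hg
  have hk0 : k = 0 := by
    rw [← Int.abs_lt_one_iff]
    exact_mod_cast hg
  rw [hk0, Int.cast_zero, neg_eq_zero, mul_eq_zero] at hk
  exact hg0 (hk.resolve_left two_ne_zero)

section pinch

variable {ι : Type*} (s : Finset ι) (β : ι → ℂ) (δ : ℝ) (h : ℂ → ℂ → ℂ)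

/-- The coefficient of the `i`-th term in the partial fraction expansion. -/
def pinchCoeff (i j : ι) (g : ℂ) : ℂ :=
  ((1 - nome (-(g + β i + (g + β j)))) * (1 - nome (g + β i - (g + β j))))⁻¹

/-- The `i`-th term of the continued integral. -/
def pinchTerm [DecidableEq ι] (i : ι) (g : ℂ) : ℂ :=
  (∏ j ∈ s.erase i, pinchCoeff β i j g) * (1 - nome (-(2 * (g + β i))))⁻¹ *
    (2 * cauchyT δ (h g) (g + β i) - lineInt 0 (h g))

variable {s β δ h}

lemma meromorphicAt_pinchCoeff (i j : ι) (g : ℂ) : MeromorphicAt (pinchCoeff β i j) g := by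
  have h1 := (analyticAt_one_sub_nome (-2) (-(β i + β j)) g).meromorphicAt
  have h2 := (analyticAt_one_sub_nome 0 (β i - β j) g).meromorphicAt
  refine (h1.mul h2).inv.congr (.of_forall fun g => ?_)
  simp only [pinchCoeff, Pi.inv_apply, Pi.mul_apply]
  ring_nf

lemma continuousAt_pinchCoeff {i j : ι} (h1 : nome (β i + β j) ≠ 1) (h2 : nome (β i - β j) ≠ 1) :
    ContinuousAt (pinchCoeff β i j) 0 := by
  have hc : Continuous fun g => (1 - nome (-(g + β i + (g + β j)))) * (1 - nome (g + β i - (g + β j))) := by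
    have := differentiable_nome.continuous
    fun_prop
  refine hc.continuousAt.inv₀ (mul_ne_zero ?_ ?_)
  · rw [zero_add, zero_add, nome_neg]
    intro h0
    exact h1 (inv_eq_one.mp (sub_eq_zero.mp h0).symm)
  · rw [zero_add, zero_add]
    exact sub_ne_zero.mpr h2.symm

lemma continuousAt_pinch_self {i : ι} (h1 : nome (β i + β i) ≠ 1) :
    ContinuousAt (fun g => (1 - nome (-(2 * (g + β i))))⁻¹) 0 := by
  have hc : Continuous fun g => 1 - nome (-(2 * (g + β i))) := by
    have := differentiable_nome.continuous
    fun_prop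
  refine hc.continuousAt.inv₀ ?_
  rw [zero_add, nome_neg, two_mul]
  intro h0
  exact h1 (inv_eq_one.mp (sub_eq_zero.mp h0).symm)

variable {c : ℝ} (hδ : 0 < δ) (hp : ∀ g, Function.Periodic (h g) 1)
  (hd : ∀ g x : ℂ, g.im < c → |x.im| ≤ δ → DifferentiableAt ℂ (Function.uncurry h) (g, x))
include hδ hd

lemma differentiableOn_lineInt_zero : DifferentiableOn ℂ (fun g => lineInt 0 (h g)) {g | g.im < c} :=
  differentiableOn_lineInt (isOpen_lt (by fun_prop) (by fun_prop)) fun g hg x hx =>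
    hd g x hg (by rw [hx, abs_zero]; exact hδ.le)

include hp

lemma meromorphicAt_pinchTerm [DecidableEq ι] {i : ι} {g : ℂ} (hg : g.im < c)
    (hm : MeromorphicAt (fun g => h g (g + β i)) g) : MeromorphicAt (pinchTerm s β δ h i) g := by
  have hU : IsOpen {g : ℂ | g.im < c} := isOpen_lt (by fun_prop) (by fun_prop)
  have h0 := ((differentiableOn_lineInt_zero hδ hd).analyticAt (hU.mem_nhds hg)).meromorphicAt
  have h1 := meromorphicAt_cauchyT hp hd hδ hg hm
  have h2 := (analyticAt_one_sub_nome (-2) (-(2 * β i)) g).meromorphicAt.inv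
  have h3 : MeromorphicAt (fun g => ∏ j ∈ s.erase i, pinchCoeff β i j g) g :=
    MeromorphicAt.fun_prod fun j _ => meromorphicAt_pinchCoeff i j g
  refine ((h3.mul h2).mul (((MeromorphicAt.const 2 g).mul h1).sub h0)).congr
    (.of_forall fun g => ?_)
  simp only [pinchTerm, Pi.mul_apply, Pi.sub_apply, Pi.inv_apply]
  ring_nf

lemma continuousAt_pinch_transform (hc : 0 < c) {i : ι}
    (hm : ContinuousAt (fun g => h g (g + β i)) 0) :
    ContinuousAt (fun g => 2 * cauchyT δ (h g) (g + β i) - lineInt 0 (h g)) 0 := by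
  have hU : IsOpen {g : ℂ | g.im < c} := isOpen_lt (by fun_prop) (by fun_prop)
  have h0 := ((differentiableOn_lineInt_zero hδ hd).analyticAt
    (hU.mem_nhds (show (0 : ℂ).im < c by simpa using hc))).continuousAt
  have h1 := continuousAt_cauchyT hp hd hδ (g := 0) (by simpa using hc) hm
  exact (continuousAt_const.mul h1).sub h0

/-- For the partner index i' the coefficient contains 1/(1 - e^{-4πig}), the trace of the pinch; the
zero of κ cancels exactly this factor and leaves a finite limit. -/
lemma tendsto_pinchTerm [DecidableEq ι] (hc : 0 < c) {i i' : ι} (hi' : i' ∈ s) (hne : i ≠ i')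
    (hβ : β i' = -β i) (hself : nome (β i + β i) ≠ 1)
    (hdiff : ∀ j ∈ s, j ≠ i → nome (β i - β j) ≠ 1)
    (hsum : ∀ j ∈ s, j ≠ i' → nome (β i + β j) ≠ 1)
    (hm : ContinuousAt (fun g => h g (g + β i)) 0) {κ κ₀ : ℂ → ℂ} (hκ₀ : ContinuousAt κ₀ 0)
    (hκ : ∀ g, κ g = (1 - nome (-(2 * g))) * κ₀ g) :
    Tendsto (fun g => κ g * pinchTerm s β δ h i g) (𝓝[≠] 0)
      (𝓝 (κ₀ 0 * ((1 - nome (2 * β i)) * (1 - nome (-(2 * β i))))⁻¹ *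
        (∏ j ∈ (s.erase i).erase i', ((1 - nome (-(β i + β j))) * (1 - nome (β i - β j)))⁻¹) *
          (2 * cauchyT δ (h 0) (β i) - lineInt 0 (h 0)))) := by
  have hc1 := continuousAt_pinch_transform hδ hp hd hc hm
  have hc2 := continuousAt_pinch_self (β := β) hself
  have hc3 : ContinuousAt (fun g => ∏ j ∈ (s.erase i).erase i', pinchCoeff β i j g) 0 :=
    tendsto_finsetProd _ fun j hj => by
      simp only [Finset.mem_erase] at hj
      exact continuousAt_pinchCoeff (hsum j hj.2.2 hj.1) (hdiff j hj.2.2 hj.2.1)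
  have hlim : Tendsto (fun g => κ₀ g * ((1 - nome (2 * β i))⁻¹ * (1 - nome (-(2 * (g + β i))))⁻¹) *
      (∏ j ∈ (s.erase i).erase i', pinchCoeff β i j g) *
        (2 * cauchyT δ (h g) (g + β i) - lineInt 0 (h g))) (𝓝[≠] 0) (𝓝 (κ₀ 0 *
      ((1 - nome (2 * β i))⁻¹ * (1 - nome (-(2 * (0 + β i))))⁻¹) *
      (∏ j ∈ (s.erase i).erase i', pinchCoeff β i j 0) *
        (2 * cauchyT δ (h 0) (0 + β i) - lineInt 0 (h 0)))) :=
    Tendsto.mono_left ((hκ₀.mul (continuousAt_const.mul hc2)).mul hc3 |>.mul hc1)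
      nhdsWithin_le_nhds
  simp only [pinchCoeff, zero_add] at hlim
  rw [mul_inv]
  refine hlim.congr' ?_
  filter_upwards [eventually_nome_neg_two_mul_ne_one] with g hg
  rw [hκ, pinchTerm, ← Finset.mul_prod_erase (s.erase i) _ (Finset.mem_erase.mpr ⟨hne.symm, hi'⟩)]
  have e : pinchCoeff β i i' g = ((1 - nome (-(2 * g))) * (1 - nome (2 * β i)))⁻¹ := by
    rw [pinchCoeff, hβ]; ring_nf
  rw [e]
  simp only [pinchCoeff]
  field_simp

/-- Without a partner nothing pinches: the term stays continuous and κ(0) = 0 removes it. -/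
lemma tendsto_pinchTerm_zero [DecidableEq ι] (hc : 0 < c) {i : ι} (hself : nome (β i + β i) ≠ 1)
    (hdiff : ∀ j ∈ s, j ≠ i → nome (β i - β j) ≠ 1) (hsum : ∀ j ∈ s, nome (β i + β j) ≠ 1)
    (hm : ContinuousAt (fun g => h g (g + β i)) 0) {κ κ₀ : ℂ → ℂ} (hκ₀ : ContinuousAt κ₀ 0)
    (hκ : ∀ g, κ g = (1 - nome (-(2 * g))) * κ₀ g) :
    Tendsto (fun g => κ g * pinchTerm s β δ h i g) (𝓝[≠] 0) (𝓝 0) := by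
  have hc1 := continuousAt_pinch_transform hδ hp hd hc hm
  have hc2 := continuousAt_pinch_self (β := β) hself
  have hc3 : ContinuousAt (fun g => ∏ j ∈ s.erase i, pinchCoeff β i j g) 0 :=
    tendsto_finsetProd _ fun j hj => by
      simp only [Finset.mem_erase] at hj
      exact continuousAt_pinchCoeff (hsum j hj.2) (hdiff j hj.2 hj.1)
  have hκc : ContinuousAt κ 0 := by
    have : Continuous fun g => 1 - nome (-(2 * g)) := by
      have := differentiable_nome.continuous
      fun_prop
    rw [show κ = fun g => (1 - nome (-(2 * g))) * κ₀ g from funext hκ]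
    exact this.continuousAt.mul hκ₀
  have hlim := (hκc.mul ((hc3.mul hc2).mul hc1)).tendsto
  have hκ0 : κ 0 = 0 := by rw [hκ]; simp [nome_zero]
  simp only [Pi.mul_apply, hκ0, zero_mul] at hlim
  exact hlim.mono_left nhdsWithin_le_nhds

/-- Continuation in `g` of an integral with poles at the points `±(g + βᵢ)`, of which one pair
pinches the contour as `g → 0`. -/
lemma exists_continuation_of_pinch [DecidableEq ι] (hc : 0 < c) (he : ∀ g x, h g (-x) = h g x) {i₁ i₂ : ι}
    (hi₁ : i₁ ∈ s) (hi₂ : i₂ ∈ s) (hne : i₁ ≠ i₂) (hβ : β i₂ = -β i₁)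
    (hdiff : ∀ i ∈ s, ∀ j ∈ s, nome (β i - β j) = 1 → i = j)
    (hsum : ∀ i ∈ s, ∀ j ∈ s, nome (β i + β j) = 1 → i = i₁ ∧ j = i₂ ∨ i = i₂ ∧ j = i₁)
    (hm : ∀ i ∈ s, ∀ g : ℂ, MeromorphicAt (fun g => h g (g + β i)) g)
    (hcont : ∀ i ∈ s, ContinuousAt (fun g => h g (g + β i)) 0) {κ κ₀ : ℂ → ℂ}
    (hκm : ∀ g, MeromorphicAt κ g) (hκ₀ : ContinuousAt κ₀ 0)
    (hκ : ∀ g, κ g = (1 - nome (-(2 * g))) * κ₀ g) :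
    ∃ G : ℂ → ℂ, MeromorphicOn G {g | g.im < c} ∧
      (∀ g : ℂ, g.im < c → (∀ i ∈ s, (g + β i).im < 0) → G g = κ g * lineInt 0 (fun x => h g x *
        ∏ i ∈ s, ((1 - nome (x - (g + β i))) * (1 - nome (-x - (g + β i))))⁻¹)) ∧
      Tendsto G (𝓝[≠] 0) (𝓝 (κ₀ 0 * ((1 - nome (2 * β i₁)) * (1 - nome (-(2 * β i₁))))⁻¹ *
        (∏ j ∈ (s.erase i₁).erase i₂, ((1 - nome (-(β i₁ + β j))) * (1 - nome (β i₁ - β j)))⁻¹) *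
          (2 * h 0 (β i₁)))) := by
  have hself : ∀ i ∈ s, nome (β i + β i) ≠ 1 := fun i hi h0 => by
    rcases hsum i hi i hi h0 with ⟨a, b⟩ | ⟨a, b⟩
    · exact hne (a.symm.trans b)
    · exact hne (b.symm.trans a)
  have hdiff' : ∀ i ∈ s, ∀ j ∈ s, j ≠ i → nome (β i - β j) ≠ 1 := fun i hi j hj hji h0 =>
    hji (hdiff i hi j hj h0).symm
  have hd' : ∀ g : ℂ, g.im < c → ∀ x : ℂ, |x.im| ≤ δ → DifferentiableAt ℂ (h g) x :=
    fun g hg x hx => differentiableAt_of_uncurry hd hg hx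
  refine ⟨fun g => ∑ i ∈ s, κ g * pinchTerm s β δ h i g, fun g hg => ?_, fun g hg hgi => ?_, ?_⟩
  · exact MeromorphicAt.fun_sum fun i hi =>
      (hκm g).fun_mul (meromorphicAt_pinchTerm hδ hp hd hg (hm i hi g))
  · dsimp only
    rw [lineInt_mul_prod_inv ⟨i₁, hi₁⟩ hδ (hp g) (he g) (hd' g hg) hgi fun i hi j hj h0 =>
      hdiff i hi j hj (by rwa [add_sub_add_left_eq_sub] at h0), Finset.mul_sum]
    rfl
  · have hi₂' : i₂ ∈ s.erase i₁ := Finset.mem_erase.mpr ⟨hne.symm, hi₂⟩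
    have l1 := tendsto_pinchTerm hδ hp hd hc hi₂ hne hβ (hself i₁ hi₁) (hdiff' i₁ hi₁)
      (fun j hj hji h0 => by
        rcases hsum _ hi₁ j hj h0 with ⟨-, b⟩ | ⟨a, -⟩
        · exact hji b
        · exact hne a) (hcont i₁ hi₁) hκ₀ hκ
    have l2 := tendsto_pinchTerm hδ hp hd hc hi₁ hne.symm (by rw [hβ, neg_neg]) (hself i₂ hi₂)
      (hdiff' i₂ hi₂) (fun j hj hji h0 => by
        rcases hsum _ hi₂ j hj h0 with ⟨a, -⟩ | ⟨-, b⟩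
        · exact hne a.symm
        · exact hji b) (hcont i₂ hi₂) hκ₀ hκ
    have l3 : Tendsto (fun g => ∑ i ∈ (s.erase i₁).erase i₂, κ g * pinchTerm s β δ h i g) (𝓝[≠] 0)
        (𝓝 (∑ i ∈ (s.erase i₁).erase i₂, 0)) := tendsto_finsetSum _ fun i hi => by
      simp only [Finset.mem_erase] at hi
      obtain ⟨n2, n1, his⟩ := hi
      exact tendsto_pinchTerm_zero hδ hp hd hc (hself i his) (hdiff' i his) (fun j hj h0 => by
        rcases hsum _ his j hj h0 with ⟨a, -⟩ | ⟨a, -⟩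
        · exact n1 a
        · exact n2 a) (hcont i his) hκ₀ hκ
    rw [Finset.sum_const_zero] at l3
    have l4 := l1.add (l2.add l3)
    -- The two surviving terms have equal coefficients. The reflection formula turns the sum of
    -- 2C(±β) - ∫h into 2h(β), so the Cauchy transforms disappear from the limit.
    have hrefl := cauchyT_add_cauchyT_neg (hp 0) (hd' 0 (by simpa using hc)) hδ (he 0) (y := β i₁)
    have e1 : ∏ j ∈ (s.erase i₂).erase i₁, ((1 - nome (-(β i₂ + β j))) * (1 - nome (β i₂ - β j)))⁻¹ =
        ∏ j ∈ (s.erase i₁).erase i₂, ((1 - nome (-(β i₁ + β j))) * (1 - nome (β i₁ - β j)))⁻¹ := by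
      rw [Finset.erase_right_comm]
      refine Finset.prod_congr rfl fun j _ => ?_
      rw [hβ]
      ring_nf
    rw [e1, hβ] at l4
    convert l4 using 2
    · rw [← Finset.add_sum_erase s _ hi₁, ← Finset.add_sum_erase _ _ hi₂']
    · have e2 : -(2 * -β i₁) = 2 * β i₁ := by ring
      have e3 : 2 * -β i₁ = -(2 * β i₁) := by ring
      rw [e2, e3, mul_comm (1 - nome (-(2 * β i₁))) (1 - nome (2 * β i₁))]
      linear_combination (-2 * κ₀ 0 * ((1 - nome (2 * β i₁)) * (1 - nome (-(2 * β i₁))))⁻¹ *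
        (∏ j ∈ (s.erase i₁).erase i₂, ((1 - nome (-(β i₁ + β j))) * (1 - nome (β i₁ - β j)))⁻¹)) *
          hrefl

end pinch

/-! ### Splitting off finitely many factors of the double product -/

/-- The indices of the factors that are split off. -/
def headIdx (N : ℕ) : Finset (ℕ × ℕ) := Finset.range N ×ˢ Finset.range N

/-- The factors of `doublePoch` with index outside `headIdx N`. -/
def tailPoch (η τ : ℂ) (N : ℕ) (t : ℂ) : ℂ :=
  zeroProd (fun k => if k ∈ headIdx N then 0 else nomePow η τ k) t

lemma nomePow_eq (η τ : ℂ) (k : ℕ × ℕ) : nomePow η τ k = nome (k.1 * τ + k.2 * (2 * η)) := by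
  rw [nomePow, nome_add, nome_nat_mul, nome_nat_mul]

section poch

variable {η τ : ℂ} (hη : 0 < η.im) (hτ : 0 < τ.im)
include hη hτ

lemma doublePoch_eq_prod_mul_tailPoch (N : ℕ) (t : ℂ) :
    doublePoch η τ t = (∏ k ∈ headIdx N, (1 - t * nomePow η τ k)) * tailPoch η τ N t :=
  zeroProd_eq_prod_mul (summable_nomePow hη hτ) _ t

lemma summable_tail (N : ℕ) :
    Summable fun k => ‖(if k ∈ headIdx N then 0 else nomePow η τ k : ℂ)‖ := by
  refine Summable.of_nonneg_of_le (fun _ => norm_nonneg _) (fun k => ?_) (summable_nomePow hη hτ)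
  split_ifs
  · rw [norm_zero]; exact norm_nonneg _
  · exact le_rfl

lemma differentiable_tailPoch (N : ℕ) : Differentiable ℂ (tailPoch η τ N) :=
  differentiable_zeroProd (summable_tail hη hτ N)

lemma tailPoch_ne_zero {N : ℕ} {t : ℂ} (h : ∀ k ∉ headIdx N, t * nomePow η τ k ≠ 1) :
    tailPoch η τ N t ≠ 0 := by
  rw [tailPoch, Ne, zeroProd_eq_zero_iff (summable_tail hη hτ N)]
  rintro ⟨k, hk⟩
  split_ifs at hk with hk'
  · simp at hk
  · exact h k hk' hk

lemma doublePoch_ne_zero_of {t : ℂ} (h : ∀ k, t * nomePow η τ k ≠ 1) : doublePoch η τ t ≠ 0 := by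
  rw [doublePoch, Ne, zeroProd_eq_zero_iff (summable_nomePow hη hτ)]
  rintro ⟨k, hk⟩
  exact h k hk

/-- In the half-plane |e^{2πiu}| ≤ e^{2πM}, and |p^a q^b| < e^{-2πM} outside a large square of
indices, so no tail factor can vanish. -/
lemma exists_tailPoch_ne_zero (M : ℝ) :
    ∃ N, 0 < N ∧ ∀ u : ℂ, -M ≤ u.im → tailPoch η τ N (nome u) ≠ 0 := by
  have hp := norm_nome_lt_one hτ
  have hq := norm_nome_lt_one (two_mul_im_pos hη)
  set K := Real.exp (2 * Real.pi * M) with hK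
  have hK0 : 0 < K⁻¹ := inv_pos.mpr (Real.exp_pos _)
  obtain ⟨n₁, h1⟩ := exists_pow_lt_of_lt_one hK0 hp
  obtain ⟨n₂, h2⟩ := exists_pow_lt_of_lt_one hK0 hq
  refine ⟨n₁ + n₂ + 1, Nat.succ_pos _, fun u hu => tailPoch_ne_zero hη hτ fun k hk h0 => ?_⟩
  have hu' : ‖nome u‖ ≤ K := by
    rw [norm_nome, hK, Real.exp_le_exp]
    nlinarith [Real.pi_pos]
  have hk' : ‖nomePow η τ k‖ < K⁻¹ := by
    rw [nomePow, norm_mul, norm_pow, norm_pow]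
    have a1 := pow_le_one₀ (n := k.1) (norm_nonneg _) hp.le
    have a2 := pow_le_one₀ (n := k.2) (norm_nonneg _) hq.le
    have b1 : 0 ≤ ‖nome τ‖ ^ k.1 := by positivity
    have b2 : 0 ≤ ‖nome (2 * η)‖ ^ k.2 := by positivity
    simp only [headIdx, Finset.mem_product, Finset.mem_range, not_and_or, not_lt] at hk
    rcases hk with hk | hk
    · have := pow_le_pow_of_le_one (norm_nonneg _) hp.le (show n₁ ≤ k.1 by omega)
      nlinarith
    · have := pow_le_pow_of_le_one (norm_nonneg _) hq.le (show n₂ ≤ k.2 by omega)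
      nlinarith
  have := congrArg norm h0
  rw [norm_mul, norm_one] at this
  have h3 : K * K⁻¹ = 1 := mul_inv_cancel₀ (Real.exp_pos _).ne'
  nlinarith [norm_nonneg (nome u), norm_nonneg (nomePow η τ k), Real.exp_pos (2 * Real.pi * M)]

/-- The index quadrant splits into its corner, the rest of the first row, the rest of the first
column, and a translated quadrant. -/
lemma doublePoch_eq_mul' (t : ℂ) : doublePoch η τ t =
    (1 - t) * (qPoch (t * nome τ) (nome τ) * qPoch (t * nome (2 * η)) (nome (2 * η)) *
      doublePoch η τ (nome τ * nome (2 * η) * t)) := by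
  have hsw : ∀ t, doublePoch η τ t = doublePoch (τ / 2) (2 * η) t := fun t => by
    rw [doublePoch, doublePoch, ← zeroProd_comp_equiv (Equiv.prodComm ℕ ℕ)]
    congr 1
    funext k
    simp only [Function.comp, nomePow, Equiv.prodComm_apply, Prod.fst_swap, Prod.snd_swap,
      mul_div_cancel₀ τ (two_ne_zero' ℂ)]
    ring
  have h1 := doublePoch_eq_mul hη hτ t
  have h2 := doublePoch_eq_mul (half_im_pos hτ) (two_mul_im_pos hη) (t * nome (2 * η))
  rw [mul_div_cancel₀ τ (two_ne_zero' ℂ), ← hsw, ← hsw] at h2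
  rw [h1, h2, qPoch_eq_mul (norm_nome_lt_one hτ) t]
  ring_nf

/-- The value at t = 1 of the double product without its vanishing factor 1 - t. Away from 1 the
factor can be cancelled, and both sides are continuous. This value explains the normalization
(q;q)_∞(p;p)_∞ of the integral. -/
lemma prod_erase_mul_tailPoch_one {N : ℕ} (hN : 0 < N) :
    (∏ k ∈ (headIdx N).erase (0, 0), (1 - 1 * nomePow η τ k)) * tailPoch η τ N 1 =
      qPoch (nome τ) (nome τ) * qPoch (nome (2 * η)) (nome (2 * η)) *
        doublePoch η τ (nome τ * nome (2 * η)) := by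
  have h0 : ((0, 0) : ℕ × ℕ) ∈ headIdx N := by simp [headIdx, hN]
  have key : ∀ t : ℂ, t ≠ 1 → (∏ k ∈ (headIdx N).erase (0, 0), (1 - t * nomePow η τ k)) *
      tailPoch η τ N t = qPoch (t * nome τ) (nome τ) * qPoch (t * nome (2 * η)) (nome (2 * η)) *
      doublePoch η τ (nome τ * nome (2 * η) * t) := fun t ht => by
    have h1 := doublePoch_eq_mul' hη hτ t
    rw [doublePoch_eq_prod_mul_tailPoch hη hτ N t, ← Finset.mul_prod_erase _ _ h0, mul_assoc] at h1
    have h2 : nomePow η τ (0, 0) = 1 := by simp [nomePow]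
    rw [h2, mul_one] at h1
    exact mul_left_cancel₀ (sub_ne_zero.mpr ht.symm) h1
  have hq : ∀ {r : ℂ}, ‖r‖ < 1 → Continuous fun t => qPoch t r := fun hr =>
    (differentiable_zeroProd (summable_norm_pow hr)).continuous
  have c1 : Continuous fun t => (∏ k ∈ (headIdx N).erase (0, 0), (1 - t * nomePow η τ k)) *
      tailPoch η τ N t := by
    have := (differentiable_tailPoch hη hτ N).continuous
    fun_prop
  have c2 : Continuous fun t => qPoch (t * nome τ) (nome τ) *
      qPoch (t * nome (2 * η)) (nome (2 * η)) * doublePoch η τ (nome τ * nome (2 * η) * t) := by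
    have a1 := (hq (norm_nome_lt_one hτ)).comp (continuous_mul_const (nome τ))
    have a2 := (hq (norm_nome_lt_one (two_mul_im_pos hη))).comp (continuous_mul_const (nome (2 * η)))
    have a3 := (differentiable_doublePoch hη hτ).continuous
    exact (a1.mul a2).mul (a3.comp (continuous_const_mul _))
  have := congrFun (Continuous.ext_on (dense_compl_singleton (1 : ℂ)) c1 c2 fun t ht => key t ht) 1
  simpa only [one_mul, mul_one] using this

end poch

/-! ### The continuation near `g = 0` -/

lemma analyticAt_add_of_periodic {Φ : ℂ → ℂ} {a : ℂ} (hp : Function.Periodic Φ a) {x : ℂ}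
    (h : AnalyticAt ℂ Φ x) : AnalyticAt ℂ Φ (x - a) := by
  have h1 : AnalyticAt ℂ (fun y => Φ (y + a)) (x - a) := by
    refine AnalyticAt.fun_comp (g := Φ) (f := fun y => y + a) ?_ (by fun_prop)
    simpa using h
  exact h1.congr (.of_forall fun y => hp y)

/-- Analyticity on the compact segment [0,1] extends to a neighbourhood, and periodicity spreads it
to a strip. -/
lemma IsTestFunction.exists_strip {Φ : ℂ → ℂ} (hΦ : IsTestFunction Φ) {r : ℝ} (hr : 0 < r) :
    ∃ δ > 0, δ < r ∧ ∀ x : ℂ, |x.im| ≤ δ → AnalyticAt ℂ Φ x := by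
  have hK : IsCompact ((fun t : ℝ => (t : ℂ)) '' Set.Icc 0 1) :=
    isCompact_Icc.image continuous_ofReal
  obtain ⟨ε, hε, hsub⟩ := hK.exists_cthickening_subset_open (isOpen_analyticAt ℂ Φ)
    (by rintro _ ⟨t, -, rfl⟩; exact hΦ.2.2 t)
  refine ⟨min ε (r / 2), lt_min hε (half_pos hr), (min_le_right _ _).trans_lt (half_lt_self hr),
    fun x hx => ?_⟩
  have h1 : AnalyticAt ℂ Φ (x - ⌊x.re⌋) := by
    refine hsub (Metric.mem_cthickening_of_dist_le _ ((Int.fract x.re : ℝ) : ℂ) _ _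
      ⟨_, ⟨Int.fract_nonneg _, (Int.fract_lt_one _).le⟩, rfl⟩ ?_)
    have e : x - ⌊x.re⌋ - ((Int.fract x.re : ℝ) : ℂ) = x.im * I := by
      refine Complex.ext ?_ ?_ <;> simp
    rw [dist_eq_norm, e, norm_mul, norm_I, mul_one, norm_real]
    exact hx.trans (min_le_left _ _)
  have h2 : Function.Periodic Φ ((-⌊x.re⌋ : ℤ) : ℂ) := by
    have := hΦ.2.1.int_mul (-⌊x.re⌋)
    rwa [mul_one] at this
  have h3 := analyticAt_add_of_periodic h2 h1
  rwa [Int.cast_neg, sub_neg_eq_add, sub_add_cancel] at h3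

section

variable (η τ z : ℂ) (N : ℕ) (Φ : ℂ → ℂ)

/-- The elliptic gamma function without the poles of index in `headIdx N`. -/
def regGamma (u : ℂ) : ℂ :=
  doublePoch η τ (nome τ * nome (2 * η) * (nome u)⁻¹) / tailPoch η τ N (nome u)

/-- The kernel without the poles of index in `headIdx N`, times the test function. -/
def regKernel (g x : ℂ) : ℂ :=
  regGamma η τ N (z + x - g) * regGamma η τ N (z - x - g) * regGamma η τ N (-z + x - g) *
    regGamma η τ N (-z - x - g) * ((eGamma η τ (2 * x))⁻¹ * (eGamma η τ (-(2 * x)))⁻¹) * Φ x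

/-- The poles of the kernel are at `x = ±(g + poleShift i)`. -/
def poleShift (i : Bool × (ℕ × ℕ)) : ℂ :=
  -(cond i.1 z (-z)) - (i.2.1 * τ + i.2.2 * (2 * η))

variable {η τ z N Φ} (hη : 0 < η.im) (hτ : 0 < τ.im)

lemma nome_sub_poleShift (x g : ℂ) (i : Bool × (ℕ × ℕ)) :
    nome (x - (g + poleShift η τ z i)) = nome (cond i.1 z (-z) + x - g) * nomePow η τ i.2 := by
  rw [nomePow_eq, ← nome_add, poleShift]
  congr 1
  ring

lemma prod_poles (g x : ℂ) :
    ∏ i ∈ (Finset.univ ×ˢ headIdx N : Finset (Bool × (ℕ × ℕ))),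
      ((1 - nome (x - (g + poleShift η τ z i))) * (1 - nome (-x - (g + poleShift η τ z i))))⁻¹ = 
    (∏ k ∈ headIdx N, (1 - nome (z + x - g) * nomePow η τ k))⁻¹ *
    (∏ k ∈ headIdx N, (1 - nome (z - x - g) * nomePow η τ k))⁻¹ *
    (∏ k ∈ headIdx N, (1 - nome (-z + x - g) * nomePow η τ k))⁻¹ *
    (∏ k ∈ headIdx N, (1 - nome (-z - x - g) * nomePow η τ k))⁻¹ := by
  simp only [nome_sub_poleShift, Finset.prod_product, Fintype.prod_bool, cond_true, cond_false,
    ← sub_eq_add_neg, mul_inv, Finset.prod_mul_distrib, Finset.prod_inv_distrib]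
  ring

include hη hτ

lemma eGamma_eq_regGamma (N : ℕ) (u : ℂ) :
    eGamma η τ u = regGamma η τ N u * (∏ k ∈ headIdx N, (1 - nome u * nomePow η τ k))⁻¹ := by
  rw [eGamma_eq hη hτ, regGamma, doublePoch_eq_prod_mul_tailPoch hη hτ N (nome u),
    div_eq_mul_inv, div_eq_mul_inv, mul_inv]
  ring

lemma kernelM_mul_eq (N : ℕ) (Φ : ℂ → ℂ) (g z x : ℂ) : kernelM η τ g z x * Φ x =
    (eGamma η τ (-(2 * g)))⁻¹ * (regKernel η τ z N Φ g x *
      ∏ i ∈ (Finset.univ ×ˢ headIdx N : Finset (Bool × (ℕ × ℕ))),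
        ((1 - nome (x - (g + poleShift η τ z i))) *
          (1 - nome (-x - (g + poleShift η τ z i))))⁻¹) := by
  rw [prod_poles, regKernel, kernelM, eGamma_eq_regGamma hη hτ N (z + x - g),
    eGamma_eq_regGamma hη hτ N (z - x - g), eGamma_eq_regGamma hη hτ N (-z + x - g),
    eGamma_eq_regGamma hη hτ N (-z - x - g), div_eq_mul_inv, mul_inv, mul_inv]
  ring

lemma differentiable_doublePoch_inv_nome :
    Differentiable ℂ fun u => doublePoch η τ (nome τ * nome (2 * η) * (nome u)⁻¹) := fun u => by
  have hn := differentiable_nome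
  have : DifferentiableAt ℂ (fun u => nome τ * nome (2 * η) * (nome u)⁻¹) u :=
    ((hn u).inv (nome_ne_zero u)).const_mul _
  exact (differentiable_doublePoch hη hτ _).comp u this

lemma differentiableAt_regGamma {u : ℂ} (hu : tailPoch η τ N (nome u) ≠ 0) :
    DifferentiableAt ℂ (regGamma η τ N) u :=
  (differentiable_doublePoch_inv_nome hη hτ u).div
    ((differentiable_tailPoch hη hτ N).comp differentiable_nome u) hu

lemma meromorphicAt_regGamma (u : ℂ) : MeromorphicAt (regGamma η τ N) u :=
  ((differentiable_doublePoch_inv_nome hη hτ).analyticAt u).meromorphicAt.div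
    (((differentiable_tailPoch hη hτ N).comp differentiable_nome).analyticAt u).meromorphicAt

lemma meromorphicAt_eGamma (u : ℂ) : MeromorphicAt (eGamma η τ) u := by
  rw [funext (eGamma_eq hη hτ)]
  exact ((differentiable_doublePoch_inv_nome hη hτ).analyticAt u).meromorphicAt.div
    (((differentiable_doublePoch hη hτ).comp differentiable_nome).analyticAt u).meromorphicAt

lemma differentiableAt_eGamma_inv_of_ne {u : ℂ}
    (hu : doublePoch η τ (nome τ * nome (2 * η) * (nome u)⁻¹) ≠ 0) :
    DifferentiableAt ℂ (fun u => (eGamma η τ u)⁻¹) u := by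
  rw [funext (eGamma_inv hη hτ)]
  exact ((differentiable_doublePoch hη hτ).comp differentiable_nome u).div
    (differentiable_doublePoch_inv_nome hη hτ u) hu

omit hη hτ in
lemma regKernel_neg (he : ∀ x, Φ (-x) = Φ x) (g x : ℂ) :
    regKernel η τ z N Φ g (-x) = regKernel η τ z N Φ g x := by
  simp only [regKernel, he, mul_neg, neg_neg, sub_neg_eq_add, ← sub_eq_add_neg]
  ring

omit hη hτ in
lemma regGamma_add_one (u : ℂ) : regGamma η τ N (u + 1) = regGamma η τ N u := by
  simp only [regGamma, nome_add, nome_one, mul_one]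

omit hη hτ in
lemma regGamma_sub_one (u : ℂ) : regGamma η τ N (u - 1) = regGamma η τ N u := by
  rw [← regGamma_add_one, sub_add_cancel]

omit hη hτ in
lemma periodic_regKernel (hp : Function.Periodic Φ 1) (g : ℂ) :
    Function.Periodic (regKernel η τ z N Φ g) 1 := fun x => by
  have e1 : ∀ a : ℂ, a + (x + 1) - g = a + x - g + 1 := fun a => by ring
  have e2 : ∀ a : ℂ, a - (x + 1) - g = a - x - g - 1 := fun a => by ring
  have e3 : 2 * (x + 1) = 2 * x + 1 + 1 := by ring
  have e4 : -(2 * x + 1 + 1) = -(2 * x) - 1 - 1 := by ring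
  simp only [regKernel, e1, e2, e3, e4, hp x, regGamma_add_one, regGamma_sub_one, eGamma_add_one,
    eGamma_sub_one]

lemma meromorphicAt_regKernel (hΦ : Meromorphic Φ) (b g : ℂ) :
    MeromorphicAt (fun g => regKernel η τ z N Φ g (g + b)) g := by
  have hR : ∀ f : ℂ → ℂ, Differentiable ℂ f → MeromorphicAt (fun g => regGamma η τ N (f g)) g :=
    fun f hf => (meromorphicAt_regGamma hη hτ (f g)).comp_analyticAt (hf.analyticAt g)
  have hG : ∀ f : ℂ → ℂ, Differentiable ℂ f → MeromorphicAt (fun g => (eGamma η τ (f g))⁻¹) g :=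
    fun f hf => ((meromorphicAt_eGamma hη hτ (f g)).comp_analyticAt (hf.analyticAt g)).inv
  have hF : MeromorphicAt (fun g => Φ (g + b)) g :=
    (hΦ (g + b)).comp_analyticAt (f := Φ) (g := fun g => g + b) (by fun_prop)
  unfold regKernel
  refine MeromorphicAt.fun_mul (((((?_ : MeromorphicAt _ _).fun_mul ?_).fun_mul ?_).fun_mul
    ?_).fun_mul (MeromorphicAt.fun_mul ?_ ?_)) hF
  · exact hR _ (by fun_prop)
  · exact hR _ (by fun_prop)
  · exact hR _ (by fun_prop)
  · exact hR _ (by fun_prop)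
  · exact hG _ (by fun_prop)
  · exact hG _ (by fun_prop)

lemma differentiableAt_regKernel {g x : ℂ} (h1 : tailPoch η τ N (nome (z + x - g)) ≠ 0)
    (h2 : tailPoch η τ N (nome (z - x - g)) ≠ 0) (h3 : tailPoch η τ N (nome (-z + x - g)) ≠ 0)
    (h4 : tailPoch η τ N (nome (-z - x - g)) ≠ 0)
    (h5 : doublePoch η τ (nome τ * nome (2 * η) * (nome (2 * x))⁻¹) ≠ 0)
    (h6 : doublePoch η τ (nome τ * nome (2 * η) * (nome (-(2 * x)))⁻¹) ≠ 0)
    (h7 : AnalyticAt ℂ Φ x) :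
    DifferentiableAt ℂ (Function.uncurry (regKernel η τ z N Φ)) (g, x) := by
  have hR : ∀ f : ℂ × ℂ → ℂ, Differentiable ℂ f → tailPoch η τ N (nome (f (g, x))) ≠ 0 →
      DifferentiableAt ℂ (fun v => regGamma η τ N (f v)) (g, x) := fun f hf h =>
    (differentiableAt_regGamma hη hτ h).comp (g, x) (hf (g, x))
  have hG : ∀ f : ℂ × ℂ → ℂ, Differentiable ℂ f →
      doublePoch η τ (nome τ * nome (2 * η) * (nome (f (g, x)))⁻¹) ≠ 0 →
      DifferentiableAt ℂ (fun v => (eGamma η τ (f v))⁻¹) (g, x) := fun f hf h =>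
    DifferentiableAt.comp (g := fun u => (eGamma η τ u)⁻¹) (g, x)
      (differentiableAt_eGamma_inv_of_ne hη hτ h) (hf (g, x))
  have hF : DifferentiableAt ℂ (fun v : ℂ × ℂ => Φ v.2) (g, x) :=
    DifferentiableAt.comp (g := Φ) (f := fun v : ℂ × ℂ => v.2) (g, x) h7.differentiableAt
      (by fun_prop)
  have e : Function.uncurry (regKernel η τ z N Φ) = fun v : ℂ × ℂ =>
      regGamma η τ N (z + v.2 - v.1) * regGamma η τ N (z - v.2 - v.1) *
      regGamma η τ N (-z + v.2 - v.1) * regGamma η τ N (-z - v.2 - v.1) *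
      ((eGamma η τ (2 * v.2))⁻¹ * (eGamma η τ (-(2 * v.2)))⁻¹) * Φ v.2 := by
    funext v; rfl
  rw [e]
  refine DifferentiableAt.fun_mul (((((?_ : DifferentiableAt _ _ _).fun_mul ?_).fun_mul ?_).fun_mul
    ?_).fun_mul (DifferentiableAt.fun_mul ?_ ?_)) hF
  · exact hR _ (by fun_prop) h1
  · exact hR _ (by fun_prop) h2
  · exact hR _ (by fun_prop) h3
  · exact hR _ (by fun_prop) h4
  · exact hG _ (by fun_prop) h5
  · exact hG _ (by fun_prop) h6

end

/-! ### Points off the lattice and the position of the poles. -/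

/-- `z` lies outside the lattice `(1/2)ℤ + ηℤ + (τ/2)ℤ`. -/
def OffLattice (η τ z : ℂ) : Prop := ∀ a b c : ℤ, z ≠ (c : ℂ) / 2 + a * η + b * (τ / 2)

section

variable {η τ z : ℂ}

lemma OffLattice.nome_ne_one (hz : OffLattice η τ z) (a b : ℤ) :
    nome (2 * z + (a * τ + b * (2 * η))) ≠ 1 := fun h => by
  obtain ⟨c, hc⟩ := (nome_eq_one_iff _).mp h
  refine hz (-b) (-a) c ?_
  push_cast
  linear_combination hc / 2

lemma OffLattice.neg (hz : OffLattice η τ z) : OffLattice η τ (-z) := fun a b c h => by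
  refine hz (-a) (-b) (-c) ?_
  push_cast
  linear_combination -h

lemma OffLattice.add (hz : OffLattice η τ z) (a b : ℤ) :
    OffLattice η τ (z + a * η + b * (τ / 2)) := fun a' b' c h => by
  refine hz (a' - a) (b' - b) c ?_
  push_cast
  linear_combination h

lemma Incommensurate.nome_eq_one (hi : Incommensurate η τ) {a b : ℤ}
    (h : nome (a * τ + b * (2 * η)) = 1) : a = 0 ∧ b = 0 := by
  obtain ⟨c, hc⟩ := (nome_eq_one_iff _).mp h
  have := hi (-c) b a (by push_cast; linear_combination hc)
  exact ⟨this.2.2, this.2.1⟩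

variable (hη : 0 < η.im) (hτ : 0 < τ.im)
include hη hτ

lemma OffLattice.tailPoch_ne_zero (hz : OffLattice η τ z) (N : ℕ) (a b : ℤ) :
    tailPoch η τ N (nome (2 * z + (a * τ + b * (2 * η)))) ≠ 0 :=
  EllipticDouble.tailPoch_ne_zero hη hτ fun k _ h => by
    rw [nomePow_eq, ← nome_add] at h
    refine hz.nome_ne_one (a + k.1) (b + k.2) ?_
    rw [← h]; congr 1; push_cast; ring

lemma OffLattice.doublePoch_ne_zero (hz : OffLattice η τ z) (a b : ℤ) :
    doublePoch η τ (nome (2 * z + (a * τ + b * (2 * η)))) ≠ 0 :=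
  doublePoch_ne_zero_of hη hτ fun k h => by
    rw [nomePow_eq, ← nome_add] at h
    refine hz.nome_ne_one (a + k.1) (b + k.2) ?_
    rw [← h]; congr 1; push_cast; ring

lemma OffLattice.doublePoch_inv_ne_zero (hz : OffLattice η τ z) (a b : ℤ) :
    doublePoch η τ (nome τ * nome (2 * η) * (nome (2 * z + (a * τ + b * (2 * η))))⁻¹) ≠ 0 := by
  have := hz.neg.doublePoch_ne_zero hη hτ (1 - a) (1 - b)
  rw [← nome_neg, ← nome_add, ← nome_add]
  convert this using 3
  push_cast; ring

/-- By incommensurability the only vanishing factor has index k, which was split off with the head.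
-/
lemma Incommensurate.tailPoch_neg_ne_zero (hi : Incommensurate η τ) {N : ℕ} {k : ℕ × ℕ}
    (hk : k ∈ headIdx N) : tailPoch η τ N (nome (-(k.1 * τ + k.2 * (2 * η)))) ≠ 0 :=
  EllipticDouble.tailPoch_ne_zero hη hτ fun l hl h => hl (by
    rw [nomePow_eq, ← nome_add] at h
    have := hi.nome_eq_one (a := l.1 - k.1) (b := l.2 - k.2) (by
      rw [← h]; congr 1; push_cast; ring)
    have e : l = k := Prod.ext (by omega) (by omega)
    rwa [e])

lemma Incommensurate.tailPoch_pos_ne_zero (hi : Incommensurate η τ) {N : ℕ} (hN : 0 < N)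
    (k : ℕ × ℕ) : tailPoch η τ N (nome (k.1 * τ + k.2 * (2 * η))) ≠ 0 :=
  EllipticDouble.tailPoch_ne_zero hη hτ fun l hl h => hl (by
    rw [nomePow_eq, ← nome_add] at h
    have := hi.nome_eq_one (a := l.1 + k.1) (b := l.2 + k.2) (by
      rw [← h]; congr 1; push_cast; ring)
    have e : l = (0, 0) := Prod.ext (by simp; omega) (by simp; omega)
    simp [e, headIdx, hN])

/-- Off the lattice the regularized kernel is holomorphic at the poles, for `g = 0`. -/
lemma differentiableAt_regKernel_poleShift (hi : Incommensurate η τ) (hz : OffLattice η τ z) {N : ℕ}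
    (hN : 0 < N) {Φ : ℂ → ℂ} {i : Bool × (ℕ × ℕ)} (hk : i.2 ∈ headIdx N)
    (hΦ : AnalyticAt ℂ Φ (poleShift η τ z i)) :
    DifferentiableAt ℂ (Function.uncurry (regKernel η τ z N Φ)) (0, poleShift η τ z i) := by
  obtain ⟨b, k⟩ := i
  have t1 := hz.tailPoch_ne_zero hη hτ N k.1 k.2
  have t2 := hz.tailPoch_ne_zero hη hτ N (-k.1) (-k.2)
  have t3 := hz.neg.tailPoch_ne_zero hη hτ N k.1 k.2
  have t4 := hz.neg.tailPoch_ne_zero hη hτ N (-k.1) (-k.2)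
  have t5 := hi.tailPoch_neg_ne_zero hη hτ hk
  have t6 := hi.tailPoch_pos_ne_zero hη hτ hN k
  have d1 := hz.doublePoch_inv_ne_zero hη hτ (2 * k.1) (2 * k.2)
  have d2 := hz.doublePoch_inv_ne_zero hη hτ (-(2 * k.1)) (-(2 * k.2))
  have d3 := hz.neg.doublePoch_inv_ne_zero hη hτ (2 * k.1) (2 * k.2)
  have d4 := hz.neg.doublePoch_inv_ne_zero hη hτ (-(2 * k.1)) (-(2 * k.2))
  push_cast at t1 t2 t3 t4 d1 d2 d3 d4
  cases b
  · refine differentiableAt_regKernel hη hτ ?_ ?_ ?_ ?_ ?_ ?_ hΦ <;>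
      simp only [poleShift, cond_false, sub_zero]
    · convert t2 using 3; ring
    · convert t6 using 3; ring
    · convert t5 using 3; ring
    · convert t3 using 3; ring
    · convert d2 using 5; ring
    · convert d3 using 5; ring
  · refine differentiableAt_regKernel hη hτ ?_ ?_ ?_ ?_ ?_ ?_ hΦ <;>
      simp only [poleShift, cond_true, sub_zero]
    · convert t5 using 3; ring
    · convert t1 using 3; ring
    · convert t4 using 3; ring
    · convert t6 using 3; ring
    · convert d4 using 5; ring
    · convert d1 using 5; ring

lemma eGamma_two_mul_ne_zero (hz : OffLattice η τ z) : eGamma η τ (2 * z) ≠ 0 := by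
  rw [eGamma_eq hη hτ]
  have h1 := hz.doublePoch_ne_zero hη hτ 0 0
  have h2 := hz.doublePoch_inv_ne_zero hη hτ 0 0
  simp only [Int.cast_zero, zero_mul, add_zero] at h1 h2
  exact div_ne_zero h2 h1

lemma lattice_im_nonneg (k : ℕ × ℕ) : 0 ≤ (k.1 * τ + k.2 * (2 * η) : ℂ).im := by
  have h1 : (k.1 * τ + k.2 * (2 * η) : ℂ).im = k.1 * τ.im + k.2 * (2 * η.im) := by simp
  rw [h1]; positivity

/-- The value at `g = 0` of the continued integral. -/
lemma pinch_value (hz : OffLattice η τ z) {N : ℕ} (hN : 0 < N) (Φ : ℂ → ℂ) :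
    qPoch (nome (2 * η)) (nome (2 * η)) * qPoch (nome τ) (nome τ) / 2 *
      ((∏ k ∈ (headIdx N).erase (0, 0), (1 - 1 * nomePow η τ k)) * tailPoch η τ N 1 /
          doublePoch η τ (nome τ * nome (2 * η)) *
        ((1 - nome (2 * z)) * (1 - nome (-(2 * z))))⁻¹ *
        (∏ j ∈ (Finset.univ ×ˢ (headIdx N).erase (0, 0) : Finset (Bool × (ℕ × ℕ))),
          ((1 - nome (-(z + poleShift η τ z j))) * (1 - nome (z - poleShift η τ z j)))⁻¹) *
        (2 * regKernel η τ z N Φ 0 z)) = Φ z := by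
  have h00 : ((0, 0) : ℕ × ℕ) ∈ headIdx N := by simp [headIdx, hN]
  have hn0 : nomePow η τ (0, 0) = 1 := by simp [nomePow]
  set D : ℂ → ℂ := fun t => ∏ k ∈ (headIdx N).erase (0, 0), (1 - t * nomePow η τ k) with hD
  have hG : ∀ u : ℂ, eGamma η τ u = regGamma η τ N u * ((1 - nome u) * D (nome u))⁻¹ := fun u => by
    rw [eGamma_eq_regGamma hη hτ N, ← Finset.mul_prod_erase _ _ h00, hn0, mul_one]
  have e1 : ∏ j ∈ (Finset.univ ×ˢ (headIdx N).erase (0, 0) : Finset (Bool × (ℕ × ℕ))),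
      ((1 - nome (-(z + poleShift η τ z j))) * (1 - nome (z - poleShift η τ z j)))⁻¹ =
      (D 1)⁻¹ * (D 1)⁻¹ * (D (nome (2 * z)))⁻¹ * (D (nome (-(2 * z))))⁻¹ := by
    have a1 : ∀ j, nome (-(z + poleShift η τ z j)) = nome (cond j.1 z (-z) - z) * nomePow η τ j.2 :=
      fun j => by
        rw [← sub_zero (cond j.1 z (-z) - z), sub_eq_add_neg _ z, ← nome_sub_poleShift]
        congr 1; ring
    have a2 : ∀ j, nome (z - poleShift η τ z j) = nome (cond j.1 z (-z) + z) * nomePow η τ j.2 :=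
      fun j => by
        rw [← sub_zero (cond j.1 z (-z) + z), ← nome_sub_poleShift]
        congr 1; ring
    simp only [a1, a2, Finset.prod_product, Fintype.prod_bool, cond_true, cond_false, mul_inv,
      Finset.prod_mul_distrib, Finset.prod_inv_distrib, sub_self, neg_add_cancel, nome_zero]
    rw [← two_mul, show -z - z = -(2 * z) by ring]
    simp only [hD]
    ring
  have e2 : regKernel η τ z N Φ 0 z = regGamma η τ N (2 * z) * regGamma η τ N 0 * regGamma η τ N 0 *
      regGamma η τ N (-(2 * z)) * ((eGamma η τ (2 * z))⁻¹ * (eGamma η τ (-(2 * z)))⁻¹) * Φ z := by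
    rw [regKernel]
    ring_nf
  have e3 : regGamma η τ N 0 = doublePoch η τ (nome τ * nome (2 * η)) / tailPoch η τ N 1 := by
    rw [regGamma, nome_zero, inv_one, mul_one]
  have key := prod_erase_mul_tailPoch_one hη hτ hN
  change D 1 * tailPoch η τ N 1 = _ at key
  have n1 := qPoch_self_ne_zero (norm_nome_lt_one hτ)
  have n2 := qPoch_self_ne_zero (norm_nome_lt_one (two_mul_im_pos hη))
  have n3 : doublePoch η τ (nome τ * nome (2 * η)) ≠ 0 := by
    refine doublePoch_ne_zero hη hτ ?_
    rw [← nome_add]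
    refine norm_nome_lt_one ?_
    rw [add_im]
    exact add_pos hτ (two_mul_im_pos hη)
  have n4 : D 1 ≠ 0 ∧ tailPoch η τ N 1 ≠ 0 := mul_ne_zero_iff.mp (by
    rw [key]; exact mul_ne_zero (mul_ne_zero n1 n2) n3)
  have g1 := eGamma_two_mul_ne_zero hη hτ hz
  have g2 := eGamma_two_mul_ne_zero hη hτ hz.neg
  rw [mul_neg] at g2
  -- The partial fraction coefficients restore the factors missing from `regGamma`. The resulting
  -- Γ(2z)Γ(-2z) cancels the denominator of the kernel at x = z.
  have e4 : ((1 - nome (2 * z)) * (1 - nome (-(2 * z))))⁻¹ * ((D (nome (2 * z)))⁻¹ *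
      (D (nome (-(2 * z))))⁻¹) * (regGamma η τ N (2 * z) * regGamma η τ N (-(2 * z))) =
      eGamma η τ (2 * z) * eGamma η τ (-(2 * z)) := by
    rw [hG, hG, mul_inv, mul_inv, mul_inv]; ring
  obtain ⟨n4, n5⟩ := n4
  change qPoch (nome (2 * η)) (nome (2 * η)) * qPoch (nome τ) (nome τ) / 2 *
    (D 1 * tailPoch η τ N 1 / doublePoch η τ (nome τ * nome (2 * η)) * _ * _ * _) = _
  rw [e1, e2, e3]
  trans qPoch (nome (2 * η)) (nome (2 * η)) * qPoch (nome τ) (nome τ) *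
    (doublePoch η τ (nome τ * nome (2 * η)) / (D 1 * tailPoch η τ N 1)) *
    (((1 - nome (2 * z)) * (1 - nome (-(2 * z))))⁻¹ * ((D (nome (2 * z)))⁻¹ *
      (D (nome (-(2 * z))))⁻¹) * (regGamma η τ N (2 * z) * regGamma η τ N (-(2 * z)))) *
      ((eGamma η τ (2 * z))⁻¹ * (eGamma η τ (-(2 * z)))⁻¹) * Φ z
  · field_simp
  · rw [e4, key]
    field_simp

end

/-! ### Continuation of M(g) to g = 0. -/

lemma lineInt_zero (h : ℂ → ℂ) : lineInt 0 h = ∫ x in (0 : ℝ)..1, h x := by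
  simp [lineInt]

section

variable {η τ z : ℂ}

lemma nome_poleShift_sub_eq_one (hi : Incommensurate η τ) (hz : OffLattice η τ z)
    (i j : Bool × (ℕ × ℕ)) (h : nome (poleShift η τ z i - poleShift η τ z j) = 1) : i = j := by
  obtain ⟨b, k⟩ := i
  obtain ⟨b', l⟩ := j
  have same : nome (((l.1 - k.1 : ℤ) : ℂ) * τ + ((l.2 - k.2 : ℤ) : ℂ) * (2 * η)) = 1 → k = l :=
    fun h => by
      have := hi.nome_eq_one h
      exact Prod.ext (by omega) (by omega)
  have n1 := hz.nome_ne_one (l.1 - k.1) (l.2 - k.2)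
  have n2 := hz.neg.nome_ne_one (l.1 - k.1) (l.2 - k.2)
  push_cast at same n1 n2
  rcases b <;> rcases b' <;> simp only [poleShift, cond_true, cond_false] at h
  · rw [same (by rw [← h]; congr 1; ring)]
  · exact absurd (by rw [← h]; congr 1; ring) n1
  · exact absurd (by rw [← h]; congr 1; ring) n2
  · rw [same (by rw [← h]; congr 1; ring)]

/-- Decides which poles g+βᵢ and -(g+βⱼ) collide at g = 0 modulo 1. Equal signs of z are excluded
off the lattice. For opposite signs incommensurability makes the non-negative lattice parts cancel,
so both vanish. -/
lemma nome_poleShift_add_eq_one (hi : Incommensurate η τ) (hz : OffLattice η τ z)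
    (i j : Bool × (ℕ × ℕ)) (h : nome (poleShift η τ z i + poleShift η τ z j) = 1) :
    i = (false, (0, 0)) ∧ j = (true, (0, 0)) ∨ i = (true, (0, 0)) ∧ j = (false, (0, 0)) := by
  obtain ⟨b, k⟩ := i
  obtain ⟨b', l⟩ := j
  have diff : nome (((-l.1 - k.1 : ℤ) : ℂ) * τ + ((-l.2 - k.2 : ℤ) : ℂ) * (2 * η)) = 1 →
      k = (0, 0) ∧ l = (0, 0) := fun h => by
    have := hi.nome_eq_one h
    exact ⟨Prod.ext (by simp; omega) (by simp; omega), Prod.ext (by simp; omega) (by simp; omega)⟩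
  have n1 := hz.nome_ne_one (-l.1 - k.1) (-l.2 - k.2)
  have n2 := hz.neg.nome_ne_one (-l.1 - k.1) (-l.2 - k.2)
  push_cast at diff n1 n2
  rcases b <;> rcases b' <;> simp only [poleShift, cond_true, cond_false] at h
  · exact absurd (by rw [← h]; congr 1; ring) n1
  · obtain ⟨rfl, rfl⟩ := diff (by rw [← h]; congr 1; ring)
    simp
  · obtain ⟨rfl, rfl⟩ := diff (by rw [← h]; congr 1; ring)
    simp
  · exact absurd (by rw [← h]; congr 1; ring) n2

variable (hη : 0 < η.im) (hτ : 0 < τ.im)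
include hη hτ

lemma poleShift_im_le (i : Bool × (ℕ × ℕ)) : (poleShift η τ z i).im ≤ |z.im| := by
  have h := lattice_im_nonneg hη hτ i.2
  rw [poleShift, sub_im, neg_im]
  rcases i with ⟨b, k⟩
  have a1 := neg_abs_le z.im
  have a2 := le_abs_self z.im
  cases b <;> simp only [cond_true, cond_false, neg_im, neg_neg] at h ⊢ <;> linarith

/-- Continuation of `g ↦ [M(g)Φ](z)` to a neighbourhood of `g = 0`, where `M(0)` is the identity on
even functions. -/
theorem exists_continuation_zero (hi : Incommensurate η τ) (hz : OffLattice η τ z) {Φ : ℂ → ℂ}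
    (hΦ : IsTestFunction Φ) (he : ∀ x, Φ (-x) = Φ x)
    (hΦz : ∀ a b : ℤ, AnalyticAt ℂ Φ (z + a * η + b * (τ / 2)) ∧
      AnalyticAt ℂ Φ (-z + a * η + b * (τ / 2))) :
    ∃ F : ℂ → ℂ, MeromorphicOn F {g | g.im < 1} ∧
      (∀ g : ℂ, |z.im| < -g.im → F g = intM η τ g Φ z) ∧ Tendsto F (𝓝[≠] 0) (𝓝 (Φ z)) := by
  have hη2 := two_mul_im_pos hη
  -- The bound on δ keeps 1/Γ(±2x) holomorphic for |Im x| ≤ δ.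
  obtain ⟨δ, hδ, hδr, hΦs⟩ := hΦ.exists_strip (r := (τ.im + (2 * η).im) / 2) (by positivity)
  -- For Im g < 1 and |Im x| ≤ δ the arguments ±z ± x - g have imaginary part at least -(|Im z| + δ
  -- + 1).
  obtain ⟨N, hN, hNt⟩ := exists_tailPoch_ne_zero hη hτ (|z.im| + δ + 1)
  have a1 := neg_abs_le z.im
  have a2 := le_abs_self z.im
  have hd : ∀ g x : ℂ, g.im < 1 → |x.im| ≤ δ →
      DifferentiableAt ℂ (Function.uncurry (regKernel η τ z N Φ)) (g, x) := fun g x hg hx => by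
    obtain ⟨b1, b2⟩ := abs_le.mp hx
    have hV : ∀ u : ℂ, u.im ≤ 2 * δ → doublePoch η τ (nome τ * nome (2 * η) * (nome u)⁻¹) ≠ 0 :=
      fun u hu => by
        rw [← nome_add, ← nome_neg, ← nome_add]
        refine doublePoch_ne_zero hη hτ (norm_nome_lt_one ?_)
        rw [add_im, add_im, neg_im]
        linarith
    refine differentiableAt_regKernel hη hτ ?_ ?_ ?_ ?_ ?_ ?_ (hΦs x hx)
    · exact hNt _ (by simp only [add_im, sub_im]; linarith)
    · exact hNt _ (by simp only [sub_im]; linarith)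
    · exact hNt _ (by simp only [add_im, sub_im, neg_im]; linarith)
    · exact hNt _ (by simp only [sub_im, neg_im]; linarith)
    · exact hV _ (by simp; linarith)
    · exact hV _ (by simp; linarith)
  set s : Finset (Bool × (ℕ × ℕ)) := Finset.univ ×ˢ headIdx N with hs
  have h00 : ((0, 0) : ℕ × ℕ) ∈ headIdx N := by simp [headIdx, hN]
  -- This is 1/Γ(-2g) with its zero factor 1 - e^{-4πig} removed.
  set κ₀ : ℂ → ℂ := fun g => (∏ k ∈ (headIdx N).erase (0, 0),
    (1 - nome (-(2 * g)) * nomePow η τ k)) * tailPoch η τ N (nome (-(2 * g))) /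
      doublePoch η τ (nome τ * nome (2 * η) * (nome (-(2 * g)))⁻¹) with hκ₀
  have hκ : ∀ g, (eGamma η τ (-(2 * g)))⁻¹ = (1 - nome (-(2 * g))) * κ₀ g := fun g => by
    rw [eGamma_inv hη hτ, doublePoch_eq_prod_mul_tailPoch hη hτ N, ← Finset.mul_prod_erase _ _ h00]
    simp only [hκ₀, nomePow, pow_zero, mul_one]
    ring
  have hκ₀c : ContinuousAt κ₀ 0 := by
    have c1 := differentiable_nome.continuous
    have c2 := (differentiable_tailPoch hη hτ N).continuous
    have c3 := (differentiable_doublePoch_inv_nome hη hτ).continuous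
    have c4 : Continuous fun g : ℂ =>
        doublePoch η τ (nome τ * nome (2 * η) * (nome (-(2 * g)))⁻¹) :=
      c3.comp (by fun_prop : Continuous fun g : ℂ => -(2 * g))
    refine ContinuousAt.div (Continuous.continuousAt (by fun_prop)) c4.continuousAt ?_
    rw [mul_zero, neg_zero, nome_zero, inv_one, mul_one, ← nome_add]
    refine doublePoch_ne_zero hη hτ (norm_nome_lt_one ?_)
    rw [add_im]; positivity
  have hκm : ∀ g, MeromorphicAt (fun g => (eGamma η τ (-(2 * g)))⁻¹) g := fun g =>
    ((meromorphicAt_eGamma hη hτ _).comp_analyticAt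
      (g := fun g : ℂ => -(2 * g)) (by fun_prop)).inv
  have hpole : ∀ i : Bool × (ℕ × ℕ), AnalyticAt ℂ Φ (poleShift η τ z i) := by
    rintro ⟨b, k⟩
    have h1 := hΦz (-(2 * k.2)) (-(2 * k.1))
    push_cast at h1
    cases b
    · convert h1.1 using 1; simp only [poleShift, cond_false]; ring
    · convert h1.2 using 1; simp only [poleShift, cond_true]; ring
  obtain ⟨G, hG1, hG2, hG3⟩ := exists_continuation_of_pinch (s := s) (β := poleShift η τ z)
    (h := regKernel η τ z N Φ) (c := 1) (i₁ := (false, (0, 0))) (i₂ := (true, (0, 0)))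
    hδ (periodic_regKernel hΦ.2.1) hd one_pos
    (regKernel_neg he) (by simp [hs, h00]) (by simp [hs, h00]) (by simp)
    (by simp [poleShift]) (fun i _ j _ => nome_poleShift_sub_eq_one hi hz i j)
    (fun i _ j _ => nome_poleShift_add_eq_one hi hz i j)
    (fun i _ g => meromorphicAt_regKernel hη hτ hΦ.1 _ g)
    (fun i his => by
      have h1 := (differentiableAt_regKernel_poleShift hη hτ hi hz hN
        (Finset.mem_product.mp his).2 (hpole i)).continuousAt
      have h2 : ContinuousAt (fun g : ℂ => (g, g + poleShift η τ z i)) 0 := by fun_prop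
      refine ContinuousAt.comp (g := Function.uncurry (regKernel η τ z N Φ)) (f := fun g : ℂ => (g, g + poleShift η τ z i)) ?_ h2
      rw [zero_add]
      exact h1) hκm hκ₀c hκ
  refine ⟨fun g => qPoch (nome (2 * η)) (nome (2 * η)) * qPoch (nome τ) (nome τ) / 2 * G g,
    fun g hg => (MeromorphicAt.const _ g).fun_mul (hG1 g hg), fun g hg => ?_, ?_⟩
  · have hg0 : g.im < 0 := by linarith [abs_nonneg z.im]
    dsimp only
    rw [hG2 g (hg0.trans one_pos) fun i _ => by
      rw [add_im]; linarith [poleShift_im_le hη hτ (z := z) i], intM_eq, lineInt_zero,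
      ← intervalIntegral.integral_const_mul]
    congr 1
    exact intervalIntegral.integral_congr fun x _ => (kernelM_mul_eq hη hτ N Φ g z x).symm
  · have h1 := hG3.const_mul (qPoch (nome (2 * η)) (nome (2 * η)) * qPoch (nome τ) (nome τ) / 2)
    have h2 := pinch_value hη hτ hz hN Φ
    have e1 : poleShift η τ z (false, (0, 0)) = z := by simp [poleShift]
    have e2 : (s.erase (false, (0, 0))).erase (true, (0, 0)) =
        Finset.univ ×ˢ (headIdx N).erase (0, 0) := by
      ext ⟨b, k⟩
      cases b <;> simp [hs]
    have e3 : κ₀ 0 = (∏ k ∈ (headIdx N).erase (0, 0), (1 - 1 * nomePow η τ k)) *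
        tailPoch η τ N 1 / doublePoch η τ (nome τ * nome (2 * η)) := by
      simp only [hκ₀, mul_zero, neg_zero, nome_zero, inv_one, mul_one]
    rw [e1, e2, e3, h2] at h1
    exact h1

end

/-! ### Iterated contiguity relations -/

section

variable {η τ z : ℂ}

lemma OffLattice.swap (hz : OffLattice η τ z) : OffLattice (τ / 2) (2 * η) z := fun a b c h => by
  refine hz b a c ?_
  rw [h]; ring

lemma OffLattice.theta1_ne_zero (hτ : 0 < τ.im) (hz : OffLattice η τ z) :
    theta1 (2 * z) τ ≠ 0 := fun h => by
  obtain ⟨a, b, hab⟩ := theta1_eq_zero hτ h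
  refine hz 0 b a ?_
  push_cast
  linear_combination hab / 2

lemma iterA_congr {f f' : ℂ → ℂ} (hη : η ≠ 0) (τ : ℂ) (ϑ : ℂ → ℂ → ℂ) (g : ℂ) (n : ℕ)
    (hf : ∀ a : ℤ, |a| ≤ n → f (z + a * η) = f' (z + a * η)) :
    iterA η τ ϑ g n f z = iterA η τ ϑ g n f' z := by
  induction n generalizing z with
  | zero => simpa [iterA] using hf 0
  | succ n ih =>
    rw [iterA, iterA, opA_apply hη, opA_apply hη, ih, ih]
    · intro a ha
      have := hf (a - 1) (by push_cast; rw [abs_le] at ha ⊢; constructor <;> linarith)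
      rw [show z - η + a * η = z + ((a - 1 : ℤ) : ℂ) * η by push_cast; ring]
      exact this
    · intro a ha
      have := hf (a + 1) (by push_cast; rw [abs_le] at ha ⊢; constructor <;> linarith)
      rw [show z + η + a * η = z + ((a + 1 : ℤ) : ℂ) * η by push_cast; ring]
      exact this

lemma abs_im_add_lt {z w η : ℂ} {n : ℕ} (hη : 0 < η.im) (h : |z.im| < -(w + n * η).im) {a : ℤ}
    (ha : |a| ≤ n) : |(z + a * η).im| < -w.im := by
  have e1 : (z + a * η).im = z.im + a * η.im := by simp
  have e2 : (w + n * η).im = w.im + n * η.im := by simp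
  rw [e2, abs_lt] at h
  rw [e1, abs_lt]
  rw [abs_le] at ha
  have h1 : (-n : ℝ) ≤ a := by exact_mod_cast ha.1
  have h2 : (a : ℝ) ≤ n := by exact_mod_cast ha.2
  constructor <;> nlinarith [h.1, h.2]

/-- Each step evaluates at z ± η with spin lowered by η; the convergence condition |Im z| < -Im g
loosens by just the Im η needed. -/
lemma intM_eq_iterA (hη : 0 < η.im) (hτ : 0 < τ.im) {ϑ : ℂ → ℂ → ℂ}
    (hϑ : ϑ = theta3 ∨ ϑ = theta4) {g : ℂ} (hx : ∀ x : ℝ, ϑ x (τ / 2) ≠ 0) {n : ℕ}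
    (hg : ∀ a < n, theta1 (2 * (g + a * η + η)) τ ≠ 0) (h : |z.im| < -(g + n * η).im)
    (hz : OffLattice η τ z) {Φ : ℂ → ℂ} (hΦ : Continuous fun x : ℝ => Φ x) :
    intM η τ (g + n * η) Φ z =
      iterA η τ ϑ g n (intM η τ g (fun x => (ϑ x (τ / 2) ^ n)⁻¹ * Φ x)) z := by
  have hη0 : η ≠ 0 := by rintro rfl; simp at hη
  induction n generalizing z Φ with
  | zero => simp [iterA]
  | succ n ih =>
    have hc : Continuous fun x : ℝ => (ϑ x (τ / 2))⁻¹ * Φ x :=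
      (((differentiable_vartheta hϑ (half_im_pos hτ)).continuous.comp continuous_ofReal).inv₀
        hx).mul hΦ
    have e : g + (n + 1 : ℕ) * η = g + n * η + η := by push_cast; ring
    rw [e] at h ⊢
    rw [intM_contiguity hη hτ hϑ h (hz.theta1_ne_zero hτ) (hg n n.lt_succ_self) hx hΦ, iterA]
    have h1 : |z.im| < -((g + n * η) + (1 : ℕ) * η).im := by simpa using h
    have key : ∀ a : ℤ, |a| ≤ (1 : ℕ) →
        intM η τ (g + n * η) (fun x => (ϑ x (τ / 2))⁻¹ * Φ x) (z + a * η) = 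
        iterA η τ ϑ g n (intM η τ g (fun x => (ϑ x (τ / 2) ^ (n + 1))⁻¹ * Φ x)) (z + a * η) := by
      intro a ha
      have hz' := hz.add a 0
      rw [Int.cast_zero, zero_mul, add_zero] at hz'
      rw [ih (fun a ha => hg a (ha.trans n.lt_succ_self)) (abs_im_add_lt hη h1 ha) hz' hc]
      refine congrArg (fun F => iterA η τ ϑ g n (intM η τ g F) (z + a * η)) (funext fun x => ?_)
      rw [pow_succ, mul_inv, mul_assoc]
    have k1 := key 1 (by simp)
    have k2 := key (-1) (by simp)
    simp only [Int.cast_one, one_mul, Int.cast_neg, neg_mul, ← sub_eq_add_neg] at k1 k2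
    rw [opA_apply hη0, opA_apply hη0, k1, k2]

lemma intM_eq_iterA_iterB (hη : 0 < η.im) (hτ : 0 < τ.im) {ϑ : ℂ → ℂ → ℂ}
    (hϑ : ϑ = theta3 ∨ ϑ = theta4) {g : ℂ} (hx : ∀ x : ℝ, ϑ x (τ / 2) ≠ 0)
    (hx' : ∀ x : ℝ, ϑ x η ≠ 0) {n m : ℕ}
    (hg : ∀ a < n, theta1 (2 * (g + m * (τ / 2) + a * η + η)) τ ≠ 0)
    (hg' : ∀ b < m, theta1 (2 * (g + b * (τ / 2) + τ / 2)) (2 * η) ≠ 0)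
    (h : |z.im| < -(g + m * (τ / 2) + n * η).im)
    (hz : OffLattice η τ z) {Φ : ℂ → ℂ} (hΦ : Continuous fun x : ℝ => Φ x) :
    intM η τ (g + m * (τ / 2) + n * η) Φ z =
      iterA η τ ϑ (g + m * (τ / 2)) n (iterB η τ ϑ g m
        (intM η τ g (fun x => (ϑ x η ^ m)⁻¹ * (ϑ x (τ / 2) ^ n)⁻¹ * Φ x))) z := by
  have hη0 : η ≠ 0 := by rintro rfl; simp at hη
  have h2 : 2 * η / 2 = η := mul_div_cancel_left₀ η (two_ne_zero' ℂ)
  have hc : Continuous fun x : ℝ => (ϑ x (τ / 2) ^ n)⁻¹ * Φ x :=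
    ((((differentiable_vartheta hϑ (half_im_pos hτ)).continuous.comp continuous_ofReal).pow n).inv₀
      fun x => pow_ne_zero n (hx x)).mul hΦ
  rw [intM_eq_iterA hη hτ hϑ hx hg h hz hΦ]
  refine iterA_congr hη0 τ ϑ _ n fun a ha => ?_
  have hz' := hz.add a 0
  rw [Int.cast_zero, zero_mul, add_zero] at hz'
  have key := intM_eq_iterA (η := τ / 2) (τ := 2 * η) (half_im_pos hτ) (two_mul_im_pos hη) hϑ
    (g := g) (by rwa [h2]) (n := m) hg' (abs_im_add_lt hη h ha) hz'.swap
    (Φ := fun x => (ϑ x (τ / 2) ^ n)⁻¹ * Φ x) hc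
  rw [intM_swap, h2] at key
  rw [key, iterB_eq]
  refine congrArg (fun F => iterA _ _ ϑ g m F (z + a * η)) (funext fun w => ?_)
  rw [intM_swap]
  exact congrArg (fun F => intM η τ g F w) (funext fun x => by rw [mul_assoc])

/-! ### Dependence of the difference operators on the spin -/

/-- The spin enters only through theta functions in the numerators; the denominators depend on z
alone. -/
lemma meromorphicAt_iterA (hη : 0 < η.im) (hτ : 0 < τ.im) {ϑ : ℂ → ℂ → ℂ}
    (hϑ : ϑ = theta3 ∨ ϑ = theta4) {f : ℂ → ℂ → ℂ} (a g₀ : ℂ) (n : ℕ)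
    (hf : ∀ k : ℤ, MeromorphicAt (fun g => f g (z + k * η)) g₀) :
    MeromorphicAt (fun g => iterA η τ ϑ (g + a) n (f g) z) g₀ := by
  have hη0 : η ≠ 0 := by rintro rfl; simp at hη
  have hθ := differentiable_vartheta hϑ (half_im_pos hτ)
  induction n generalizing z with
  | zero => simpa [iterA] using hf 0
  | succ n ih =>
    simp only [iterA, opA_apply hη0]
    have h1 := ih (z := z + η) fun k => by
      have := hf (k + 1)
      push_cast at this
      rwa [show z + (k + 1) * η = z + η + k * η by ring] at this
    have h2 := ih (z := z - η) fun k => by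
      have := hf (k - 1)
      push_cast at this
      rwa [show z + (k - 1) * η = z - η + k * η by ring] at this
    have d1 : Differentiable ℂ fun g => ϑ (z + (g + a + n * η) + η) (τ / 2) :=
      hθ.comp (g := fun z => ϑ z (τ / 2)) (f := fun g => z + (g + a + n * η) + η) (by fun_prop)
    have d2 : Differentiable ℂ fun g => ϑ (z - (g + a + n * η) - η) (τ / 2) :=
      hθ.comp (g := fun z => ϑ z (τ / 2)) (f := fun g => z - (g + a + n * η) - η) (by fun_prop)
    exact (MeromorphicAt.const _ _).fun_mul
      (((d1.analyticAt g₀).meromorphicAt.fun_mul ((MeromorphicAt.const _ _).fun_mul h1)).fun_sub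
      ((d2.analyticAt g₀).meromorphicAt.fun_mul ((MeromorphicAt.const _ _).fun_mul h2)))

lemma tendsto_iterA (hη : 0 < η.im) (hτ : 0 < τ.im) {ϑ : ℂ → ℂ → ℂ}
    (hϑ : ϑ = theta3 ∨ ϑ = theta4) {f : ℂ → ℂ → ℂ} {f₀ : ℂ → ℂ} (a : ℂ) (n : ℕ)
    (hf : ∀ k : ℤ, Tendsto (fun g => f g (z + k * η)) (𝓝[≠] 0) (𝓝 (f₀ (z + k * η)))) :
    Tendsto (fun g => iterA η τ ϑ (g + a) n (f g) z) (𝓝[≠] 0) (𝓝 (iterA η τ ϑ a n f₀ z)) := by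
  have hη0 : η ≠ 0 := by rintro rfl; simp at hη
  have hθ := (differentiable_vartheta hϑ (half_im_pos hτ)).continuous
  induction n generalizing z with
  | zero => simpa [iterA] using hf 0
  | succ n ih =>
    simp only [iterA, opA_apply hη0]
    have h1 := ih (z := z + η) fun k => by
      have := hf (k + 1)
      push_cast at this
      rwa [show z + (k + 1) * η = z + η + k * η by ring] at this
    have h2 := ih (z := z - η) fun k => by
      have := hf (k - 1)
      push_cast at this
      rwa [show z + (k - 1) * η = z - η + k * η by ring] at this
    have d1 : Tendsto (fun g => ϑ (z + (g + a + n * η) + η) (τ / 2)) (𝓝[≠] 0)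
        (𝓝 (ϑ (z + (a + n * η) + η) (τ / 2))) :=
      ((hθ.comp (by fun_prop : Continuous fun g => z + (g + a + n * η) + η)).tendsto' 0 _
        (by simp)).mono_left nhdsWithin_le_nhds
    have d2 : Tendsto (fun g => ϑ (z - (g + a + n * η) - η) (τ / 2)) (𝓝[≠] 0)
        (𝓝 (ϑ (z - (a + n * η) - η) (τ / 2))) :=
      ((hθ.comp (by fun_prop : Continuous fun g => z - (g + a + n * η) - η)).tendsto' 0 _
        (by simp)).mono_left nhdsWithin_le_nhds
    exact ((d1.mul (h1.const_mul _)).sub (d2.mul (h2.const_mul _))).const_mul _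

lemma differentiable_theta1 (hτ : 0 < τ.im) : Differentiable ℂ fun u => theta1 u τ := by
  simp only [theta1_eq]
  intro u
  have h : DifferentiableAt ℂ (fun u : ℂ => u + 1 / 2 + τ / 2) u := by fun_prop
  have := (differentiableAt_jacobiTheta₂_fst (u + 1 / 2 + τ / 2) hτ).comp u h
  exact (DifferentiableAt.mul (by fun_prop) this).neg

lemma eventually_theta1_ne_zero (hτ : 0 < τ.im) (c g₀ : ℂ) :
    ∀ᶠ g in 𝓝[≠] g₀, theta1 (2 * (g + c)) τ ≠ 0 := by
  have hd : Differentiable ℂ fun g => theta1 (2 * (g + c)) τ :=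
    (differentiable_theta1 hτ).comp (by fun_prop : Differentiable ℂ fun g => 2 * (g + c))
  rcases (hd.analyticAt g₀).eventually_eq_zero_or_eventually_ne_zero with h | h
  · exfalso
    have han : AnalyticOnNhd ℂ (fun g => theta1 (2 * (g + c)) τ) Set.univ := fun g _ =>
      hd.analyticAt g
    -- At g = 1/4 - c the argument is 1/2, which is not a zero of θ₁.
    have h0 := han.eqOn_zero_of_preconnected_of_eventuallyEq_zero isPreconnected_univ
      (Set.mem_univ g₀) h (Set.mem_univ (1 / 4 - c))
    obtain ⟨a, b, hab⟩ := theta1_eq_zero hτ h0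
    have him := congrArg im hab
    have hre := congrArg re hab
    have hb : (b : ℝ) = 0 := by
      simp at him
      exact_mod_cast him.resolve_right hτ.ne'
    have hb' : b = 0 := by exact_mod_cast hb
    rw [hb'] at hre
    norm_num at hre
    have h4 : (2 * a : ℝ) = 1 := by linarith
    have h5 : 2 * a = 1 := by exact_mod_cast h4
    omega
  · exact h

end

/-! ### Test functions -/

lemma IsTestFunction.continuous {Φ : ℂ → ℂ} (hΦ : IsTestFunction Φ) : Continuous fun x : ℝ => Φ x :=
  continuous_iff_continuousAt.mpr fun x =>
    (hΦ.2.2 x).continuousAt.comp (f := fun x : ℝ => (x : ℂ)) continuous_ofReal.continuousAt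

lemma analyticAt_comp_neg {Φ : ℂ → ℂ} {x : ℂ} (h : AnalyticAt ℂ Φ (-x)) :
    AnalyticAt ℂ (fun x => Φ (-x)) x :=
  AnalyticAt.fun_comp (g := Φ) (f := fun x => -x) h (by fun_prop)

lemma analyticAt_comp_add {Φ : ℂ → ℂ} {x c : ℂ} (h : AnalyticAt ℂ Φ (x + c)) :
    AnalyticAt ℂ (fun x => Φ (x + c)) x :=
  AnalyticAt.fun_comp (g := Φ) (f := fun x => x + c) h (by fun_prop)

lemma IsTestFunction.comp_add_half {Φ : ℂ → ℂ} (hΦ : IsTestFunction Φ) :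
    IsTestFunction fun x => Φ (x + 1 / 2) := by
  refine ⟨fun x => (hΦ.1 (x + 1 / 2)).comp_analyticAt (f := Φ) (g := fun x => x + 1 / 2)
    (by fun_prop), fun x => ?_, fun x => analyticAt_comp_add ?_⟩
  · dsimp only
    rw [add_right_comm, hΦ.2.1]
  · have := hΦ.2.2 (x + 1 / 2)
    push_cast at this
    exact this

lemma IsTestFunction.evenPart {Φ : ℂ → ℂ} (hΦ : IsTestFunction Φ) :
    IsTestFunction fun x => (Φ x + Φ (-x)) / 2 := by
  refine ⟨fun x => ?_, fun x => ?_, fun x => ?_⟩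
  · have h1 : MeromorphicAt (fun x => Φ (-x)) x :=
      (hΦ.1 (-x)).comp_analyticAt (f := Φ) (g := fun x => -x) (by fun_prop)
    exact ((hΦ.1 x).fun_add h1).fun_div (MeromorphicAt.const 2 x)
  · dsimp only
    rw [hΦ.2.1, neg_add, ← sub_eq_add_neg, hΦ.2.1.sub_eq]
  · have h1 := hΦ.2.2 (-x)
    push_cast at h1
    exact ((hΦ.2.2 x).fun_add (analyticAt_comp_neg h1)).fun_div analyticAt_const two_ne_zero

lemma intM_evenPart {η τ : ℂ} (hη : 0 < η.im) (hτ : 0 < τ.im) {g z : ℂ} (h : |z.im| < -g.im)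
    {Φ : ℂ → ℂ} (hΦ : IsTestFunction Φ) :
    intM η τ g (fun x => (Φ x + Φ (-x)) / 2) z = intM η τ g Φ z := by
  have h1 := intM_comp_neg η τ g hΦ.2.1 z
  have hK := continuous_kernelM hη hτ h
  have hc := hΦ.continuous
  have hc' : Continuous fun x : ℝ => Φ (-x) := by
    have := hc.comp continuous_neg
    simpa [Function.comp_def] using this
  have i1 : IntervalIntegrable (fun x : ℝ => kernelM η τ g z x * Φ x) MeasureTheory.volume 0 1 :=
    (hK.mul hc).intervalIntegrable _ _
  have i2 : IntervalIntegrable (fun x : ℝ => kernelM η τ g z x * Φ (-x)) MeasureTheory.volume 0 1 :=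
    (hK.mul hc').intervalIntegrable _ _
  have h2 : ∫ x in (0 : ℝ)..1, kernelM η τ g z x * ((Φ x + Φ (-x)) / 2) =
      ((∫ x in (0 : ℝ)..1, kernelM η τ g z x * Φ x) +
        ∫ x in (0 : ℝ)..1, kernelM η τ g z x * Φ (-x)) / 2 := by
    rw [← intervalIntegral.integral_add i1 i2, ← intervalIntegral.integral_div]
    exact intervalIntegral.integral_congr fun x _ => by ring
  rw [intM_eq, intM_eq] at h1
  rw [intM_eq, intM_eq, h2]
  linear_combination h1 / 2

section

variable {η τ z s : ℂ} (hη : 0 < η.im) (hτ : 0 < τ.im)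
include hη hτ

lemma exists_continuation (hs : s = 0 ∨ s = 1 / 2) (hi : Incommensurate η τ)
    (hz : OffLattice η τ z) {Φ : ℂ → ℂ} (hΦ : IsTestFunction Φ) (he : ∀ x, Φ (-x) = Φ x)
    (hΦz : ∀ a b : ℤ, AnalyticAt ℂ Φ (z + s + a * η + b * (τ / 2)) ∧
      AnalyticAt ℂ Φ (-z + s + a * η + b * (τ / 2))) :
    ∃ F : ℂ → ℂ, MeromorphicOn F {g | g.im < 1} ∧
      (∀ g : ℂ, |z.im| < -g.im → F g = intM η τ (g + s) Φ z) ∧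
        Tendsto F (𝓝[≠] 0) (𝓝 (Φ (z + s))) := by
  rcases hs with rfl | rfl
  · simp only [add_zero] at hΦz ⊢
    exact exists_continuation_zero hη hτ hi hz hΦ he hΦz
  · simp only [intM_add_half η τ _ hΦ.2.1]
    refine exists_continuation_zero hη hτ hi hz hΦ.comp_add_half (fun x => ?_) fun a b => ?_
    · rw [← he, ← hΦ.2.1]
      congr 1; ring
    · refine ⟨analyticAt_comp_add ?_, analyticAt_comp_add ?_⟩
      · convert (hΦz a b).1 using 1; ring
      · convert (hΦz a b).2 using 1; ring

/-- The continued integral operator agrees with the difference operator on even functions. -/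
theorem hasMValue_opM (hs : s = 0 ∨ s = 1 / 2) (hi : Incommensurate η τ) (hz : OffLattice η τ z)
    {ϑ : ℂ → ℂ → ℂ} (hϑ : ϑ = theta3 ∨ ϑ = theta4) (hx : ∀ x : ℝ, ϑ x (τ / 2) ≠ 0 ∧ ϑ x η ≠ 0)
    (hϑz : ∀ w, (w = z ∨ w = -z) → ∀ a b : ℤ, ϑ (w + s + a * η + b * (τ / 2)) (τ / 2) ≠ 0 ∧
      ϑ (w + s + a * η + b * (τ / 2)) η ≠ 0)
    {f : ℂ → ℂ} (hf : IsTestFunction f) (he : ∀ x, f (-x) = f x)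
    (hfz : ∀ w, (w = z ∨ w = -z) → ∀ a b : ℤ, AnalyticAt ℂ f (w + s + a * η + b * (τ / 2)))
    (n m : ℕ) :
    HasMValue η τ (s + n * η + m * (τ / 2)) f z (opM η τ ϑ s n m f z) := by
  have hη0 : η ≠ 0 := by rintro rfl; simp at hη
  have hτ0 : τ / 2 ≠ 0 := fun h => by have := half_im_pos hτ; rw [h] at this; simp at this
  have hs0 : s.im = 0 := by rcases hs with rfl | rfl <;> simp
  have hd1 := differentiable_vartheta hϑ (half_im_pos hτ)
  have hd2 := differentiable_vartheta hϑ hη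
  set Φ : ℂ → ℂ := fun x => (ϑ x η ^ m)⁻¹ * (ϑ x (τ / 2) ^ n)⁻¹ * f x with hΦdef
  have han : ∀ x, ϑ x (τ / 2) ≠ 0 ∧ ϑ x η ≠ 0 → AnalyticAt ℂ f x → AnalyticAt ℂ Φ x :=
    fun x h1 h2 => ((((hd2.analyticAt x).fun_pow m).fun_inv (pow_ne_zero m h1.2)).fun_mul
      (((hd1.analyticAt x).fun_pow n).fun_inv (pow_ne_zero n h1.1))).fun_mul h2
  have hΦ : IsTestFunction Φ := by
    refine ⟨fun x => ?_, fun x => ?_, fun x => han x (hx x) (hf.2.2 x)⟩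
    · exact (((hd2.analyticAt x).fun_pow m).meromorphicAt.fun_inv.fun_mul
        ((hd1.analyticAt x).fun_pow n).meromorphicAt.fun_inv).fun_mul (hf.1 x)
    · simp only [hΦdef, vartheta_add_one hϑ, hf.2.1 x]
  have heΦ : ∀ x, Φ (-x) = Φ x := fun x => by simp only [hΦdef, vartheta_neg hϑ, he]
  -- The points where the continuation to spin s is available; the orbit of z under shifts by η and
  -- τ/2 lies in this set.
  set P : ℂ → Prop := fun w => OffLattice η τ w ∧ ∀ a b : ℤ,
    AnalyticAt ℂ Φ (w + s + a * η + b * (τ / 2)) ∧ AnalyticAt ℂ Φ (-w + s + a * η + b * (τ / 2))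
    with hP
  have hPz : ∀ a b : ℤ, P (z + a * η + b * (τ / 2)) := fun a b => by
    refine ⟨hz.add a b, fun a' b' => ⟨?_, ?_⟩⟩
    · have h1 := han _ (hϑz z (Or.inl rfl) (a + a') (b + b')) (hfz z (Or.inl rfl) (a + a') (b + b'))
      convert h1 using 1; push_cast; ring
    · have h1 := han _ (hϑz (-z) (Or.inr rfl) (a' - a) (b' - b))
        (hfz (-z) (Or.inr rfl) (a' - a) (b' - b))
      convert h1 using 1; push_cast; ring
  have hex : ∀ w, P w → ∃ F : ℂ → ℂ, MeromorphicOn F {g | g.im < 1} ∧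
      (∀ g : ℂ, |w.im| < -g.im → F g = intM η τ (g + s) Φ w) ∧
        Tendsto F (𝓝[≠] 0) (𝓝 (Φ (w + s))) := fun w hw =>
    exists_continuation hη hτ hs hi hw.1 hΦ heΦ hw.2
  choose! F hF1 hF2 hF3 using hex
  -- The candidate: the difference operators, with spins shifted by g, applied to the continuation
  -- of M(g+s)Φ, so that g = 0 corresponds to the spin g₀.
  set Fc : ℂ → ℂ := fun g => iterA η τ ϑ (g + (s + m * (τ / 2))) n
    (iterB η τ ϑ (g + s) m (fun w => F w g)) z with hFc
  set g₀ := s + n * η + m * (τ / 2) with hg₀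
  have hFcm : ∀ g : ℂ, g.im < 1 → MeromorphicAt Fc g := fun g hg => by
    refine meromorphicAt_iterA hη hτ hϑ _ g n fun k => ?_
    simp only [iterB_eq]
    exact meromorphicAt_iterA (half_im_pos hτ) (two_mul_im_pos hη) hϑ (f := fun g w => F w g) _ g m
      fun l => hF1 _ (hPz k l) g hg
  have hFct : Tendsto Fc (𝓝[≠] 0) (𝓝 (opM η τ ϑ s n m f z)) := by
    refine tendsto_iterA hη hτ hϑ (s + m * (τ / 2)) n fun k => ?_
    simp only [iterB_eq]
    exact tendsto_iterA (half_im_pos hτ) (two_mul_im_pos hη) hϑ (f := fun g w => F w g)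
      (f₀ := fun w => Φ (w + s)) s m fun l => hF3 _ (hPz k l)
  -- Contiguity requires θ₁ at certain spins to be nonzero, so the candidate may differ from the
  -- integral at isolated spins. Patching in the integral gives equality on the whole half-plane
  -- without affecting meromorphy.
  set G : ℂ → ℂ := fun g => if |z.im| < -g.im then intM η τ g f z else Fc (g - g₀) with hG
  have hev : ∀ g₁ : ℂ, ∀ᶠ g in 𝓝[≠] g₁, Fc (g - g₀) = G g := fun g₁ => by
    have ev1 : ∀ᶠ g in 𝓝[≠] g₁, ∀ a ∈ Finset.range n,
        theta1 (2 * (g - g₀ + s + m * (τ / 2) + a * η + η)) τ ≠ 0 :=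
      (Filter.eventually_all_finset _).mpr fun a _ =>
        (eventually_theta1_ne_zero hτ (-g₀ + s + m * (τ / 2) + a * η + η) g₁).mono fun g hg => by
          convert hg using 3; ring
    have ev2 : ∀ᶠ g in 𝓝[≠] g₁, ∀ b ∈ Finset.range m,
        theta1 (2 * (g - g₀ + s + b * (τ / 2) + τ / 2)) (2 * η) ≠ 0 :=
      (Filter.eventually_all_finset _).mpr fun b _ =>
        (eventually_theta1_ne_zero (two_mul_im_pos hη) (-g₀ + s + b * (τ / 2) + τ / 2) g₁).mono
          fun g hg => by convert hg using 3; ring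
    filter_upwards [ev1, ev2] with g h1 h2
    simp only [hG]
    split_ifs with hreg
    · set u := g - g₀ with hu
      have hgu : g = u + s + m * (τ / 2) + n * η := by rw [hu, hg₀]; ring
      rw [hgu] at hreg ⊢
      rw [intM_eq_iterA_iterB hη hτ hϑ (fun x => (hx x).1) (fun x => (hx x).2)
        (fun a ha => h1 a (Finset.mem_range.mpr ha)) (fun b hb => h2 b (Finset.mem_range.mpr hb))
        hreg hz hf.continuous]
      simp only [hFc]
      rw [← add_assoc]
      refine iterA_congr hη0 τ ϑ _ n fun a ha => ?_
      rw [iterB_eq, iterB_eq]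
      refine iterA_congr hτ0 _ ϑ _ m fun b hb => ?_
      have hreg' := abs_im_add_lt (half_im_pos hτ) (abs_im_add_lt hη hreg ha) hb
      rw [add_im u s, hs0, add_zero] at hreg'
      exact hF2 _ (hPz a b) u hreg'
    · rfl
  refine ⟨1 + g₀.im, G, by linarith, fun g hg => ?_, fun g h1 h2 => ?_, ?_⟩
  · have h1 : (g - g₀).im < 1 := by
      rw [sub_im]
      have : g.im < 1 + g₀.im := hg
      linarith
    exact ((hFcm _ h1).comp_analyticAt (g := fun g => g - g₀) (by fun_prop)).congr (hev g)
  · simp only [hG]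
    rw [if_pos (abs_im_lt_iff.mpr ⟨h1, h2⟩)]
  · have ht : Tendsto (fun g => g - g₀) (𝓝[≠] g₀) (𝓝[≠] 0) := by
      refine tendsto_nhdsWithin_iff.mpr ⟨?_, ?_⟩
      · exact ((by fun_prop : Continuous fun g => g - g₀).tendsto' g₀ 0 (sub_self _)).mono_left
          nhdsWithin_le_nhds
      · filter_upwards [self_mem_nhdsWithin] with g hg
        exact sub_ne_zero.mpr hg
    exact (hFct.comp ht).congr' (hev g₀)

end

/-! ### Zeros of the theta functions -/

section

variable {η τ z s : ℂ}

lemma vartheta_ofReal_ne_zero {ω : ℂ} (hω : 0 < ω.im) {ϑ : ℂ → ℂ → ℂ}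
    (hϑ : ϑ = theta3 ∨ ϑ = theta4) (x : ℝ) : ϑ x ω ≠ 0 := fun h => by
  have key : ∀ y : ℝ, jacobiTheta₂ y ω ≠ 0 := fun y h => by
    obtain ⟨a, b, hab⟩ := jacobiTheta₂_eq_zero hω h
    have him := congrArg im hab
    have e : (a + 1 / 2 + b * ω + ω / 2 : ℂ).im = b * ω.im + ω.im / 2 := by simp
    rw [e, ofReal_im] at him
    have h1 : (2 * b + 1 : ℝ) * ω.im = 0 := by linarith
    have h2 : (2 * b + 1 : ℝ) = 0 := (mul_eq_zero.mp h1).resolve_right hω.ne'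
    have h3 : 2 * b + 1 = 0 := by exact_mod_cast h2
    omega
  rcases hϑ with rfl | rfl
  · rw [theta3_eq] at h; exact key x h
  · rw [theta4_eq] at h
    refine key (x + 1 / 2) ?_
    push_cast
    exact h

variable (hη : 0 < η.im) (hτ : 0 < τ.im)
include hη hτ

/-- Multiplication by 4 clears denominators: zeros for either nome put 4z in one class modulo 4ℤ +
τℤ + 2ηℤ. The class is stable under z ↦ -z because 4e and 4s are 0 or 2. For e = 0 and e = 1/2, that
is θ₃ and θ₄, the classes differ by 2. -/
lemma jacobiTheta₂_lattice_zero {e u w : ℂ} (he : e = 0 ∨ e = 1 / 2) (hs : s = 0 ∨ s = 1 / 2)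
    (hw : w = z ∨ w = -z) {a b : ℤ} (hu : u = w + s + a * η + b * (τ / 2))
    (h : jacobiTheta₂ (u + e) (τ / 2) = 0 ∨ jacobiTheta₂ (u + e) η = 0) :
    ∃ k A B : ℤ, 4 * z = 2 - 4 * e - 4 * s + 4 * k + A * τ + B * (2 * η) := by
  have hpos : ∃ k A B : ℤ, 4 * w = 2 - 4 * e - 4 * s + 4 * k + A * τ + B * (2 * η) := by
    rcases h with h | h
    · obtain ⟨c, d, hcd⟩ := jacobiTheta₂_eq_zero (half_im_pos hτ) h
      refine ⟨c, 2 * d + 1 - 2 * b, -2 * a, ?_⟩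
      rw [hu] at hcd
      push_cast
      linear_combination 4 * hcd
    · obtain ⟨c, d, hcd⟩ := jacobiTheta₂_eq_zero hη h
      refine ⟨c, -2 * b, 2 * d + 1 - 2 * a, ?_⟩
      rw [hu] at hcd
      push_cast
      linear_combination 4 * hcd
  rcases hw with rfl | rfl
  · exact hpos
  · obtain ⟨k, A, B, h1⟩ := hpos
    rcases he with rfl | rfl <;> rcases hs with rfl | rfl
    · exact ⟨-k - 1, -A, -B, by push_cast; linear_combination -h1⟩
    · exact ⟨-k, -A, -B, by push_cast; linear_combination -h1⟩
    · exact ⟨-k, -A, -B, by push_cast; linear_combination -h1⟩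
    · exact ⟨-k + 1, -A, -B, by push_cast; linear_combination -h1⟩

/-- One of `θ₃`, `θ₄` has no zeros on the orbit of `z`. -/
lemma exists_vartheta_ne_zero (hi : Incommensurate η τ) (hs : s = 0 ∨ s = 1 / 2) (z : ℂ) :
    ∃ ϑ : ℂ → ℂ → ℂ, (ϑ = theta3 ∨ ϑ = theta4) ∧ ∀ w, (w = z ∨ w = -z) → ∀ a b : ℤ,
      ϑ (w + s + a * η + b * (τ / 2)) (τ / 2) ≠ 0 ∧ ϑ (w + s + a * η + b * (τ / 2)) η ≠ 0 := by
  by_contra hcon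
  have h3 : ∃ k A B : ℤ, 4 * z = 2 - 4 * 0 - 4 * s + 4 * k + A * τ + B * (2 * η) := by
    by_contra h
    refine hcon ⟨theta3, Or.inl rfl, fun w hw a b => ?_⟩
    rw [theta3_eq, theta3_eq, ← not_or]
    refine fun h0 => h (jacobiTheta₂_lattice_zero hη hτ (Or.inl rfl) hs hw (a := a) (b := b) rfl ?_)
    simpa only [add_zero] using h0
  have h4 : ∃ k A B : ℤ, 4 * z = 2 - 4 * (1 / 2) - 4 * s + 4 * k + A * τ + B * (2 * η) := by
    by_contra h
    refine hcon ⟨theta4, Or.inr rfl, fun w hw a b => ?_⟩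
    rw [theta4_eq, theta4_eq, ← not_or]
    exact fun h0 => h (jacobiTheta₂_lattice_zero hη hτ (Or.inr rfl) hs hw (a := a) (b := b) rfl h0)
  obtain ⟨k, A, B, h3⟩ := h3
  obtain ⟨k', A', B', h4⟩ := h4
  -- If both thetas had zeros on the orbit, subtracting the two relations would force 2 + 4(k - k')
  -- = 0.
  have := (hi (2 + 4 * k - 4 * k') (B - B') (A - A') (by
    push_cast; linear_combination h4 - h3)).1
  omega

lemma OffLattice.regular (hz : OffLattice η τ z) {ϑ : ℂ → ℂ → ℂ}
    (hϑz : ∀ a b : ℤ, ϑ (z + s + a * η + b * (τ / 2)) (τ / 2) ≠ 0 ∧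
      ϑ (z + s + a * η + b * (τ / 2)) η ≠ 0) (n m : ℕ) : Regular η τ ϑ s n m z := by
  refine ⟨fun a _ => ?_, fun a b _ _ => ?_, fun a b _ _ => ?_⟩
  · have := (hz.add a 0).theta1_ne_zero hτ
    rwa [Int.cast_zero, zero_mul, add_zero] at this
  · exact (hz.add a b).swap.theta1_ne_zero (two_mul_im_pos hη)
  · exact mul_ne_zero (pow_ne_zero _ (hϑz a b).2) (pow_ne_zero _ (hϑz a b).1)

/-- A test function whose even part is annihilated by the difference operators is annihilated by
the continued integral operator. -/
theorem intKills_of_diffKills (hi : Incommensurate η τ) (hs : s = 0 ∨ s = 1 / 2) {n m : ℕ}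
    {f : ℂ → ℂ} (hf : IsTestFunction f)
    (hD : DiffKills η τ s n m fun x => (f x + f (-x)) / 2) :
    IntKills η τ (s + n * η + m * (τ / 2)) f := by
  intro z (hz : OffLattice η τ z) hfz
  obtain ⟨ϑ, hϑ, hϑz⟩ := exists_vartheta_ne_zero hη hτ hi hs z
  have hf1 : ∀ w, (w = z ∨ w = -z) → ∀ a b : ℤ, AnalyticAt ℂ f (w + s + a * η + b * (τ / 2)) := by
    intro w hw a b
    have h1 := hfz (a - n) (b - m)
    rcases hw with rfl | rfl
    · convert h1.1 using 1; push_cast; ring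
    · convert h1.2 using 1; push_cast; ring
  -- Negation sends the orbit of z + s to that of -z - s; the period 2s brings it back to -z + s,
  -- where analyticity is known.
  have hp : Function.Periodic f (2 * s) := by
    rcases hs with rfl | rfl
    · intro x; simp
    · intro x; rw [mul_one_div_cancel two_ne_zero, hf.2.1]
  have hf2 : ∀ w, (w = z ∨ w = -z) → ∀ a b : ℤ,
      AnalyticAt ℂ (fun x => (f x + f (-x)) / 2) (w + s + a * η + b * (τ / 2)) := by
    intro w hw a b
    refine ((hf1 w hw a b).fun_add (analyticAt_comp_neg ?_)).fun_div analyticAt_const two_ne_zero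
    have h2 := hf1 (-w) (by rcases hw with rfl | rfl <;> simp) (-a) (-b)
    convert analyticAt_add_of_periodic hp h2 using 1
    push_cast; ring
  obtain ⟨c, F, hc, hF1, hF2, hF3⟩ := hasMValue_opM hη hτ hs hi hz hϑ
    (fun x => ⟨vartheta_ofReal_ne_zero (half_im_pos hτ) hϑ x, vartheta_ofReal_ne_zero hη hϑ x⟩)
    hϑz hf.evenPart (fun x => by rw [neg_neg, add_comm]) hf2 n m
  rw [hD ϑ hϑ z (hz.regular hη hτ (hϑz z (Or.inl rfl)) n m)] at hF3
  refine ⟨c, F, hc, hF1, fun g h1 h2 => ?_, hF3⟩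
  rw [hF2 g h1 h2, intM_evenPart hη hτ (abs_im_lt_iff.mpr ⟨h1, h2⟩) hf]

/-- Zero modes of the form `φ ψ`, with `φ` even and `ψ` in a class stable under even parts. -/
lemma isZeroMode_mul (hs : s = 0 ∨ s = 1 / 2) {n m : ℕ} {φ ψ : ℂ → ℂ} (hφ : ∀ x, φ (-x) = φ x)
    {C : (ℂ → ℂ) → Prop} (hC : ∀ ψ, C ψ → DiffKills η τ s n m fun z => φ z * ψ z)
    (hψ : C ψ) (hψ' : C fun x => (ψ x + ψ (-x)) / 2) :
    IsZeroMode η τ s n m fun z => φ z * ψ z := by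
  refine ⟨hC ψ hψ, fun hi hf => intKills_of_diffKills hη hτ hi hs hf ?_⟩
  have := hC _ hψ'
  convert this using 2 with x
  rw [hφ]; ring

end

lemma periodic_evenPart {ψ : ℂ → ℂ} {c : ℂ} (h : Function.Periodic ψ c) :
    Function.Periodic (fun x => (ψ x + ψ (-x)) / 2) c := fun x => by
  dsimp only
  rw [h, neg_add, ← sub_eq_add_neg, h.sub_eq]

/-! ### The products of theta functions as test functions -/

section

variable {η τ : ℂ}

lemma phi_neg (η τ : ℂ) (n m j l : ℕ) (z : ℂ) : phi η τ n m j l (-z) = phi η τ n m j l z := by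
  simp only [phi, vartheta_neg (Or.inl rfl : theta3 = theta3 ∨ theta3 = theta4),
    vartheta_neg (Or.inr rfl : theta4 = theta3 ∨ theta4 = theta4)]

lemma thetaDen_neg (ω z : ℂ) : thetaDen ω (-z) = thetaDen ω z := by
  have e : exp (2 * Real.pi * I * -z) = (exp (2 * Real.pi * I * z))⁻¹ := by
    rw [← exp_neg, mul_neg]
  simp only [thetaDen, e, inv_inv]
  ring

lemma thetaDen_add_one (ω z : ℂ) : thetaDen ω (z + 1) = thetaDen ω z := by
  have e : exp (2 * Real.pi * I * (z + 1)) = exp (2 * Real.pi * I * z) := by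
    change nome (z + 1) = nome z
    rw [nome_add, nome_one, mul_one]
  simp only [thetaDen, e]

/-- The zeros of θ(t;p) have modulus a power of |p|, and none lies strictly between 1 and 1/|p|. For
real z both arguments r^{-1/4}Z^{±1} have modulus |r|^{-1/4}, inside this annulus. -/
lemma mTheta_ne_zero_of_norm {p t : ℂ} (hp : ‖p‖ < 1) (h1 : 1 < ‖t‖)
    (h2 : ‖t‖ * ‖p‖ < 1) : mTheta t p ≠ 0 := by
  refine mul_ne_zero ?_ ?_
  · rw [Ne, qPoch_eq_zero_iff hp]
    rintro ⟨k, hk⟩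
    have hk' := congrArg norm hk
    rw [norm_mul, norm_pow, norm_one] at hk'
    rcases k with _ | k
    · rw [pow_zero, mul_one] at hk'; linarith
    · have := pow_le_one₀ (n := k) (norm_nonneg p) hp.le
      rw [pow_succ'] at hk'
      nlinarith [norm_nonneg p, norm_nonneg t, mul_nonneg (norm_nonneg t) (norm_nonneg p)]
  · rw [Ne, qPoch_eq_zero_iff hp]
    rintro ⟨k, hk⟩
    have hk' := congrArg norm hk
    rw [norm_mul, norm_mul, norm_pow, norm_one, norm_inv] at hk'
    have a1 := pow_le_one₀ (n := k) (norm_nonneg p) hp.le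
    have a2 : ‖t‖⁻¹ < 1 := inv_lt_one_of_one_lt₀ h1
    have a3 : 0 ≤ ‖t‖⁻¹ := by positivity
    have a4 : ‖p‖ * ‖t‖⁻¹ < 1 := by nlinarith [norm_nonneg p]
    have a5 : 0 ≤ ‖p‖ * ‖t‖⁻¹ := by positivity
    have a6 : 0 ≤ ‖p‖ ^ k := by positivity
    nlinarith

lemma thetaDen_ofReal_ne_zero {ω : ℂ} (hω : 0 < ω.im) (x : ℝ) : thetaDen ω x ≠ 0 := by
  have hn : ‖exp (-(Real.pi * I * ω / 2))‖ = Real.exp (Real.pi * ω.im / 2) := by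
    rw [norm_exp]; congr 1; simp; ring
  have hX : ‖exp (2 * Real.pi * I * x)‖ = 1 := by
    rw [norm_exp]; simp
  have h1 : 1 < Real.exp (Real.pi * ω.im / 2) := Real.one_lt_exp_iff.mpr (by positivity)
  have h2 : Real.exp (Real.pi * ω.im / 2) * ‖nome ω‖ < 1 := by
    rw [norm_nome, ← Real.exp_add, Real.exp_lt_one_iff]
    nlinarith [mul_pos Real.pi_pos hω]
  have hp := norm_nome_lt_one hω
  refine mul_ne_zero (mTheta_ne_zero_of_norm hp ?_ ?_) (mTheta_ne_zero_of_norm hp ?_ ?_)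
  · rwa [norm_mul, hn, hX, mul_one]
  · rwa [norm_mul, hn, hX, mul_one]
  · rwa [norm_mul, norm_inv, hn, hX, inv_one, mul_one]
  · rwa [norm_mul, norm_inv, hn, hX, inv_one, mul_one]

lemma differentiable_thetaDen {ω : ℂ} (hω : 0 < ω.im) : Differentiable ℂ (thetaDen ω) := by
  have hq : Differentiable ℂ fun t => qPoch t (nome ω) :=
    differentiable_zeroProd (summable_norm_pow (norm_nome_lt_one hω))
  have hm : ∀ f : ℂ → ℂ, Differentiable ℂ f → (∀ z, f z ≠ 0) →
      Differentiable ℂ fun z => mTheta (f z) (nome ω) := fun f hf h0 =>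
    (hq.comp hf).mul (hq.comp ((hf.inv h0).const_mul (nome ω)))
  refine (hm _ (by fun_prop) fun z => mul_ne_zero (exp_ne_zero _) (exp_ne_zero _)).mul
    (hm _ ?_ fun z => mul_ne_zero (exp_ne_zero _) (inv_ne_zero (exp_ne_zero _)))
  have he : Differentiable ℂ fun z : ℂ => exp (2 * Real.pi * I * z) := by fun_prop
  exact (he.inv fun z => exp_ne_zero _).const_mul _

variable (hη : 0 < η.im) (hτ : 0 < τ.im)

lemma differentiable_theta_pow {ω : ℂ} (hω : 0 < ω.im) (j k : ℕ) :
    Differentiable ℂ fun z => theta3 z ω ^ j * theta4 z ω ^ k :=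
  ((differentiable_vartheta (Or.inl rfl : theta3 = theta3 ∨ theta3 = theta4) hω).pow j).mul
    ((differentiable_vartheta (Or.inr rfl : theta4 = theta3 ∨ theta4 = theta4) hω).pow k)

include hη hτ in
lemma differentiable_phi (n m j l : ℕ) : Differentiable ℂ (phi η τ n m j l) :=
  (differentiable_theta_pow (half_im_pos hτ) j _).mul (differentiable_theta_pow hη l _)

include hη hτ in
lemma isTestFunction_phi (n m j l : ℕ) : IsTestFunction (phi η τ n m j l) := by
  have hd := differentiable_phi hη hτ n m j l
  refine ⟨fun x => (hd.analyticAt x).meromorphicAt, fun z => ?_, fun x => hd.analyticAt x⟩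
  simp only [phi, vartheta_add_one (Or.inl rfl : theta3 = theta3 ∨ theta3 = theta4),
    vartheta_add_one (Or.inr rfl : theta4 = theta3 ∨ theta4 = theta4)]

lemma isTestFunction_div_thetaDen {ω ω' : ℂ} (hω : 0 < ω.im) (hω' : 0 < ω'.im) (j k : ℕ) :
    IsTestFunction fun z => theta3 z ω ^ j * theta4 z ω ^ k / thetaDen ω' z := by
  have hd := differentiable_theta_pow hω j k
  have hD := differentiable_thetaDen hω'
  refine ⟨fun x => (hd.analyticAt x).meromorphicAt.fun_div (hD.analyticAt x).meromorphicAt,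
    fun z => ?_, fun x => (hd.analyticAt x).fun_div (hD.analyticAt x)
      (thetaDen_ofReal_ne_zero hω' x)⟩
  simp only [thetaDen_add_one, vartheta_add_one (Or.inl rfl : theta3 = theta3 ∨ theta3 = theta4),
    vartheta_add_one (Or.inr rfl : theta4 = theta3 ∨ theta4 = theta4)]

lemma div_thetaDen_neg (ω ω' : ℂ) (j k : ℕ) (z : ℂ) :
    theta3 (-z) ω ^ j * theta4 (-z) ω ^ k / thetaDen ω' (-z) =
      theta3 z ω ^ j * theta4 z ω ^ k / thetaDen ω' z := by
  simp only [thetaDen_neg, vartheta_neg (Or.inl rfl : theta3 = theta3 ∨ theta3 = theta4),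
    vartheta_neg (Or.inr rfl : theta4 = theta3 ∨ theta4 = theta4)]

end

end EllipticDouble

end

/-! ### Assembly of the three families. -/

theorem mainTheorem2 (η τ : ℂ) (hη : 0 < η.im) (hτ : 0 < τ.im) :
    -- both lattices, `n, m > 0`
    (∀ n m : ℕ, 0 < n → 0 < m → ∀ j < n, ∀ l < m,
      Differentiable ℂ (EllipticDouble.phi η τ n m j l) ∧
      EllipticDouble.IsTestFunction (EllipticDouble.phi η τ n m j l) ∧
      ∀ ψ : ℂ → ℂ, (Function.Periodic ψ (2 * η) ∨ Function.Periodic ψ τ) →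
        EllipticDouble.IsZeroMode η τ 0 n m
          (fun z => EllipticDouble.phi η τ n m j l z * ψ z) ∧
        EllipticDouble.IsZeroMode η τ (1 / 2) n m
          (fun z => EllipticDouble.phi η τ n m (n - 1 - j) (m - 1 - l) z * ψ z)) ∧
    -- `m = 0`
    (∀ n : ℕ, 0 < n → ∀ j < n,
      EllipticDouble.IsTestFunction (EllipticDouble.phiEta η τ n j) ∧
      ∀ ψ : ℂ → ℂ, Function.Periodic ψ (2 * η) →
        EllipticDouble.IsZeroMode η τ 0 n 0
          (fun z => EllipticDouble.phiEta η τ n j z * ψ z)) ∧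
    -- `n = 0`
    (∀ m : ℕ, 0 < m → ∀ l < m,
      EllipticDouble.IsTestFunction (EllipticDouble.phiTau η τ m l) ∧
      ∀ ψ : ℂ → ℂ, Function.Periodic ψ τ →
        EllipticDouble.IsZeroMode η τ 0 0 m
          (fun z => EllipticDouble.phiTau η τ m l z * ψ z)) := by
  open EllipticDouble in
  refine ⟨fun n m hn hm j hj l hl => ⟨differentiable_phi hη hτ n m j l,
    isTestFunction_phi hη hτ n m j l, fun ψ hψ => ?_⟩, fun n hn j hj =>
    ⟨isTestFunction_div_thetaDen (half_im_pos hτ) (two_mul_im_pos hη) _ _, fun ψ hψ => ?_⟩,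
    fun m hm l hl => ⟨isTestFunction_div_thetaDen hη hτ _ _, fun ψ hψ => ?_⟩⟩
  · have hψ' := hψ.imp periodic_evenPart periodic_evenPart
    exact ⟨isZeroMode_mul hη hτ (Or.inl rfl) (phi_neg η τ n m _ _)
        (fun _ h => diffKills_phi hη hτ hj hl (Or.inl rfl) h) hψ hψ',
      -- The reversed indices n-1-j and m-1-l run through the same ranges, which is all that is
      -- used.
      isZeroMode_mul hη hτ (Or.inr rfl) (phi_neg η τ n m _ _)
        (fun _ h => diffKills_phi hη hτ (by omega) (by omega) (Or.inr rfl) h) hψ hψ'⟩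
  · exact isZeroMode_mul hη hτ (Or.inl rfl) (div_thetaDen_neg _ _ _ _)
      (fun _ h => diffKills_phiEta hη hτ hj h) hψ (periodic_evenPart hψ)
  · exact isZeroMode_mul hη hτ (Or.inl rfl) (div_thetaDen_neg _ _ _ _)
      (fun _ h => diffKills_phiTau hη hτ hl h) hψ (periodic_evenPart hψ)
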